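/- Let $q\in\mathbb C\setminus\{0\}$ be either $q=1$ or not a root of unity (in particular any real $q>0$ is allowed). Put $q^x=e^{x\log q}$ with the principal logarithm, $[x]=(q^x-q^{-x})/(q-q^{-1})$ for $q\ne 1$ and $[x]=x$ for $q=1$, $[n]!=[n][n-1]\cdots[1]$, $[0]!=1$, and $1/[n]!=0$ for negative integers $n$. Fix the principal square root of every $[n]!$ (the positive root for $q>0$), and let $$\nabla[abc]=\left(\frac{[a+b-c]!\,[a-b+c]!\,[a+b+c+1]!}{[b+c-a]!}\right)^{1/2},\qquad \Delta[abc]=\left(\frac{[a+b-c]!\,[a-b+c]!\,[b+c-a]!}{[a+b+c+1]!}\right)^{1/2},$$ where the roots are taken factor by factor. A triple of numbers in $\{0,\tfrac12,1,\tfrac32,\dots\}$ is a triad if $|a-b|\le c\le a+b$ and $a+b+c\in\mathbb Z$. The $q$-$6j$ coefficient of $u_q(2)$ is $$\left\{\begin{array}{ccc}a&b&e\\ d&c&f\end{array}\right\}_q=\Delta[abe]\Delta[acf]\Delta[dbf]\Delta[dce]\sum_z\frac{(-1)^z[z+1]!}{[z-a-b-e]!\,[z-a-c-f]!\,[z-d-b-f]!\,[z-d-c-e]!\,[a+b+c+d-z]!\,[a+d+e+f-z]!\,[b+c+e+f-z]!}$$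 if $(abe),(acf),(dbf),(dce)$ are triads, and $0$ otherwise. With $Z_{deh}=-d(d+1)-e(e+1)-h(h+1)$, the $q$-$9j$ coefficient of $u_q(2)$ (Nomura's convention) is $$\left\{\begin{array}{ccc}a&b&e\\ c&d&f\\ h&k&g\end{array}\right\}_q=\sum_{j\in\{0,\frac12,1,\dots\}}(-1)^{2j}q^{Z_{deh}-j(j+1)}[2j+1]\left\{\begin{array}{ccc}a&c&h\\ k&g&j\end{array}\right\}_q\left\{\begin{array}{ccc}k&j&c\\ f&d&b\end{array}\right\}_q\left\{\begin{array}{ccc}a&g&j\\ f&b&e\end{array}\right\}_q .$$ Suppose that the rows $(abe),(cdf),(hkg)$ and the columns $(ach),(bdk),(efg)$ are triads. Then this $q$-$9j$ coefficient is equal to each of the following five expressions, where the sums run over the non-negative integers $z_1,z_2,z_3$ for which the arguments of all the factorials in the denominators are non-negative. (1) $$(-1)^{c+h-a}\frac{\nabla[abe]\nabla[feg]\nabla[kbd]}{\nabla[ach]\nabla[fcd]\nabla[kgh]}\,q^{(f+h-e-k)(a+d-e+k+1)-(a-e+f)(a-e+f+1)+Z_{deh}}$$ $$\times\sum_{z_1,z_2,z_3}\frac{(-1)^{z_1+z_2+z_3}[g-h+k+z_1]!\,[a+c-h+z_1]!\,[2h-z_1]!}{[z_1]!\,[g+h-k-z_1]!\,[c-a+h-z_1]!}\cdot\frac{[2d-z_2]!\,[c-d+f+z_2]!}{[z_2]!\,[d-b+k-z_2]!\,[c+d-f-z_2]!\,[b+d+k-z_2+1]!}$$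 $$\times\frac{[b+e-a+z_3]!\,[e-f+g+z_3]!}{[z_3]!\,[a+b-e-z_3]!\,[f+g-e-z_3]!\,[2e+z_3+1]!}\cdot\frac{q^{-z_1(a+d-e+k-z_2-z_3+1)+z_2(e-f-h+k+z_3)+z_3(a-d+f-h)}\,[a+d-e+k-z_2-z_3]!}{[a-d+f-h+z_1+z_2]!\,[e-f-h+k+z_1+z_3]!};$$ (2) $$(-1)^{e-f-h+k}\frac{\nabla[abe]\nabla[feg]\nabla[kbd]}{\nabla[ach]\nabla[fcd]\nabla[kgh]}\,q^{(b+e-a)(e-f-h+k)-(a-e+f+1)(a-e+f)+Z_{deh}}$$ $$\times\sum_{z_1,z_2,z_3}\frac{(-1)^{z_1+z_2}[a+c-h+z_1]!\,[g-h+k+z_1]!\,[2h-z_1]!}{[z_1]!\,[c+h-a-z_1]!\,[g+h-k-z_1]!}\cdot\frac{[2b-z_2]!\,[b-c+f+k-z_2]!\,[b+c+f+k-z_2+1]!}{[z_2]!\,[b-d+k-z_2]!\,[b+d+k-z_2+1]!}$$ $$\times\frac{[b+e-a+z_3]!\,[e-f+g+z_3]!}{[z_3]!\,[a+b-e-z_3]!\,[f+g-e-z_3]!\,[2e+z_3+1]!}\cdot\frac{q^{z_1(b+e-a-z_2+z_3)+z_3(a+b+f-h+k-z_2+1)-z_2(e+k-f-h)}}{[e+k-f-h+z_1+z_3]!\,[b+e-a-z_2+z_3]!\,[a+b+f-h+k+z_1-z_2+1]!};$$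 (3) $$(-1)^{c-d+f}\frac{\nabla[ach]\nabla[feg]\nabla[kbd]}{\nabla[abe]\nabla[fcd]\nabla[kgh]}\,q^{(c-d+f)(a+g)-(d-f+k)(c+k+1)+Z_{deh}}$$ $$\times\sum_{z_1,z_2,z_3}\frac{(-1)^{z_1+z_3}[a+c-g+k-z_1]!\,[a+c+g+k-z_1+1]!\,[2c-z_1]!}{[z_1]!\,[a+c-h-z_1]!\,[a+c+h-z_1+1]!}\cdot\frac{[2d-z_2]!\,[c-d+f+z_2]!}{[z_2]!\,[d-b+k-z_2]!\,[c+d-f-z_2]!\,[b+d+k-z_2+1]!}$$ $$\times\frac{[a-b+f+g-z_3]!\,[a+b+f+g-z_3+1]!\,[2g-z_3]!}{[z_3]!\,[f+g-e-z_3]!\,[e+f+g-z_3+1]!}\cdot\frac{q^{-z_1(a-d+f+g-k+z_2-z_3)+z_2(a+c+g+k-z_3+1)-z_3(c-d+f)}}{[c-d+f-z_1+z_2]!\,[a-d+f+g-k+z_2-z_3]!\,[a+c+g+k-z_1-z_3+1]!};$$ (4) $$(-1)^{b-a+f-g}\frac{\nabla[ach]\nabla[feg]\nabla[kbd]}{\nabla[abe]\nabla[fcd]\nabla[kgh]}\,q^{-(a+h-k+1)(a+b-e)-(e+f-a)(b+f+1)+Z_{deh}}$$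 $$\times\sum_{z_1,z_2,z_3}\frac{(-1)^{z_1+z_2+z_3}[2h-z_1]!\,[g-h+k+z_1]!}{[z_1]!\,[a-c+h-z_1]!\,[g+h-k-z_1]!\,[a+c+h-z_1+1]!}\cdot\frac{[2b-z_2]!\,[b-c+f+k-z_2]!\,[b+c+f+k-z_2+1]!}{[z_2]!\,[b-d+k-z_2]!\,[b+d+k-z_2+1]!}$$ $$\times\frac{[2e-z_3]!\,[a+b-e+z_3]!}{[z_3]!\,[e+f-g-z_3]!\,[b-a+e-z_3]!\,[e+f+g-z_3+1]!}\cdot\frac{q^{z_1(a+b-e-z_2+z_3)+z_2(e+f+h-k-z_3+1)+z_3(b-a+f-h+k)}\,[e+f-k+h-z_1-z_3]!}{[b+f-h+k-a+z_1-z_2]!\,[a+b-e-z_2+z_3]!};$$ (5) $$(-1)^{c-b+e-g+k}\frac{\nabla[abe]\nabla[feg]\nabla[kbd]}{\nabla[ach]\nabla[fcd]\nabla[khg]}\,q^{Z_{deh}-(a-b-h+f+k)(a+b+e+2)-(b-f)(b-f+1)+(d-b+k)(e+f+h-k+1)}$$ $$\times\sum_{z_1,z_2,z_3}\frac{[k+g-h+z_1]!\,[a+c-h+z_1]!\,[2h-z_1]!}{[z_1]!\,[g+h-k-z_1]!\,[c-a+h-z_1]!}\cdot\frac{(-1)^{z_2+z_3}[2d-z_2]!\,[c-d+f+z_2]!}{[z_2]!\,[d-b+k-z_2]!\,[c+d-f-z_2]!\,[b+d+k-z_2+1]!}$$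 $$\times\frac{[2e-z_3]!\;q^{z_3(a-d+f-h+z_1+z_2)-z_2(e+f+h-k-z_1+1)-z_1(a+d+e+k+2)}}{[z_3]!\,[a-b+e-z_3]!\,[e+f-g-z_3]!\,[e+f+g-z_3+1]!}\cdot\frac{[a+d+e+k-z_2-z_3+1]!\,[e+f+h-k-z_1-z_3]!}{[a+b+e-z_3+1]!\,[a-d+f-h+z_1+z_2]!}.$$ For $q=1$ these are five triple-sum formulas for the usual $9j$ coefficients of $SU(2)$. -/

import Mathlib

noncomputable section

namespace QNineJ

/-- `q ^ x` for a rational exponent (principal branch; for `q > 0` the usual real power). -/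
def qPow (q : ℂ) (x : ℚ) : ℂ := q ^ (x : ℂ)

/-- The `q`-number `[x] = (q^x - q^(-x)) / (q - q^(-1))`, which is `x` for `q = 1`. -/
def qNum (q : ℂ) (x : ℚ) : ℂ :=
  if q = 1 then (x : ℂ) else (qPow q x - qPow q (-x)) / (q - q⁻¹)

/-- The `q`-factorial `[x]! = [x][x-1]⋯[1]`, meant for non-negative integers `x`. -/
def qFact (q : ℂ) (x : ℚ) : ℂ := ∏ i ∈ Finset.range ⌊x⌋₊, qNum q ((i : ℚ) + 1)

/-- `1 / [x]!`, with the convention `1 / [x]! = 0` for negative `x`: this is how the factorials in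
the denominators restrict the summation intervals. -/
def qInvFact (q : ℂ) (x : ℚ) : ℂ := if x < 0 then 0 else (qFact q x)⁻¹

/-- The quotient `∏ [xᵢ]! / ∏ [yᵢ]!` of products of `q`-factorials. -/
def qRatio (q : ℂ) (num den : List ℚ) : ℂ :=
  (num.map (qFact q)).prod * (den.map (qInvFact q)).prod

/-- The sign `(-1)^x`, meant for integers `x`. -/
def sgn (x : ℚ) : ℂ := (-1 : ℂ) ^ ⌊x⌋

/-- A (non-zero) deformation parameter which is not a root of unity, or `q = 1`. -/
def IsGeneric (q : ℂ) : Prop := q ≠ 0 ∧ (q = 1 ∨ ∀ n : ℕ, 0 < n → q ^ n ≠ 1)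

/-- Angular momenta: `0, 1/2, 1, 3/2, …`. -/
def IsSpin (a : ℚ) : Prop := ∃ n : ℕ, a = n / 2

/-- The triangular conditions for three angular momenta. -/
def Triad (a b c : ℚ) : Prop :=
  IsSpin a ∧ IsSpin b ∧ IsSpin c ∧ |a - b| ≤ c ∧ c ≤ a + b ∧ ∃ n : ℤ, a + b + c = n

/-- The square root of `[x]!` (principal branch; for `q > 0` the positive square root). -/
def qFactSqrt (q : ℂ) (x : ℚ) : ℂ := qFact q x ^ (1 / 2 : ℂ)

/-- The asymmetric triangle coefficient
`∇[abc] = ([a+b-c]! [a-b+c]! [a+b+c+1]! / [b+c-a]!)^(1/2)`.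
The root is taken factor by factor, which fixes a coherent branch for complex `q`. -/
def nabla (q : ℂ) (a b c : ℚ) : ℂ :=
  qFactSqrt q (a + b - c) * qFactSqrt q (a - b + c) * qFactSqrt q (a + b + c + 1)
    / qFactSqrt q (b + c - a)

/-- The symmetric triangle coefficient
`Δ[abc] = ([a+b-c]! [a-b+c]! [b+c-a]! / [a+b+c+1]!)^(1/2)`, the root taken factor by factor. -/
def triDelta (q : ℂ) (a b c : ℚ) : ℂ :=
  qFactSqrt q (a + b - c) * qFactSqrt q (a - b + c) * qFactSqrt q (b + c - a)
    / qFactSqrt q (a + b + c + 1)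

open Classical in
/-- The `q`-`6j` coefficient of `u_q(2)` with upper row `a b e` and lower row `d c f`, given by the
(most symmetric) Racah formula; it vanishes if a triangular condition fails. -/
def sixJ (q : ℂ) (a b e d c f : ℚ) : ℂ :=
  if Triad a b e ∧ Triad a c f ∧ Triad d b f ∧ Triad d c e then
    triDelta q a b e * triDelta q a c f * triDelta q d b f * triDelta q d c e *
      ∑ z ∈ Finset.range (⌊a + b + c + d⌋₊ + 1),
        sgn z * qRatio q [(z : ℚ) + 1]
          [z - (a + b + e), z - (a + c + f), z - (d + b + f), z - (d + c + e),
            a + b + c + d - z, a + d + e + f - z, b + c + e + f - z]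
  else 0

/-- `Z_{deh} = -d(d+1) - e(e+1) - h(h+1)`. -/
def Zexp (d e h : ℚ) : ℚ := -d * (d + 1) - e * (e + 1) - h * (h + 1)

/-- The `q`-`9j` coefficient of `u_q(2)` in Nomura's convention, with rows `a b e`, `c d f`,
`h k g`. The sum is over all `j = n/2`; the `q`-`6j` coefficients vanish unless `(agj)`, `(ckj)` and
`(bfj)` satisfy the triangular conditions, so that `j ≤ a + g` in all the non-zero terms. -/
def nineJ (q : ℂ) (a b e c d f h k g : ℚ) : ℂ :=
  ∑ n ∈ Finset.range (⌊2 * (a + g)⌋₊ + 1),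
    let j : ℚ := n / 2
    sgn (2 * j) * qPow q (Zexp d e h - j * (j + 1)) * qNum q (2 * j + 1) *
      sixJ q a c h k g j * sixJ q k j c f d b * sixJ q a g j f b e

/-- A triple sum of `F z₁ z₂ z₃` over the integers `0 ≤ zᵢ ≤ Nᵢ`. -/
def tripleSum (N₁ N₂ N₃ : ℚ) (F : ℚ → ℚ → ℚ → ℂ) : ℂ :=
  ∑ z₁ ∈ Finset.range (⌊N₁⌋₊ + 1), ∑ z₂ ∈ Finset.range (⌊N₂⌋₊ + 1),
    ∑ z₃ ∈ Finset.range (⌊N₃⌋₊ + 1), F z₁ z₂ z₃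

end QNineJ

end

noncomputable section

namespace QNineJ

open Finset

/-! ### Powers and `q`-numbers -/

/-! Up to triangle coefficients, each of the three 6j coefficients under the sum over j is a Racah
sum, that is, a balanced terminating ₄φ₃ series. Sears' transformation (`qSears`) rewrites it so
that, apart from a prefactor, j enters each term only through a "pair" 1/([x-j]! [x+j+1]!)
(representations A and C, `hatA` and `hatC`) or a "ratio" [u+j]!/[j-u]! (representations B and D,
`hatB` and `hatD`). For the choices A·B·D and B·B·C the j-dependent prefactors of the three Racah
sums exactly cancel the squares of Δ[agj], Δ[bfj], Δ[ckj], and the signs lose their dependence on j.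

What is left is the sum over j of q^(-j(j+1)) [2j+1] times one pair and two ratios. It has a closed
form (`jsum_jRatio_jRatio_jPair`), because the sum and its value obey one recurrence, which comes
from [x-u][x+u+1] = [j-u][j+u+1] + [x-j][x+j+1]. The closed form needs j to run over a whole class
modulo 1, while the 6j coefficients live on a triangle region only. Outside this region the product
of the three representations vanishes: some of the triangle inequalities are enforced by inverse
factorials, the others by `sum_qBin_prod_eq_zero`, the q-analogue of the fact that an n-th
difference kills polynomials of degree less than n. Thus A·B·D yields formula (1), and B·B·C, after
a cyclic permutation that leaves the j-summand unchanged, yields formula (4).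

Formulas (2), (3) and (5) arise by exchanging one representation after the summation over j: B for C
in A·B·D, the first B for C in B·B·C, and D for a further form E in A·B·D. Both sides of such an
exchange satisfy the same recurrence in the ratio parameter u and the pair parameter x, so only the
smallest u has to be checked; there two ₃φ₂ transformations (`qThreePhiTwo`) lead to a common single
sum. Two defects are repaired by the vanishing sums: terms in which the factorial [u+v]! would have
a negative argument, and, for E, a correction at x > b+f, which becomes a combination of zero values
of `hatB` once the B-sum is carried out.

All hypergeometric identities are kept in a form cleared of denominators (q-binomials times shifted
factorials), so that they hold for arbitrary rational parameters without case distinctions. -/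

lemma qPow_add {q : ℂ} (hq : q ≠ 0) (x y : ℚ) : qPow q (x + y) = qPow q x * qPow q y := by
  unfold qPow; push_cast; exact Complex.cpow_add _ _ hq

lemma qPow_zero (q : ℂ) : qPow q 0 = 1 := by simp [qPow]

lemma qPow_neg (q : ℂ) (x : ℚ) : qPow q (-x) = (qPow q x)⁻¹ := by
  unfold qPow; push_cast; exact Complex.cpow_neg _ _

lemma qPow_sub {q : ℂ} (hq : q ≠ 0) (x y : ℚ) : qPow q (x - y) = qPow q x / qPow q y := by
  rw [sub_eq_add_neg, qPow_add hq, qPow_neg, div_eq_mul_inv]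

lemma qPow_ne_zero {q : ℂ} (hq : q ≠ 0) (x : ℚ) : qPow q x ≠ 0 := by
  unfold qPow; simp [Complex.cpow_eq_zero_iff, hq]

lemma qPow_base_one (x : ℚ) : qPow 1 x = 1 := by simp [qPow]

lemma qPow_intCast (q : ℂ) (n : ℤ) : qPow q n = q ^ n := by
  unfold qPow; push_cast; exact Complex.cpow_intCast _ _

lemma IsGeneric.ne_zero {q : ℂ} (hq : IsGeneric q) : q ≠ 0 := hq.1

lemma IsGeneric.zpow_ne_one {q : ℂ} (hq : IsGeneric q) (h1 : q ≠ 1) {n : ℤ} (hn : n ≠ 0) :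
    q ^ n ≠ 1 := by
  have h := hq.2.resolve_left h1
  rcases Int.natAbs_eq n with h' | h' <;> rw [h']
  · rw [zpow_natCast]; exact h n.natAbs (by omega)
  · rw [zpow_neg, zpow_natCast, ne_eq, inv_eq_one]; exact h n.natAbs (by omega)

lemma IsGeneric.sub_inv_ne_zero {q : ℂ} (hq : IsGeneric q) (h1 : q ≠ 1) : q - q⁻¹ ≠ 0 := by
  have h := hq.zpow_ne_one h1 (n := 2) (by norm_num)
  intro h'
  apply h
  have h0 := hq.ne_zero
  field_simp at h'
  have : q ^ (2 : ℤ) = q ^ 2 := by norm_cast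
  rw [this]
  linear_combination h'

lemma qNum_base_one (x : ℚ) : qNum 1 x = x := by simp [qNum]

lemma qNum_of_ne {q : ℂ} (h1 : q ≠ 1) (x : ℚ) :
    qNum q x = (qPow q x - (qPow q x)⁻¹) / (q - q⁻¹) := by
  rw [qNum, if_neg h1, qPow_neg]

lemma qNum_zero (q : ℂ) : qNum q 0 = 0 := by
  by_cases h : q = 1
  · simp [qNum, h]
  · simp [qNum, h, qPow_zero]

lemma qNum_neg (q : ℂ) (x : ℚ) : qNum q (-x) = -qNum q x := by
  by_cases h : q = 1
  · simp [qNum, h]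
  · simp [qNum, h]; ring

lemma qNum_intCast_ne_zero {q : ℂ} (hq : IsGeneric q) {n : ℤ} (hn : n ≠ 0) :
    qNum q n ≠ 0 := by
  by_cases h : q = 1
  · subst h; rw [qNum_base_one]; exact_mod_cast hn
  · rw [qNum_of_ne h]
    refine div_ne_zero ?_ (hq.sub_inv_ne_zero h)
    rw [qPow_intCast]
    intro h'
    have h0 : q ^ n ≠ 0 := zpow_ne_zero _ hq.ne_zero
    have : q ^ (2 * n) = 1 := by
      rw [two_mul, zpow_add₀ hq.ne_zero]
      field_simp at h'
      linear_combination h'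
    exact hq.zpow_ne_one h (by omega) this

/-- Addition formula for `q`-numbers. -/
lemma qNum_add {q : ℂ} (hq : IsGeneric q) (x y : ℚ) :
    qNum q (x + y) = qPow q y * qNum q x + qPow q (-x) * qNum q y := by
  by_cases h : q = 1
  · subst h; simp only [qNum_base_one, qPow_base_one]; push_cast; ring
  · have hs := hq.sub_inv_ne_zero h
    have hx := qPow_ne_zero hq.ne_zero x
    have hy := qPow_ne_zero hq.ne_zero y
    simp only [qNum_of_ne h, qPow_add hq.ne_zero, qPow_neg]
    generalize q - q⁻¹ = s at *
    field_simp
    ring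

lemma qNum_add' {q : ℂ} (hq : IsGeneric q) (x y : ℚ) :
    qNum q (x + y) = qPow q (-y) * qNum q x + qPow q x * qNum q y := by
  rw [add_comm, qNum_add hq]; ring

/-- The cubic relation between `q`-numbers behind the `q`-Saalschütz summation. -/
lemma qNum_saalschutz_relation {q : ℂ} (hq : IsGeneric q) (a b c n s : ℚ) :
    qNum q (n + 1) * qNum q (c + n) * qNum q (c - a - b + n - s)
      - qNum q (c - a + n) * qNum q (c - b + n) * qNum q (n + 1 - s)
    = qNum q s * qNum q (c - a - b + n - s) * qNum q (c + s - 1)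
      - qNum q (n + 1 - s) * qNum q (a + s) * qNum q (b + s) := by
  by_cases h : q = 1
  · subst h; simp only [qNum_base_one]; push_cast; ring
  · have hs := hq.sub_inv_ne_zero h
    have ha := qPow_ne_zero hq.ne_zero a
    have hb := qPow_ne_zero hq.ne_zero b
    have hc := qPow_ne_zero hq.ne_zero c
    have hn := qPow_ne_zero hq.ne_zero n
    have hs' := qPow_ne_zero hq.ne_zero s
    have h1 := qPow_ne_zero hq.ne_zero 1
    simp only [qNum_of_ne h, qPow_add hq.ne_zero, qPow_sub hq.ne_zero]
    -- Every term is cubic in q-numbers, so the common denominator may be treated as an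
    -- indeterminate; the rest is an identity of Laurent polynomials in the powers of q.
    generalize q - q⁻¹ = t at *
    field_simp
    ring

/-! ### Integral rational numbers, `q`-factorials and shifted `q`-factorials -/

/-- `x` is a non-negative integer. -/
def IsNat (x : ℚ) : Prop := ∃ n : ℕ, x = n

/-- `x` is an integer. -/
def IsInt (x : ℚ) : Prop := ∃ n : ℤ, x = n

lemma isNat_natCast (n : ℕ) : IsNat n := ⟨n, rfl⟩

lemma isInt_natCast (n : ℕ) : IsInt n := ⟨n, by simp⟩

lemma isNat_one : IsNat 1 := ⟨1, by simp⟩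

lemma isInt_one : IsInt 1 := ⟨1, by simp⟩

lemma IsNat.isInt {x : ℚ} (h : IsNat x) : IsInt x := by
  obtain ⟨n, rfl⟩ := h; exact isInt_natCast n

lemma IsNat.nonneg {x : ℚ} (h : IsNat x) : 0 ≤ x := by
  obtain ⟨n, rfl⟩ := h; positivity

lemma IsInt.isNat {x : ℚ} (h : IsInt x) (h0 : 0 ≤ x) : IsNat x := by
  obtain ⟨n, rfl⟩ := h
  have : 0 ≤ n := by exact_mod_cast h0
  obtain ⟨m, rfl⟩ := Int.eq_ofNat_of_zero_le this
  exact ⟨m, by simp⟩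

lemma IsInt.add {x y : ℚ} (hx : IsInt x) (hy : IsInt y) : IsInt (x + y) := by
  obtain ⟨m, rfl⟩ := hx; obtain ⟨n, rfl⟩ := hy; exact ⟨m + n, by push_cast; ring⟩

lemma IsInt.sub {x y : ℚ} (hx : IsInt x) (hy : IsInt y) : IsInt (x - y) := by
  obtain ⟨m, rfl⟩ := hx; obtain ⟨n, rfl⟩ := hy; exact ⟨m - n, by push_cast; ring⟩

lemma IsInt.neg {x : ℚ} (hx : IsInt x) : IsInt (-x) := by
  obtain ⟨m, rfl⟩ := hx; exact ⟨-m, by push_cast; ring⟩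

lemma IsNat.add {x y : ℚ} (hx : IsNat x) (hy : IsNat y) : IsNat (x + y) := by
  obtain ⟨m, rfl⟩ := hx; obtain ⟨n, rfl⟩ := hy; exact ⟨m + n, by push_cast; ring⟩

/-- `x < 0` implies `x ≤ -1` for integers. -/
lemma IsInt.le_neg_one {x : ℚ} (hx : IsInt x) (h : x < 0) : x ≤ -1 := by
  obtain ⟨m, rfl⟩ := hx
  have : m < 0 := by exact_mod_cast h
  have : m ≤ -1 := by omega
  exact_mod_cast this

lemma qNum_ne_zero {q : ℂ} (hq : IsGeneric q) {x : ℚ} (hx : IsInt x) (h : x ≠ 0) :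
    qNum q x ≠ 0 := by
  obtain ⟨n, rfl⟩ := hx
  exact qNum_intCast_ne_zero hq (by rintro rfl; simp at h)

lemma qFact_zero (q : ℂ) : qFact q 0 = 1 := by simp [qFact]

lemma qFact_natCast (q : ℂ) (n : ℕ) : qFact q n = ∏ i ∈ range n, qNum q ((i : ℚ) + 1) := by
  simp [qFact]

lemma qFact_add_one {q : ℂ} {x : ℚ} (hx : IsNat x) :
    qFact q (x + 1) = qNum q (x + 1) * qFact q x := by
  obtain ⟨n, rfl⟩ := hx
  have : ((n : ℚ) + 1) = ((n + 1 : ℕ) : ℚ) := by push_cast; ring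
  rw [this, qFact_natCast, qFact_natCast, prod_range_succ, mul_comm]
  push_cast; ring

lemma qFact_ne_zero {q : ℂ} (hq : IsGeneric q) (x : ℚ) : qFact q x ≠ 0 := by
  unfold qFact
  refine prod_ne_zero_iff.2 fun i _ => qNum_ne_zero hq ⟨i + 1, by push_cast; ring⟩ ?_
  positivity

lemma qInvFact_of_neg {q : ℂ} {x : ℚ} (hx : x < 0) : qInvFact q x = 0 := by simp [qInvFact, hx]

lemma qInvFact_of_nonneg {q : ℂ} {x : ℚ} (hx : 0 ≤ x) : qInvFact q x = (qFact q x)⁻¹ := by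
  simp [qInvFact, not_lt.2 hx]

lemma qInvFact_zero (q : ℂ) : qInvFact q 0 = 1 := by
  simp [qInvFact, qFact_zero]

lemma qFact_mul_qInvFact {q : ℂ} (hq : IsGeneric q) {x : ℚ} (hx : 0 ≤ x) :
    qFact q x * qInvFact q x = 1 := by
  rw [qInvFact_of_nonneg hx, mul_inv_cancel₀ (qFact_ne_zero hq x)]

lemma qInvFact_ne_zero {q : ℂ} (hq : IsGeneric q) {x : ℚ} (hx : 0 ≤ x) : qInvFact q x ≠ 0 := by
  rw [qInvFact_of_nonneg hx]; exact inv_ne_zero (qFact_ne_zero hq x)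

/-- Valid at every integer: at x = 0 the zero of [0] matches the convention 1/[-1]! = 0. This is
what lets recurrences pass the ends of summation ranges without boundary terms. -/
lemma qNum_mul_qInvFact {q : ℂ} (hq : IsGeneric q) {x : ℚ} (hx : IsInt x) :
    qNum q x * qInvFact q x = qInvFact q (x - 1) := by
  rcases lt_trichotomy x 0 with h | h | h
  · rw [qInvFact_of_neg h, qInvFact_of_neg (by linarith), mul_zero]
  · subst h; rw [qNum_zero, qInvFact_of_neg (x := 0 - 1) (by norm_num), zero_mul]
  · have h1 : IsNat (x - 1) := by
      obtain ⟨m, rfl⟩ := hx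
      have : 0 < m := by exact_mod_cast h
      exact (IsInt.sub ⟨m, rfl⟩ isInt_one).isNat (by
        have : (1 : ℤ) ≤ m := by omega
        have : (1 : ℚ) ≤ m := by exact_mod_cast this
        linarith)
    have h2 := qFact_add_one (q := q) h1
    rw [sub_add_cancel] at h2
    rw [qInvFact_of_nonneg h.le, qInvFact_of_nonneg h1.nonneg, h2]
    have := qFact_ne_zero hq (x - 1)
    have := qNum_ne_zero hq hx h.ne'
    field_simp

lemma qInvFact_sub_one {q : ℂ} (hq : IsGeneric q) {x : ℚ} (hx : IsInt x) :
    qInvFact q (x - 1) = qNum q x * qInvFact q x := (qNum_mul_qInvFact hq hx).symm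

/-- The shifted `q`-factorial `[x][x+1]⋯[x+n-1]`. -/
def qPoch (q : ℂ) (x : ℚ) (n : ℕ) : ℂ := ∏ i ∈ range n, qNum q (x + i)

lemma qPoch_zero (q : ℂ) (x : ℚ) : qPoch q x 0 = 1 := by simp [qPoch]

lemma qPoch_succ (q : ℂ) (x : ℚ) (n : ℕ) :
    qPoch q x (n + 1) = qPoch q x n * qNum q (x + n) := by simp [qPoch, prod_range_succ]

lemma qPoch_add (q : ℂ) (x : ℚ) (m n : ℕ) :
    qPoch q x (m + n) = qPoch q x m * qPoch q (x + m) n := by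
  simp [qPoch, prod_range_add, add_assoc]

lemma qPoch_succ' (q : ℂ) (x : ℚ) (n : ℕ) :
    qPoch q x (n + 1) = qNum q x * qPoch q (x + 1) n := by
  rw [add_comm, qPoch_add]; simp [qPoch]

/-- The factors are read in reverse order and [-x] = -[x] is applied to each. -/
lemma qPoch_neg (q : ℂ) (x : ℚ) (n : ℕ) :
    qPoch q x n = (-1) ^ n * qPoch q (1 - x - n) n := by
  unfold qPoch
  rw [← prod_range_reflect]
  rw [← card_range n, ← prod_const, card_range, ← prod_mul_distrib]
  refine prod_congr rfl fun i hi => ?_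
  have hi' := mem_range.1 hi
  rw [neg_one_mul, ← qNum_neg]
  congr 1
  rw [Nat.sub_sub, Nat.cast_sub (by omega)]
  push_cast; ring

lemma qFact_add_natCast {q : ℂ} {x : ℚ} (hx : IsNat x) (n : ℕ) :
    qFact q (x + n) = qFact q x * qPoch q (x + 1) n := by
  induction n with
  | zero => simp [qPoch_zero]
  | succ n ih =>
    have : x + ((n + 1 : ℕ) : ℚ) = (x + n) + 1 := by push_cast; ring
    rw [this, qFact_add_one (hx.add (isNat_natCast n)), ih, qPoch_succ]
    rw [show x + n + 1 = x + 1 + n by ring]; ring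

/-- No sign condition on x is needed: if x < 0 ≤ x + n, the product contains the factor [0], in
agreement with 1/[x]! = 0. -/
lemma qInvFact_eq_qPoch_mul {q : ℂ} (hq : IsGeneric q) {x : ℚ} (hx : IsInt x) (n : ℕ) :
    qInvFact q x = qPoch q (x + 1) n * qInvFact q (x + n) := by
  induction n with
  | zero => simp [qPoch_zero]
  | succ n ih =>
    have h : qInvFact q (x + n) = qNum q (x + n + 1) * qInvFact q (x + n + 1) := by
      rw [← qInvFact_sub_one hq ((hx.add (isInt_natCast n)).add isInt_one)]; simp
    rw [ih, h, qPoch_succ]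
    push_cast
    rw [show x + 1 + n = x + n + 1 by ring, show x + (n + 1 : ℚ) = x + n + 1 by ring]
    ring

/-- Shift of the argument `x + z` of an inverse factorial to the end `x + n`. -/
lemma qInvFact_add {q : ℂ} (hq : IsGeneric q) {x : ℚ} (hx : IsInt x) {z n : ℕ} (hz : z ≤ n) :
    qInvFact q (x + z) = qPoch q (x + 1 + z) (n - z) * qInvFact q (x + n) := by
  rw [qInvFact_eq_qPoch_mul hq (hx.add (isInt_natCast z)) (n - z)]
  rw [Nat.cast_sub hz]
  congr 2 <;> ring

lemma qInvFact_sub {q : ℂ} (hq : IsGeneric q) {x : ℚ} (hx : IsInt x) (z : ℕ) :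
    qInvFact q (x - z) = (-1) ^ z * qPoch q (-x) z * qInvFact q x := by
  rw [qInvFact_eq_qPoch_mul hq (hx.sub (isInt_natCast z)) z, qPoch_neg q (-x)]
  rw [← mul_assoc, ← mul_pow, show (-1 : ℂ) * -1 = 1 by norm_num, one_pow, one_mul]
  congr 2 <;> ring

/-- Unlike for inverse factorials, the smallest argument x - n has to be non-negative here, since
`qFact` takes the default value 1 at negative arguments. -/
lemma qFact_sub {q : ℂ} {x : ℚ} {z n : ℕ} (hx : IsNat (x - n)) (hz : z ≤ n) :
    qFact q (x - z) = (-1) ^ (n - z) * qPoch q (-x + z) (n - z) * qFact q (x - n) := by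
  have h := qFact_add_natCast (q := q) hx (n - z)
  rw [Nat.cast_sub hz] at h
  rw [show x - z = x - n + (n - z) by ring, h, qPoch_neg q (-x + z), Nat.cast_sub hz, ← mul_assoc,
    ← mul_pow, show (-1 : ℂ) * -1 = 1 by norm_num, one_pow, one_mul, mul_comm]
  congr 2; ring

/-- The `q`-binomial coefficient. -/
def qBin (q : ℂ) (n z : ℕ) : ℂ := qFact q n * qInvFact q z * qInvFact q ((n : ℚ) - z)

/-! ### Summation and transformation formulas for terminating series -/

/-- A character `P` compatible with the addition formula for `q`-numbers: `x ↦ q^x` or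
`x ↦ q^(-x)`. -/
structure IsQPow (q : ℂ) (P : ℚ → ℂ) : Prop where
  zero : P 0 = 1
  add : ∀ x y, P (x + y) = P x * P y
  num : ∀ x y, qNum q (x + y) = P y * qNum q x + P (-x) * qNum q y

lemma IsQPow.num' {q : ℂ} {P : ℚ → ℂ} (hP : IsQPow q P) (x y : ℚ) :
    qNum q (x + y) = P (-y) * qNum q x + P x * qNum q y := by
  rw [add_comm, hP.num]; ring

lemma isQPow_qPow {q : ℂ} (hq : IsGeneric q) : IsQPow q (qPow q) :=
  ⟨qPow_zero q, qPow_add hq.ne_zero, qNum_add hq⟩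

lemma isQPow_qPow_neg {q : ℂ} (hq : IsGeneric q) : IsQPow q (fun x => qPow q (-x)) := by
  refine ⟨by simp [qPow_zero], fun x y => ?_, fun x y => ?_⟩
  · rw [← qPow_add hq.ne_zero]; congr 1; ring
  · rw [qNum_add' hq, neg_neg]

section Series
variable {q : ℂ}

lemma qBin_zero_zero : qBin q 0 0 = 1 := by simp [qBin, qFact_zero, qInvFact_zero]

lemma qBin_of_lt {n z : ℕ} (h : n < z) : qBin q n z = 0 := by
  have : ((n : ℚ) - z) < 0 := by
    have : (n : ℚ) < z := by exact_mod_cast h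
    linarith
  rw [qBin, qInvFact_of_neg this, mul_zero]

variable (hq : IsGeneric q)
include hq

lemma qBin_zero_right (n : ℕ) : qBin q n 0 = 1 := by
  simp [qBin, qInvFact_zero, qFact_mul_qInvFact hq]

lemma qBin_self (n : ℕ) : qBin q n n = 1 := by
  simp [qBin, qInvFact_zero, qFact_mul_qInvFact hq]

/-- The q-Pascal rule, from the addition formula for [n+1] = [(n-z) + (z+1)]. Either character q^x
or q^(-x) may carry the weights, and both are needed later. -/
lemma qBin_succ_succ {P : ℚ → ℂ} (hP : IsQPow q P) (n z : ℕ) :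
    qBin q (n + 1) (z + 1) = P (-((z : ℚ) + 1)) * qBin q n (z + 1)
      + P ((n : ℚ) - z) * qBin q n z := by
  unfold qBin
  have h1 : qInvFact q ((n : ℚ) - (z + 1 : ℕ)) =
      qNum q ((n : ℚ) - z) * qInvFact q ((n : ℚ) - z) := by
    rw [← qInvFact_sub_one hq ((isInt_natCast n).sub (isInt_natCast z))]
    congr 1; push_cast; ring
  have h2 : qInvFact q z = qNum q ((z : ℚ) + 1) * qInvFact q ((z : ℚ) + 1) := by
    rw [← qInvFact_sub_one hq ((isInt_natCast z).add isInt_one)]; simp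
  have h3 := hP.num' ((n : ℚ) - z) ((z : ℚ) + 1)
  have h4 := qFact_add_one (q := q) (isNat_natCast n)
  rw [h1]
  push_cast
  rw [h2, h4, show (n : ℚ) + 1 - (z + 1) = n - z by ring, show (n : ℚ) + 1 = n - z
      + (z + 1) by ring,
    h3]
  ring

/-- Pascal's rule under a summation sign: the step from n to n+1 in inductions on terminating
series. -/
lemma sum_qBin_succ {P : ℚ → ℂ} (hP : IsQPow q P) (n : ℕ) (f : ℕ → ℂ) :
    ∑ z ∈ range (n + 2), qBin q (n + 1) z * f z =
      ∑ z ∈ range (n + 1), qBin q n z * (P (-(z : ℚ)) * f z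
        + P ((n : ℚ) - z) * f (z + 1)) := by
  rw [sum_range_succ', qBin_zero_right hq]
  simp only [qBin_succ_succ hq hP, add_mul, mul_add, sum_add_distrib]
  have h := sum_range_succ' (fun z => qBin q n z * (P (-(z : ℚ)) * f z)) (n + 1)
  rw [sum_range_succ, qBin_of_lt (Nat.lt_succ_self n), zero_mul, add_zero] at h
  rw [h, qBin_zero_right hq]
  simp only [Nat.cast_zero, neg_zero, hP.zero, one_mul]
  rw [add_right_comm]
  congr 1
  · congr 1
    refine sum_congr rfl fun z _ => ?_
    push_cast; ring
  · refine sum_congr rfl fun z _ => ?_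
    ring

/-- Absorption: a factor [z] lowers the order of the q-binomial by one and shifts the variable. -/
lemma sum_qBin_mul_qNum (n : ℕ) (f : ℕ → ℂ) :
    ∑ z ∈ range (n + 1 + 1), qBin q (n + 1) z * qNum q z * f z =
      qNum q ((n : ℚ) + 1) * ∑ z ∈ range (n + 1), qBin q n z * f (z + 1) := by
  rw [sum_range_succ', mul_sum]
  simp only [Nat.cast_zero, qNum_zero, mul_zero, zero_mul, add_zero]
  refine sum_congr rfl fun z _ => ?_
  have h : qInvFact q z = qNum q ((z : ℚ) + 1) * qInvFact q ((z : ℚ) + 1) := by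
    rw [← qInvFact_sub_one hq ((isInt_natCast z).add isInt_one)]; simp
  unfold qBin
  push_cast
  rw [h, qFact_add_one (isNat_natCast n), show (n : ℚ) + 1 - (z + 1) = n - z by ring]
  ring

/-- The `q`-Saalschütz summation in a form without denominators. -/
theorem qSaalschutz (a b c : ℚ) (n : ℕ) :
    ∑ s ∈ range (n + 1), qBin q n s * (qPoch q a s * qPoch q b s * qPoch q (c + s) (n - s)
      * qPoch q (c - a - b) (n - s)) = qPoch q (c - a) n * qPoch q (c - b) n := by
  induction n with
  | zero => simp [qBin_zero_zero, qPoch_zero]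
  | succ n ih =>
    -- The telescoping certificate: the summand for n+1 minus [c-a+n][c-b+n] times the summand for n
    -- equals g(s+1) - g(s). The factor 1/[s-1]! gives g(0) = 0, and g(n+1) cancels the extra term s
    -- = n+1.
    set g : ℕ → ℂ := fun s => -(qFact q n * qInvFact q ((s : ℚ) - 1) * qInvFact q ((n : ℚ) + 1 - s)
      * qPoch q a s * qPoch q b s * qPoch q (c + s - 1) (n + 1 - s)
      * qPoch q (c - a - b) (n + 1 - s)) with hg
    have key : ∀ s ∈ range (n + 1),
        qBin q (n + 1) s * (qPoch q a s * qPoch q b s * qPoch q (c + s) (n + 1 - s)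
          * qPoch q (c - a - b) (n + 1 - s)) =
        qNum q (c - a + n) * qNum q (c - b + n) * (qBin q n s * (qPoch q a s * qPoch q b s
          * qPoch q (c + s) (n - s) * qPoch q (c - a - b) (n - s))) + (g (s + 1) - g s) := by
      intro s hs
      have hs' : s ≤ n := Nat.lt_succ_iff.1 (mem_range.1 hs)
      have e1 : n + 1 - s = (n - s) + 1 := by omega
      have i1 : qInvFact q ((s : ℚ) - 1) = qNum q s * qInvFact q s :=
        qInvFact_sub_one hq (isInt_natCast s)
      have i2 : qInvFact q ((n : ℚ) - s) = qNum q ((n : ℚ) + 1 - s)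
          * qInvFact q ((n : ℚ) + 1 - s) := by
        rw [← qInvFact_sub_one hq (((isInt_natCast n).add isInt_one).sub (isInt_natCast s))]
        congr 1; ring
      have p1 : qPoch q (c + s) (n + 1 - s) = qPoch q (c + s) (n - s) * qNum q (c + n) := by
        rw [e1, qPoch_succ, Nat.cast_sub hs']; congr 2; ring
      have p2 : qPoch q (c - a - b) (n + 1 - s)
          = qPoch q (c - a - b) (n - s) * qNum q (c - a - b + n - s) := by
        rw [e1, qPoch_succ, Nat.cast_sub hs']; congr 2; ring
      have p3 : qPoch q (c + s - 1) (n + 1 - s) = qNum q (c + s - 1) * qPoch q (c + s) (n - s) := by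
        rw [e1, qPoch_succ']; congr 2; ring
      have rel := qNum_saalschutz_relation hq a b c n s
      simp only [hg, qBin, Nat.add_sub_add_right]
      push_cast
      rw [qPoch_succ, qPoch_succ, p1, p2, p3, i1, qFact_add_one (isNat_natCast n),
        show (s : ℚ) + 1 - 1 = s by ring, show (n : ℚ) + 1 - (s + 1) = n - s by ring, i2,
        show c + ((s : ℚ) + 1) - 1 = c + s by ring]
      linear_combination (qFact q n * qInvFact q s * qInvFact q ((n : ℚ) + 1 - s)
        * qPoch q a s * qPoch q b s * qPoch q (c + s) (n - s) * qPoch q (c - a - b) (n - s)) * rel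
    rw [sum_range_succ, sum_congr rfl key, sum_add_distrib, ← mul_sum, ih, sum_range_sub,
      qBin_self hq, qPoch_succ q (c - a), qPoch_succ q (c - b)]
    have g0 : g 0 = 0 := by
      simp only [hg, Nat.cast_zero]
      rw [qInvFact_of_neg (x := 0 - 1) (by norm_num)]; ring
    have g1 : g (n + 1) = -(qPoch q a (n + 1) * qPoch q b (n + 1)) := by
      simp only [hg]
      push_cast
      rw [show (n : ℚ) + 1 - 1 = n by ring, show (n : ℚ) + 1 - (n + 1) = 0 by ring,
        qFact_mul_qInvFact hq (by positivity), qInvFact_zero]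
      simp [qPoch_zero]
    rw [g0, g1]
    simp [qPoch_zero]
    ring

/-- The `q`-Vandermonde summation in a form without denominators. -/
theorem qVandermonde {P : ℚ → ℂ} (hP : IsQPow q P) (A E : ℚ) (m : ℕ) :
    ∑ y ∈ range (m + 1), qBin q m y * ((-1) ^ y * qPoch q A y * qPoch q (E + y) (m - y)
      * P (-(y * (E - A + m - 1)))) = P (m * A) * qPoch q (E - A) m := by
  induction m generalizing E with
  | zero => simp [qBin_zero_zero, qPoch_zero, hP.zero]
  | succ m ih =>
    rw [sum_qBin_succ hq hP]
    -- Writing [E+y] = [(E-A)+(A+y)] makes the parts with [A+y] cancel between the two terms of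
    -- Pascal's rule. The factor P(A)[E-A] comes out and the sum for m with E+1 in place of E
    -- remains.
    have key : ∀ y ∈ range (m + 1), qBin q m y * (P (-(y : ℚ)) * ((-1) ^ y * qPoch q A y
        * qPoch q (E + y) (m + 1 - y) * P (-(y * (E - A + (m + 1 : ℕ) - 1))))
        + P ((m : ℚ) - y) * ((-1) ^ (y + 1) * qPoch q A (y + 1)
        * qPoch q (E + (y + 1 : ℕ)) (m + 1 - (y + 1))
        * P (-((y + 1 : ℕ) * (E - A + (m + 1 : ℕ) - 1))))) =
        P A * qNum q (E - A) * (qBin q m y * ((-1) ^ y * qPoch q A y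
          * qPoch q (E + 1 + y) (m - y) * P (-(y * (E + 1 - A + m - 1))))) := by
      intro y hy
      have hy' : y ≤ m := Nat.lt_succ_iff.1 (mem_range.1 hy)
      rw [show m + 1 - y = (m - y) + 1 by omega, show m + 1 - (y + 1) = m - y by omega,
        qPoch_succ', qPoch_succ q A, show E + y + 1 = E + 1 + y by ring]
      have h1 : qNum q (E + y) = P (A + y) * qNum q (E - A) + P (-(E - A)) * qNum q (A + y) := by
        rw [← hP.num]; congr 1; ring
      have h2 : P ((m : ℚ) - y) * P (-((y + 1 : ℕ) * (E - A + (m + 1 : ℕ) - 1)))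
          = P (-(y : ℚ)) * P (-(E - A)) * P (-(y * (E + 1 - A + m - 1))) := by
        rw [← hP.add, ← hP.add, ← hP.add]
        congr 1; push_cast; ring
      have h3 : P (-(y : ℚ)) * P (A + y) = P A := by
        rw [← hP.add]; congr 1; ring
      rw [show -((y : ℚ) * (E - A + (m + 1 : ℕ) - 1)) = -(y
          * (E + 1 - A + m - 1)) by push_cast; ring,
        h1, show E + ((y + 1 : ℕ) : ℚ) = E + 1 + y by push_cast; ring]
      rw [pow_succ]
      linear_combination (qBin q m y * (-1) ^ y * qPoch q A y * qPoch q (E + 1 + y) (m - y)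
        * P (-(y * (E + 1 - A + m - 1))) * qNum q (E - A)) * h3
        - (qBin q m y * (-1) ^ y * qPoch q A y * qNum q (A + y) * qPoch q (E + 1 + y) (m - y)) * h2
    rw [sum_congr rfl key, ← mul_sum, ih, qPoch_succ', show E + 1 - A = E - A + 1 by ring]
    have : P (((m + 1 : ℕ) : ℚ) * A) = P A * P (m * A) := by
      rw [← hP.add]; congr 1; push_cast; ring
    rw [this]; ring

/-- Rearrangement of a sum by means of the `q`-Saalschütz formula. -/
lemma sum_expand_qSaalschutz (b c d : ℚ) (n : ℕ) (f : ℕ → ℂ) :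
    ∑ z ∈ range (n + 1), qBin q n z * (qPoch q b z * qPoch q c z * qPoch q (d + z) (n - z) * f z) =
    ∑ s ∈ range (n + 1), qBin q n s * (qPoch q (d - b) s * qPoch q (d - c) s
      * qPoch q (d + s) (n - s) * ∑ y ∈ range (n - s + 1), qBin q (n - s) y
        * (qPoch q (b + c - d) y * f (s + y))) := by
  have h1 : ∀ z ∈ range (n + 1), qBin q n z * (qPoch q b z * qPoch q c z * qPoch q (d + z) (n - z)
      * f z) = ∑ s ∈ range (z + 1), qBin q n s * (qPoch q (d - b) s * qPoch q (d - c) s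
        * qPoch q (d + s) (n - s)) * (qBin q (n - s) (z - s) * (qPoch q (b + c - d) (z - s)
            * f z)) := by
    intro z hz
    have hz' : z ≤ n := Nat.lt_succ_iff.1 (mem_range.1 hz)
    -- With these parameters the right-hand side of the Saalschütz summation is (b)_z (c)_z. This
    -- product is replaced by the sum over s, and the double sum is then reordered by z = s + y.
    have hs := qSaalschutz hq (d - b) (d - c) d z
    rw [show d - (d - b) = b by ring, show d - (d - c) = c by ring,
      show b - (d - c) = b + c - d by ring] at hs
    rw [← hs, sum_mul, sum_mul, mul_sum]
    refine sum_congr rfl fun s hs' => ?_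
    have hsz : s ≤ z := Nat.lt_succ_iff.1 (mem_range.1 hs')
    have hp : qPoch q (d + s) (n - s) = qPoch q (d + s) (z - s) * qPoch q (d + z) (n - z) := by
      rw [show n - s = (z - s) + (n - z) by omega, qPoch_add, Nat.cast_sub hsz]
      congr 2; ring
    have hb : qBin q n z * qBin q z s = qBin q n s * qBin q (n - s) (z - s) := by
      unfold qBin
      rw [Nat.cast_sub hsz, Nat.cast_sub (hsz.trans hz')]
      have e1 := qFact_mul_qInvFact hq (x := z) (by positivity)
      have e2 := qFact_mul_qInvFact hq (x := (n : ℚ) - s) (by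
        have : (s : ℚ) ≤ n := by exact_mod_cast hsz.trans hz'
        linarith)
      rw [show (n : ℚ) - s - (z - s) = n - z by ring]
      linear_combination (qFact q n * qInvFact q ((n : ℚ) - z) * qInvFact q s
        * qInvFact q ((z : ℚ) - s)) * (e1 - e2)
    rw [hp]
    linear_combination (qPoch q (d - b) s * qPoch q (d - c) s * qPoch q (d + s) (z - s)
      * qPoch q (b + c - d) (z - s) * qPoch q (d + z) (n - z) * f z) * hb
  rw [sum_congr rfl h1]
  simp only [← mul_assoc]
  simp only [mul_sum]
  rw [sum_sigma', sum_sigma']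
  refine sum_bij' (fun p _ => ⟨p.2, p.1 - p.2⟩) (fun p _ => ⟨p.1 + p.2, p.1⟩) ?_ ?_ ?_ ?_ ?_
  all_goals simp only [mem_sigma, mem_range]
  · rintro ⟨z, s⟩ h; simp only at h ⊢; omega
  · rintro ⟨s, y⟩ h; simp only at h ⊢; omega
  · rintro ⟨z, s⟩ h; simp only at h ⊢; congr 1; omega
  · rintro ⟨s, y⟩ h; simp only at h ⊢; congr 1; omega
  · rintro ⟨z, s⟩ h
    simp only at h ⊢
    rw [show s + (z - s) = z by omega]
    ring

/-- Sears' transformation of balanced terminating `₄φ₃` series, without denominators. -/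
theorem qSears (a b c d e f : ℚ) (n : ℕ) (hbal : d + e + f = a + b + c - n + 1) :
    ∑ z ∈ range (n + 1), qBin q n z * ((-1) ^ z * qPoch q a z * qPoch q b z * qPoch q c z
      * qPoch q (d + z) (n - z) * qPoch q (e + z) (n - z) * qPoch q (f + z) (n - z)) =
    ∑ z ∈ range (n + 1), qBin q n z * ((-1) ^ z * qPoch q a z * qPoch q (d - b) z
      * qPoch q (d - c) z * qPoch q (d + z) (n - z) * qPoch q (e - a) (n - z)
      * qPoch q (f - a) (n - z)) := by
  have h := sum_expand_qSaalschutz hq b c d n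
    (fun z => (-1) ^ z * qPoch q a z * qPoch q (e + z) (n - z) * qPoch q (f + z) (n - z))
  have h0 : ∀ z ∈ range (n + 1), qBin q n z * ((-1) ^ z * qPoch q a z * qPoch q b z * qPoch q c z
      * qPoch q (d + z) (n - z) * qPoch q (e + z) (n - z) * qPoch q (f + z) (n - z)) =
      qBin q n z * (qPoch q b z * qPoch q c z * qPoch q (d + z) (n - z) * ((-1) ^ z * qPoch q a z
        * qPoch q (e + z) (n - z) * qPoch q (f + z) (n - z))) := fun z _ => by ring
  rw [sum_congr rfl h0, h]
  refine sum_congr rfl fun s hs => ?_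
  have hs' : s ≤ n := Nat.lt_succ_iff.1 (mem_range.1 hs)
  -- Reflecting the shifted factorial with parameter f turns the inner sum into a Saalschütz sum;
  -- the balance condition is exactly what makes its last parameter fit.
  have hin : ∑ y ∈ range (n - s + 1), qBin q (n - s) y * (qPoch q (b + c - d) y
      * ((-1) ^ (s + y) * qPoch q a (s + y) * qPoch q (e + (s + y : ℕ)) (n - (s + y))
        * qPoch q (f + (s + y : ℕ)) (n - (s + y)))) =
      (-1) ^ s * qPoch q a s * (-1) ^ (n - s) * ∑ y ∈ range (n - s + 1), qBin q (n - s) y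
        * (qPoch q (a + s) y * qPoch q (b + c - d) y * qPoch q (e + s + y) (n - s - y)
          * qPoch q (e + s - (a + s) - (b + c - d)) (n - s - y)) := by
    rw [mul_sum]
    refine sum_congr rfl fun y hy => ?_
    have hy' : y ≤ n - s := Nat.lt_succ_iff.1 (mem_range.1 hy)
    rw [qPoch_add, show n - (s + y) = n - s - y by omega, qPoch_neg q (f + (s + y : ℕ)),
      show e + ((s + y : ℕ) : ℚ) = e + s + y by push_cast; ring]
    rw [show 1 - (f + ((s + y : ℕ) : ℚ)) - ((n - s - y : ℕ) : ℚ) = e + s - (a + s) - (b + c - d) by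
      rw [Nat.cast_sub hy', Nat.cast_sub hs']; push_cast; linarith]
    have hsg : (-1 : ℂ) ^ (s + y) * (-1) ^ (n - s - y) = (-1) ^ s * (-1) ^ (n - s) := by
      rw [← pow_add, ← pow_add]; congr 1; omega
    linear_combination (qBin q (n - s) y * qPoch q (b + c - d) y * qPoch q a s * qPoch q (a + s) y
      * qPoch q (e + s + y) (n - s - y)
      * qPoch q (e + s - (a + s) - (b + c - d)) (n - s - y)) * hsg
  rw [hin, qSaalschutz hq, qPoch_neg q (e + s - (b + c - d)),
    show 1 - (e + s - (b + c - d)) - ((n - s : ℕ) : ℚ) = f - a by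
      rw [Nat.cast_sub hs']; linarith, show e + s - (a + s) = e - a by ring]
  have hsg : (-1 : ℂ) ^ (n - s) * (-1) ^ (n - s) = 1 := by
    rw [← mul_pow]; norm_num
  linear_combination (qBin q n s * qPoch q (d - b) s * qPoch q (d - c) s * qPoch q (d + s) (n - s)
    * (-1) ^ s * qPoch q a s * qPoch q (e - a) (n - s) * qPoch q (f - a) (n - s)) * hsg

/-- A transformation of terminating `₃φ₂` series, without denominators. -/
theorem qThreePhiTwo {P : ℚ → ℂ} (hP : IsQPow q P) (b c d e : ℚ) (n : ℕ) :
    ∑ z ∈ range (n + 1), qBin q n z * ((-1) ^ z * qPoch q b z * qPoch q c z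
      * qPoch q (d + z) (n - z) * qPoch q (e + z) (n - z)
      * P (-(z * (d + e - b - c + n - 1)))) =
    ∑ z ∈ range (n + 1), qBin q n z * ((-1) ^ z * qPoch q (d - b) z * qPoch q (d - c) z
      * qPoch q (d + z) (n - z) * qPoch q (d + e - b - c + z) (n - z)
      * P (-(z * (d + e - b - c + n - 1)) + (n - z) * (b + c - d))) := by
  have h := sum_expand_qSaalschutz hq b c d n
    (fun z => (-1) ^ z * qPoch q (e + z) (n - z) * P (-(z * (d + e - b - c + n - 1))))
  have h0 : ∀ z ∈ range (n + 1), qBin q n z * ((-1) ^ z * qPoch q b z * qPoch q c z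
      * qPoch q (d + z) (n - z) * qPoch q (e + z) (n - z)
      * P (-(z * (d + e - b - c + n - 1)))) =
      qBin q n z * (qPoch q b z * qPoch q c z * qPoch q (d + z) (n - z) * ((-1) ^ z
        * qPoch q (e + z) (n - z) * P (-(z * (d + e - b - c + n - 1))))) := fun z _ => by ring
  rw [sum_congr rfl h0, h]
  refine sum_congr rfl fun s hs => ?_
  have hs' : s ≤ n := Nat.lt_succ_iff.1 (mem_range.1 hs)
  -- Here the power of q under the sum makes the inner sum a q-Vandermonde sum.
  have hin : ∑ y ∈ range (n - s + 1), qBin q (n - s) y * (qPoch q (b + c - d) y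
      * ((-1) ^ (s + y) * qPoch q (e + (s + y : ℕ)) (n - (s + y))
        * P (-((s + y : ℕ) * (d + e - b - c + n - 1))))) =
      (-1) ^ s * P (-(s * (d + e - b - c + n - 1))) * ∑ y ∈ range (n - s + 1),
        qBin q (n - s) y * ((-1) ^ y * qPoch q (b + c - d) y * qPoch q (e + s + y) (n - s - y)
          * P (-(y * (e + s - (b + c - d) + (n - s : ℕ) - 1)))) := by
    rw [mul_sum]
    refine sum_congr rfl fun y hy => ?_
    have hp : P (-((s + y : ℕ) * (d + e - b - c + n - 1))) =
        P (-(s * (d + e - b - c + n - 1)))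
          * P (-(y * (e + s - (b + c - d) + (n - s : ℕ) - 1))) := by
      rw [← hP.add, Nat.cast_sub hs']; congr 1; push_cast; ring
    rw [show n - (s + y) = n - s - y by omega, hp, pow_add,
      show e + ((s + y : ℕ) : ℚ) = e + s + y by push_cast; ring]
    ring
  rw [hin, qVandermonde hq hP, hP.add, Nat.cast_sub hs',
    show e + s - (b + c - d) = d + e - b - c + s by ring]
  ring

/-- The alternating `q`-binomial sum annihilates products of fewer than `n` linear factors. -/
theorem sum_qBin_prod_eq_zero (L : List ℚ) (n : ℕ) (κ : ℤ)
    (h1 : L.length + κ + 1 ≤ n) (h1' : L.length - κ + 1 ≤ n) (h2 : (L.length + κ + 1 - n) % 2 = 0) :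
    ∑ z ∈ range (n + 1), qBin q n z * ((-1) ^ z * qPow q (κ * z)
      * (L.map fun c => qNum q (c + z)).prod) = 0 := by
  generalize hl : L.length = l at h1 h1' h2
  induction l generalizing L n κ with
  | zero =>
    obtain rfl := List.length_eq_zero_iff.1 hl
    simp only [List.map_nil, List.prod_nil, mul_one]
    clear hl
    -- Pascal's rule gives 1 - q^(n+κ) times the sum for (n, κ-1). Size and parity restrict κ to n,
    -- n-2, …, -n (for order n+1), so that the factor 1 - q^0 is met on the way down.
    induction n generalizing κ with
    | zero => push_cast at h1 h1'; omega
    | succ n ih =>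
      rw [sum_qBin_succ hq (isQPow_qPow hq)]
      have key : ∀ z ∈ range (n + 1), qBin q n z * (qPow q (-(z : ℚ)) * ((-1) ^ z * qPow q (κ * z))
          + qPow q ((n : ℚ) - z) * ((-1) ^ (z + 1) * qPow q (κ * (z + 1 : ℕ)))) =
          (1 - qPow q (n + κ)) * (qBin q n z * ((-1) ^ z * qPow q ((κ - 1 : ℤ) * z))) := by
        intro z _
        have e1 : qPow q (-(z : ℚ)) * qPow q (κ * z) = qPow q ((κ - 1 : ℤ) * z) := by
          rw [← qPow_add hq.ne_zero]; congr 1; push_cast; ring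
        have e2 : qPow q ((n : ℚ) - z) * qPow q (κ * (z + 1 : ℕ)) =
            qPow q (n + κ) * qPow q ((κ - 1 : ℤ) * z) := by
          rw [← qPow_add hq.ne_zero, ← qPow_add hq.ne_zero]; congr 1; push_cast; ring
        rw [pow_succ]
        linear_combination (qBin q n z * (-1) ^ z) * (e1 - e2)
      rw [sum_congr rfl key, ← mul_sum]
      by_cases hk : κ = -n
      · subst hk; simp [qPow_zero]
      · rw [ih (κ - 1) (by push_cast at *; omega) (by push_cast at *; omega)
          (by push_cast at *; omega), mul_zero]
  | succ l ih =>
    obtain ⟨c, L, rfl⟩ := List.exists_cons_of_length_eq_add_one hl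
    simp only [List.length_cons, add_left_inj] at hl
    obtain _ | n := n
    · push_cast at h1 h1'; omega
    simp only [List.map_cons, List.prod_cons]
    push_cast at h1 h1' h2
    -- One linear factor is split as [c+z] = q^z [c] + q^(-c) [z]. The first part raises κ by one;
    -- the second is absorbed and lowers n by one. Both keep the size and parity conditions with one
    -- factor less.
    have key : ∀ z ∈ range (n + 1 + 1), qBin q (n + 1) z * ((-1) ^ z * qPow q (κ * z)
        * (qNum q (c + z) * (L.map fun c => qNum q (c + z)).prod)) =
        qNum q c * (qBin q (n + 1) z * ((-1) ^ z * qPow q ((κ + 1 : ℤ) * z)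
          * (L.map fun c => qNum q (c + z)).prod)) + qPow q (-c) * (qBin q (n + 1) z * qNum q z
          * ((-1) ^ z * qPow q (κ * z) * (L.map fun c => qNum q (c + z)).prod)) := by
      intro z _
      have e1 : qPow q ((κ + 1 : ℤ) * z) = qPow q z * qPow q (κ * z) := by
        rw [← qPow_add hq.ne_zero]; congr 1; push_cast; ring
      rw [qNum_add hq, e1]; ring
    rw [sum_congr rfl key, sum_add_distrib, ← mul_sum, ← mul_sum,
      ih L (n + 1) (κ + 1) hl (by push_cast; omega) (by push_cast; omega) (by push_cast; omega),
          sum_qBin_mul_qNum hq]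
    have key2 : ∀ z ∈ range (n + 1), qBin q n z * ((-1) ^ (z + 1) * qPow q (κ * (z + 1 : ℕ))
        * (L.map fun c => qNum q (c + (z + 1 : ℕ))).prod) =
        -qPow q κ * (qBin q n z * ((-1) ^ z * qPow q (κ * z)
          * ((L.map fun c => c + 1).map fun c => qNum q (c + z)).prod)) := by
      intro z _
      have e1 : qPow q (κ * (z + 1 : ℕ)) = qPow q κ * qPow q (κ * z) := by
        rw [← qPow_add hq.ne_zero]; congr 1; push_cast; ring
      have e2 : (L.map fun c => qNum q (c + (z + 1 : ℕ)))
          = (L.map fun c => c + 1).map fun c => qNum q (c + z) := by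
        rw [List.map_map]
        refine List.map_congr_left fun c _ => ?_
        simp only [Function.comp]; congr 1; push_cast; ring
      rw [e1, e2, pow_succ]; ring
    rw [sum_congr rfl key2, ← mul_sum]
    have := ih (L.map fun c => c + 1) n κ (by simpa using hl) (by omega) (by omega) (by omega)
    rw [this]; simp

end Series

/-! ### Signs, triads and changes of the summation variable -/

lemma IsNat.of_eq {x y : ℚ} (h : IsNat x) (e : y = x) : IsNat y := e ▸ h

lemma IsInt.of_eq {x y : ℚ} (h : IsInt x) (e : y = x) : IsInt y := e ▸ h

lemma sgn_natCast (z : ℕ) : sgn (z : ℚ) = (-1) ^ z := by simp [sgn]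

lemma sgn_add (x : ℚ) {y : ℚ} (hy : IsInt y) : sgn (x + y) = sgn x * sgn y := by
  obtain ⟨n, rfl⟩ := hy
  simp only [sgn, Int.floor_add_intCast, Int.floor_intCast]
  exact zpow_add₀ (by norm_num) _ _

lemma sgn_mul_self (x : ℚ) : sgn x * sgn x = 1 := by
  simp only [sgn, ← mul_zpow]; norm_num

lemma sgn_two_mul {x : ℚ} (hx : IsInt x) : sgn (2 * x) = 1 := by
  rw [two_mul, sgn_add x hx, sgn_mul_self]

lemma sgn_congr {x y : ℚ} (h : IsInt ((x - y) / 2)) : sgn x = sgn y := by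
  have h2 : sgn (y + 2 * ((x - y) / 2)) = sgn y * sgn (2 * ((x - y) / 2)) :=
    sgn_add y ((h.add h).of_eq (by ring))
  rw [sgn_two_mul h, mul_one] at h2
  rw [← h2]; congr 1; ring

lemma sgn_neg {x : ℚ} (hx : IsInt x) : sgn (-x) = sgn x :=
  sgn_congr (hx.neg.of_eq (by ring))

lemma sgn_sub (x : ℚ) {y : ℚ} (hy : IsInt y) : sgn (x - y) = sgn x * sgn y := by
  rw [sub_eq_add_neg, sgn_add x hy.neg, sgn_neg hy]

/-- The triangular conditions, in terms of non-negative integers. -/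
structure Tri (a b c : ℚ) : Prop where
  n1 : IsNat (a + b - c)
  n2 : IsNat (a + c - b)
  n3 : IsNat (b + c - a)

lemma Triad.tri {a b c : ℚ} (h : Triad a b c) : Tri a b c := by
  obtain ⟨⟨la, ha⟩, ⟨lb, hb⟩, ⟨lc, hc⟩, h1, h2, ⟨n, hn⟩⟩ := h
  rw [abs_le] at h1
  refine ⟨IsInt.isNat ⟨n - lc, ?_⟩ ?_, IsInt.isNat ⟨n - lb, ?_⟩ ?_, IsInt.isNat ⟨n - la, ?_⟩ ?_⟩
  all_goals first | linarith | (push_cast; linarith)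

lemma isSpin_iff {a : ℚ} : IsSpin a ↔ IsNat (2 * a) :=
  ⟨fun ⟨n, h⟩ => ⟨n, by rw [h]; ring⟩, fun ⟨n, h⟩ => ⟨n, by rw [← h]; ring⟩⟩

namespace Tri
variable {a b c : ℚ}

lemma two1 (h : Tri a b c) : IsNat (2 * a) := (h.n1.add h.n2).of_eq (by ring)
lemma two2 (h : Tri a b c) : IsNat (2 * b) := (h.n1.add h.n3).of_eq (by ring)
lemma two3 (h : Tri a b c) : IsNat (2 * c) := (h.n2.add h.n3).of_eq (by ring)
lemma sum (h : Tri a b c) : IsNat (a + b + c) := ((h.n1.add h.n2).add h.n3).of_eq (by ring)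
lemma sum_one (h : Tri a b c) : IsNat (a + b + c + 1) := h.sum.add ⟨1, by simp⟩
lemma swap12 (h : Tri a b c) : Tri b a c :=
  ⟨h.n1.of_eq (by ring), h.n3.of_eq (by ring), h.n2.of_eq (by ring)⟩
lemma swap23 (h : Tri a b c) : Tri a c b :=
  ⟨h.n2.of_eq (by ring), h.n1.of_eq (by ring), h.n3.of_eq (by ring)⟩
lemma rot (h : Tri a b c) : Tri b c a := h.swap12.swap23

lemma triad (h : Tri a b c) : Triad a b c := by
  refine ⟨isSpin_iff.2 h.two1, isSpin_iff.2 h.two2, isSpin_iff.2 h.two3, ?_, ?_, ?_⟩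
  · rw [abs_le]
    have := h.n2.nonneg
    have := h.n3.nonneg
    constructor <;> linarith
  · have := h.n1.nonneg
    linarith
  · exact h.sum.isInt

end Tri

lemma triad_iff {a b c : ℚ} : Triad a b c ↔ Tri a b c := ⟨Triad.tri, Tri.triad⟩

lemma cast_toNat {i : ℤ} (h : 0 ≤ i) : ((i.toNat : ℕ) : ℚ) = i := by
  have := congrArg (Int.cast : ℤ → ℚ) (Int.toNat_of_nonneg h)
  rwa [Int.cast_natCast] at this

/-- Change of the variable of summation. -/
lemma sum_shift (g : ℚ → ℂ) (p r s : ℚ) (n m : ℕ) (hs : s = 1 ∨ s = -1) (hr : IsInt (r - p))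
    (h : ∀ i : ℤ, g (p + i) ≠ 0 → 0 ≤ i ∧ i ≤ n ∧ 0 ≤ s * (p + i - r) ∧ s * (p + i - r) ≤ m) :
    ∑ w ∈ range (n + 1), g (p + w) = ∑ w ∈ range (m + 1), g (r + s * w) := by
  obtain ⟨d, hd⟩ := hr
  -- Both directions are treated at once: the substitution w = t(i - d) has the inverse i = d + t w
  -- because t² = 1.
  obtain ⟨t, ht, ht2⟩ : ∃ t : ℤ, s = t ∧ t * t = 1 := by
    rcases hs with rfl | rfl
    · exact ⟨1, by simp, by norm_num⟩
    · exact ⟨-1, by simp, by norm_num⟩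
  have key : ∀ i : ℤ, g (p + i) ≠ 0 → 0 ≤ i ∧ i ≤ n ∧ 0 ≤ t * (i - d) ∧ t * (i - d) ≤ m := by
    intro i hi
    obtain ⟨h1, h2, h3, h4⟩ := h i hi
    have e : s * (p + i - r) = ((t * (i - d) : ℤ) : ℚ) := by
      push_cast; rw [← ht, ← hd]; ring
    rw [e] at h3 h4
    exact ⟨h1, h2, by exact_mod_cast h3, by exact_mod_cast h4⟩
  have e2 : ∀ w : ℤ, r + s * w = p + ((d + t * w : ℤ) : ℚ) := by
    intro w; push_cast; rw [← ht, ← hd]; ring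
  refine sum_bij_ne_zero (fun w _ _ => (t * (w - d)).toNat) ?_ ?_ ?_ ?_
  · intro w _ hw
    have := key w (by simpa using hw)
    simp only [mem_range]; omega
  · intro w _ hw w' _ hw' hww
    have h1 := key w (by simpa using hw)
    have h2 := key w' (by simpa using hw')
    have h3 : t * ((w : ℤ) - d) = t * (w' - d) := by omega
    have h4 : t * t * ((w : ℤ) - d) = t * t * (w' - d) := by rw [mul_assoc, h3, mul_assoc]
    rw [ht2] at h4; omega
  · intro w _ hw
    have hw2 : g (p + ((d + t * w : ℤ) : ℚ)) ≠ 0 := by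
      rw [← e2]; simpa using hw
    have h1 := key _ hw2
    have e3 : t * (d + t * (w : ℤ) - d) = w := by linear_combination (w : ℤ) * ht2
    refine ⟨(d + t * w).toNat, mem_range.2 (by omega), ?_, ?_⟩
    · have : (((d + t * w).toNat : ℕ) : ℚ) = ((d + t * w : ℤ) : ℚ) := cast_toNat h1.1
      rwa [this]
    · rw [Int.toNat_of_nonneg h1.1, e3]; simp
  · intro w _ hw
    have h1 := key w (by simpa using hw)
    have e3 : (((t * ((w : ℤ) - d)).toNat : ℕ) : ℚ) = ((t * ((w : ℤ) - d) : ℤ) : ℚ) := 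
      cast_toNat h1.2.2.1
    rw [e3, e2]
    congr 2
    rw [show d + t * (t * ((w : ℤ) - d)) = d + t * t * (w - d) by ring, ht2]
    simp

/-- Sums of `f` over the integers `0, …, N`. -/
def nsum (N : ℚ) (f : ℚ → ℂ) : ℂ := ∑ z ∈ range (⌊N⌋₊ + 1), f z

lemma nsum_natCast (n : ℕ) (f : ℚ → ℂ) : nsum n f = ∑ z ∈ range (n + 1), f z := by simp [nsum]

lemma nsum_congr {N : ℚ} (hN : IsNat N) {f g : ℚ → ℂ}
    (h : ∀ z : ℚ, IsNat z → IsNat (N - z) → f z = g z) : nsum N f = nsum N g := by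
  obtain ⟨n, rfl⟩ := hN
  rw [nsum_natCast, nsum_natCast]
  refine sum_congr rfl fun z hz => h z ⟨z, rfl⟩ ⟨n - z, ?_⟩
  rw [Nat.cast_sub (Nat.lt_succ_iff.1 (mem_range.1 hz))]

lemma nsum_mul_left (N : ℚ) (c : ℂ) (f : ℚ → ℂ) : nsum N (fun z => c * f z) = c * nsum N f := by
  simp [nsum, mul_sum]

lemma nsum_add (N : ℚ) (f g : ℚ → ℂ) : nsum N (fun z => f z + g z) = nsum N f + nsum N g := by
  simp [nsum, sum_add_distrib]

lemma nsum_sub (N : ℚ) (f g : ℚ → ℂ) : nsum N (fun z => f z - g z) = nsum N f - nsum N g := by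
  simp [nsum, sum_sub_distrib]

lemma nsum_comm (N M : ℚ) (f : ℚ → ℚ → ℂ) :
    nsum N (fun x => nsum M fun y => f x y) = nsum M fun y => nsum N fun x => f x y := by
  simp only [nsum]; exact sum_comm

lemma nsum_eq_zero {N : ℚ} (hN : IsNat N) {f : ℚ → ℂ}
    (h : ∀ z : ℚ, IsNat z → IsNat (N - z) → f z = 0) : nsum N f = 0 := by
  rw [nsum_congr hN h]; simp [nsum]

/-- The range of summation may be changed as long as the omitted terms vanish. -/
lemma nsum_range {N M : ℚ} (hN : IsNat N) (hM : IsNat M) {f : ℚ → ℂ}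
    (h : ∀ z : ℚ, IsNat z → f z ≠ 0 → z ≤ N ∧ z ≤ M) : nsum N f = nsum M f := by
  obtain ⟨n, rfl⟩ := hN
  obtain ⟨m, rfl⟩ := hM
  rw [nsum_natCast, nsum_natCast]
  have h' : ∀ z : ℕ, f z ≠ 0 → z ≤ n ∧ z ≤ m := fun z hz => by
    have := h z ⟨z, rfl⟩ hz; exact_mod_cast this
  refine sum_bij_ne_zero (fun w _ _ => w) ?_ ?_ ?_ ?_
  · intro w _ hw; simpa [Nat.lt_succ_iff] using (h' w hw).2
  · intro w _ _ w' _ _ h; exact h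
  · intro w _ hw; exact ⟨w, by simpa [Nat.lt_succ_iff] using (h' w hw).1, hw, rfl⟩
  · intro w _ _; rfl

/-! ### Balanced series in terms of factorials -/

/-- A terminating `₄φ₃` series, with the denominators cleared. -/
def qPhi (q : ℂ) (n : ℕ) (a b c d e f : ℚ) : ℂ :=
  ∑ z ∈ range (n + 1), qBin q n z * ((-1) ^ z * qPoch q a z * qPoch q b z * qPoch q c z
      * qPoch q (d + z) (n - z) * qPoch q (e + z) (n - z) * qPoch q (f + z) (n - z))

section
variable {q : ℂ}

lemma qBin_symm {n z : ℕ} (hz : z ≤ n) : qBin q n (n - z) = qBin q n z := by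
  unfold qBin
  rw [Nat.cast_sub hz, show (n : ℚ) - (n - z) = z by ring]; ring

lemma neg_one_pow_mul_self (n : ℕ) : (-1 : ℂ) ^ n * (-1) ^ n = 1 := by
  rw [← mul_pow]; norm_num

/-- Sears' transformation with its right-hand side brought back to the same standard form: the
factors (e-a)_(n-z) and (f-a)_(n-z) are reflected, and their two signs cancel. The parameters a and
d stay fixed, so permuting parameters beforehand selects the variant of the transformation. -/
lemma qPhi_sears (hq : IsGeneric q) {n : ℕ} {a b c d e f b' c' e' f' : ℚ}
    (hbal : d + e + f = a + b + c - n + 1) (hb : b' = d - b) (hc : c' = d - c)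
    (he : e' = 1 - e + a - n) (hf : f' = 1 - f + a - n) :
    qPhi q n a b c d e f = qPhi q n a b' c' d e' f' := by
  unfold qPhi
  rw [qSears hq a b c d e f n hbal]
  refine sum_congr rfl fun z hz => ?_
  have hz' : z ≤ n := Nat.lt_succ_iff.1 (mem_range.1 hz)
  have h1 : ∀ x x' : ℚ, x' = 1 - x + a - n →
      qPoch q (x - a) (n - z) = (-1) ^ (n - z) * qPoch q (x' + z) (n - z) := by
    rintro x x' rfl
    rw [qPoch_neg, Nat.cast_sub hz']
    congr 2; ring
  rw [h1 e e' he, h1 f f' hf, hb, hc]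
  linear_combination (qBin q n z * (-1) ^ z * qPoch q a z * qPoch q (d - b) z * qPoch q (d - c) z
    * qPoch q (d + z) (n - z) * qPoch q (e' + z) (n - z) * qPoch q (f' + z) (n - z))
    * neg_one_pow_mul_self (n - z)

/-- The substitution z ↦ n - z exchanges upper and lower parameters. -/
lemma qPhi_reverse {n : ℕ} {a b c d e f a' b' c' d' e' f' : ℚ} (ha : a' = 1 - d - n)
    (hb : b' = 1 - e - n) (hc : c' = 1 - f - n) (hd : d' = 1 - a - n) (he : e' = 1 - b - n)
    (hf : f' = 1 - c - n) :
    qPhi q n a b c d e f = qPhi q n a' b' c' d' e' f' := by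
  unfold qPhi
  rw [← sum_range_reflect]
  refine sum_congr rfl fun z hz => ?_
  have hz' : z ≤ n := Nat.lt_succ_iff.1 (mem_range.1 hz)
  rw [show n + 1 - 1 - z = n - z by omega, qBin_symm hz', show n - (n - z) = z by omega]
  have h1 : ∀ x x' : ℚ, x' = 1 - x - n →
      qPoch q x (n - z) = (-1) ^ (n - z) * qPoch q (x' + z) (n - z) := by
    rintro x x' rfl
    rw [qPoch_neg, Nat.cast_sub hz']; congr 2; ring
  have h2 : ∀ x x' : ℚ, x' = 1 - x - n →
      qPoch q (x + (n - z : ℕ)) z = (-1) ^ z * qPoch q x' z := by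
    rintro x x' rfl
    rw [qPoch_neg, Nat.cast_sub hz']; congr 2; ring
  rw [h1 a d' hd, h1 b e' he, h1 c f' hf, h2 d a' ha, h2 e b' hb, h2 f c' hc]
  have s1 := neg_one_pow_mul_self (n - z)
  have s2 := neg_one_pow_mul_self z
  generalize (-1 : ℂ) ^ (n - z) = s at *
  generalize (-1 : ℂ) ^ z = t at *
  have s3 : s * s * s * s * (t * t * t) = t := by
    rw [show s * s * s * s * (t * t * t) = (s * s) * (s * s) * (t * t) * t by ring, s1, s2]; ring
  linear_combination (qBin q n z * qPoch q a' z * qPoch q b' z * qPoch q c' z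
    * qPoch q (d' + z) (n - z) * qPoch q (e' + z) (n - z) * qPoch q (f' + z) (n - z)) * s3

variable (hq : IsGeneric q)
include hq

lemma qInvFact_mul_eq_qBin (n z : ℕ) :
    qInvFact q z * qInvFact q ((n : ℚ) - z) = qInvFact q n * qBin q n z := by
  unfold qBin
  linear_combination (- qInvFact q z * qInvFact q ((n : ℚ) - z))
    * qFact_mul_qInvFact hq (x := n) (by positivity)

/-- A dictionary between sums of factorials and cleared series: [x+z]! and 1/[v-z]! give upper
parameters x+1 and -v, while [y-z]! and 1/[w+z]! give lower parameters -y and w+1. Only the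
distribution of the factorials differs in the companion lemmas. -/
lemma sum_eq_qPhi_122 {n : ℕ} {x y₁ y₂ v₁ v₂ w : ℚ} (hx : IsNat x) (hy₁ : IsNat (y₁ - n))
    (hy₂ : IsNat (y₂ - n)) (hv₁ : IsInt v₁) (hv₂ : IsInt v₂) (hw : IsInt w) :
    ∑ z ∈ range (n + 1), (-1) ^ z * qFact q (x + z) * qFact q (y₁ - z) * qFact q (y₂ - z)
      * (qInvFact q z * qInvFact q ((n : ℚ) - z)) * qInvFact q (v₁ - z) * qInvFact q (v₂ - z)
      * qInvFact q (w + z) =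
    qFact q x * qFact q (y₁ - n) * qFact q (y₂ - n) * qInvFact q n * qInvFact q v₁
      * qInvFact q v₂ * qInvFact q (w + n)
      * qPhi q n (x + 1) (-v₁) (-v₂) (-y₁) (-y₂) (w + 1) := by
  rw [qPhi, mul_sum]
  refine sum_congr rfl fun z hz => ?_
  have hz' : z ≤ n := Nat.lt_succ_iff.1 (mem_range.1 hz)
  rw [qFact_add_natCast hx, qFact_sub hy₁ hz', qFact_sub hy₂ hz', qInvFact_sub hq hv₁,
    qInvFact_sub hq hv₂, qInvFact_add hq hw hz', qInvFact_mul_eq_qBin hq]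
  have s1 := neg_one_pow_mul_self (n - z)
  have s2 := neg_one_pow_mul_self z
  generalize (-1 : ℂ) ^ (n - z) = s at *
  generalize (-1 : ℂ) ^ z = t at *
  have s3 : s * s * (t * t * t) = t := by
    rw [show s * s * (t * t * t) = (s * s) * (t * t) * t by ring, s1, s2]; ring
  linear_combination (qFact q x * qFact q (y₁ - n) * qFact q (y₂ - n) * qInvFact q n
    * qInvFact q v₁ * qInvFact q v₂ * qInvFact q (w + n) * qBin q n z * qPoch q (x + 1) z
    * qPoch q (-v₁) z * qPoch q (-v₂) z * qPoch q (-y₁ + z) (n - z) * qPoch q (-y₂ + z) (n - z)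
    * qPoch q (w + 1 + z) (n - z)) * s3

lemma sum_eq_qPhi_033 {n : ℕ} {y₁ y₂ y₃ v₁ v₂ v₃ : ℚ} (hy₁ : IsNat (y₁ - n))
    (hy₂ : IsNat (y₂ - n)) (hy₃ : IsNat (y₃ - n)) (hv₁ : IsInt v₁) (hv₂ : IsInt v₂)
    (hv₃ : IsInt v₃) :
    ∑ z ∈ range (n + 1), (-1) ^ z * qFact q (y₁ - z) * qFact q (y₂ - z) * qFact q (y₃ - z)
      * (qInvFact q z * qInvFact q ((n : ℚ) - z)) * qInvFact q (v₁ - z) * qInvFact q (v₂ - z)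
      * qInvFact q (v₃ - z) =
    (-1) ^ n * qFact q (y₁ - n) * qFact q (y₂ - n) * qFact q (y₃ - n) * qInvFact q n
      * qInvFact q v₁ * qInvFact q v₂ * qInvFact q v₃
      * qPhi q n (-v₁) (-v₂) (-v₃) (-y₁) (-y₂) (-y₃) := by
  rw [qPhi, mul_sum]
  refine sum_congr rfl fun z hz => ?_
  have hz' : z ≤ n := Nat.lt_succ_iff.1 (mem_range.1 hz)
  rw [qFact_sub hy₁ hz', qFact_sub hy₂ hz', qFact_sub hy₃ hz', qInvFact_sub hq hv₁,
    qInvFact_sub hq hv₂, qInvFact_sub hq hv₃, qInvFact_mul_eq_qBin hq]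
  have s0 : (-1 : ℂ) ^ n = (-1) ^ (n - z) * (-1) ^ z := by rw [← pow_add]; congr 1; omega
  rw [s0]
  have s1 := neg_one_pow_mul_self (n - z)
  have s2 := neg_one_pow_mul_self z
  generalize (-1 : ℂ) ^ (n - z) = s at *
  generalize (-1 : ℂ) ^ z = t at *
  have s3 : s * s * s * (t * t * t * t) = s * t * t := by
    rw [show s * s * s * (t * t * t * t) = (s * s) * (t * t) * (s * t * t) by ring, s1, s2]; ring
  linear_combination (qFact q (y₁ - n) * qFact q (y₂ - n) * qFact q (y₃ - n) * qInvFact q n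
    * qInvFact q v₁ * qInvFact q v₂ * qInvFact q v₃ * qBin q n z * qPoch q (-v₁) z
    * qPoch q (-v₂) z * qPoch q (-v₃) z * qPoch q (-y₁ + z) (n - z) * qPoch q (-y₂ + z) (n - z)
    * qPoch q (-y₃ + z) (n - z)) * s3

lemma sum_eq_qPhi_211 {n : ℕ} {x₁ x₂ y v w₁ w₂ : ℚ} (hx₁ : IsNat x₁) (hx₂ : IsNat x₂)
    (hy : IsNat (y - n)) (hv : IsInt v) (hw₁ : IsInt w₁) (hw₂ : IsInt w₂) :
    ∑ z ∈ range (n + 1), (-1) ^ z * qFact q (x₁ + z) * qFact q (x₂ + z) * qFact q (y - z)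
      * (qInvFact q z * qInvFact q ((n : ℚ) - z)) * qInvFact q (v - z) * qInvFact q (w₁ + z)
      * qInvFact q (w₂ + z) =
    (-1) ^ n * qFact q x₁ * qFact q x₂ * qFact q (y - n) * qInvFact q n * qInvFact q v
      * qInvFact q (w₁ + n) * qInvFact q (w₂ + n)
      * qPhi q n (x₁ + 1) (x₂ + 1) (-v) (-y) (w₁ + 1) (w₂ + 1) := by
  rw [qPhi, mul_sum]
  refine sum_congr rfl fun z hz => ?_
  have hz' : z ≤ n := Nat.lt_succ_iff.1 (mem_range.1 hz)
  rw [qFact_add_natCast hx₁, qFact_add_natCast hx₂, qFact_sub hy hz', qInvFact_sub hq hv,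
    qInvFact_add hq hw₁ hz', qInvFact_add hq hw₂ hz', qInvFact_mul_eq_qBin hq]
  have s0 : (-1 : ℂ) ^ n = (-1) ^ (n - z) * (-1) ^ z := by rw [← pow_add]; congr 1; omega
  rw [s0]
  ring

lemma sum_eq_qPhi_103 {n : ℕ} {x v₁ v₂ w₁ w₂ w₃ : ℚ} (hx : IsNat x)
    (hv₁ : IsInt v₁) (hv₂ : IsInt v₂) (hw₁ : IsInt w₁) (hw₂ : IsInt w₂) (hw₃ : IsInt w₃) :
    ∑ z ∈ range (n + 1), (-1) ^ z * qFact q (x + z)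
      * (qInvFact q z * qInvFact q ((n : ℚ) - z)) * qInvFact q (v₁ - z) * qInvFact q (v₂ - z)
      * qInvFact q (w₁ + z) * qInvFact q (w₂ + z) * qInvFact q (w₃ + z) =
    qFact q x * qInvFact q n * qInvFact q v₁ * qInvFact q v₂ * qInvFact q (w₁ + n)
      * qInvFact q (w₂ + n) * qInvFact q (w₃ + n)
      * qPhi q n (x + 1) (-v₁) (-v₂) (w₁ + 1) (w₂ + 1) (w₃ + 1) := by
  rw [qPhi, mul_sum]
  refine sum_congr rfl fun z hz => ?_
  have hz' : z ≤ n := Nat.lt_succ_iff.1 (mem_range.1 hz)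
  rw [qFact_add_natCast hx, qInvFact_sub hq hv₁, qInvFact_sub hq hv₂, qInvFact_add hq hw₁ hz',
    qInvFact_add hq hw₂ hz', qInvFact_add hq hw₃ hz', qInvFact_mul_eq_qBin hq]
  have s2 := neg_one_pow_mul_self z
  generalize (-1 : ℂ) ^ z = t at *
  linear_combination (qFact q x * qInvFact q n * qInvFact q v₁ * qInvFact q v₂
    * qInvFact q (w₁ + n) * qInvFact q (w₂ + n) * qInvFact q (w₃ + n) * qBin q n z
    * qPoch q (x + 1) z * qPoch q (-v₁) z * qPoch q (-v₂) z * qPoch q (w₁ + 1 + z) (n - z)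
    * qPoch q (w₂ + 1 + z) (n - z) * qPoch q (w₃ + 1 + z) (n - z) * t) * s2

end

/-! ### Representations of the Racah sum

The parameters `a b e f g` stand for the triads `(abe)`, `(efg)`, `(agj)` and `(bfj)`. -/

/-- The term of a Racah sum. -/
def racahTerm (q : ℂ) (p₁ p₂ p₃ p₄ r₁ r₂ r₃ z : ℚ) : ℂ :=
  sgn z * qFact q (z + 1) * qInvFact q (z - p₁) * qInvFact q (z - p₂) * qInvFact q (z - p₃)
    * qInvFact q (z - p₄) * qInvFact q (r₁ - z) * qInvFact q (r₂ - z) * qInvFact q (r₃ - z)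

/-- The Racah sum in the `6j` coefficient. -/
def racah (q : ℂ) (a b e f g j : ℚ) : ℂ :=
  nsum (a + b + f + g) (racahTerm q (a + g + j) (a + b + e) (f + g + e) (f + b + j)
    (a + b + f + g) (a + f + j + e) (g + b + j + e))

/-- `1 / ([x-j]! [x+j+1]!)`. -/
def jPair (q : ℂ) (x j : ℚ) : ℂ := qInvFact q (x - j) * qInvFact q (x + j + 1)

/-- `[u+j]! / [j-u]!`. -/
def jRatio (q : ℂ) (u j : ℚ) : ℂ := qFact q (u + j) * qInvFact q (j - u)

/-- The coefficient of `jPair (a + f - e + z)` in `hatA`. -/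
def termA (q : ℂ) (a b e f g z : ℚ) : ℂ :=
  sgn z * (qFact q (a + b - e + z) * qFact q (f + g - e + z) * qFact q (2 * e - z) * qInvFact q z
    * qInvFact q (b + e - a - z) * qInvFact q (g - f + e - z))

/-- The coefficient of `jRatio (e + f - a - z)` in `hatB`. -/
def termB (q : ℂ) (a b e f g z : ℚ) : ℂ :=
  sgn z * (qFact q (2 * e - z) * qFact q (a + b - e + z) * qInvFact q z * qInvFact q (e + f - g - z)
    * qInvFact q (b - a + e - z) * qInvFact q (e + f + g + 1 - z))

/-- The coefficient of `jPair (a + g - z)` in `hatC`. -/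
def termC (q : ℂ) (a b e f g z : ℚ) : ℂ :=
  sgn z * (qFact q (a - b + f + g - z) * qFact q (a + b + f + g + 1 - z) * qFact q (2 * g - z)
    * qInvFact q z * qInvFact q (f + g - e - z) * qInvFact q (e + f + g + 1 - z))

/-- The coefficient of `jRatio (a + f - e - z)` in `hatD`. -/
def termD (q : ℂ) (a b e f g z : ℚ) : ℂ :=
  sgn z * (qFact q (b + e - a + z) * qFact q (e - f + g + z) * qInvFact q z
    * qInvFact q (a + b - e - z) * qInvFact q (f + g - e - z) * qInvFact q (2 * e + 1 + z))

/-- The Racah sum as a combination of `jPair`s, with parameters rising from `a + f - e`. -/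
def hatA (q : ℂ) (a b e f g j : ℚ) : ℂ :=
  nsum (b + e - a) fun z => termA q a b e f g z * jPair q (a + f - e + z) j

/-- The Racah sum as a combination of `jRatio`s, with parameters falling from `e + f - a`. -/
def hatB (q : ℂ) (a b e f g j : ℚ) : ℂ :=
  nsum (e + f - g) fun z => termB q a b e f g z * jRatio q (e + f - a - z) j

/-- The Racah sum as a combination of `jPair`s, with parameters falling from `a + g`. -/
def hatC (q : ℂ) (a b e f g j : ℚ) : ℂ :=
  nsum (f + g - e) fun z => termC q a b e f g z * jPair q (a + g - z) j

/-- The Racah sum as a combination of `jRatio`s, with parameters falling from `a + f - e`. -/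
def hatD (q : ℂ) (a b e f g j : ℚ) : ℂ :=
  nsum (f + g - e) fun z => termD q a b e f g z * jRatio q (a + f - e - z) j

lemma nonneg_of_qInvFact_ne_zero {q : ℂ} {x : ℚ} (h : qInvFact q x ≠ 0) : 0 ≤ x := by
  by_contra hx
  exact h (qInvFact_of_neg (not_le.1 hx))

section
variable {q : ℂ} (hq : IsGeneric q)
include hq

/-- Any lower limit p₁ and upper limit r₁ may serve as ends, since the other inverse factorials
remove superfluous terms. In the applications the two are chosen so that n = r₁ - p₁ does not
involve j, which gives the transformed sums ranges independent of j. -/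
lemma nsum_racahTerm {p₁ p₂ p₃ p₄ r₁ r₂ r₃ R m₂ m₃ m₄ s₂ s₃ : ℚ} {n : ℕ} (hn : r₁ - p₁ = n)
    (hR : IsNat R) (h : ∀ z, z ≤ r₁ → z ≤ r₂ → z ≤ r₃ → z ≤ R)
    (hp₁ : IsNat p₁) (hm₂ : m₂ = p₁ - p₂ + n) (hm₃ : m₃ = p₁ - p₃ + n) (hm₄ : m₄ = p₁ - p₄ + n)
    (hs₂ : s₂ = r₂ - p₁) (hs₃ : s₃ = r₃ - p₁)
    (im₂ : IsInt m₂) (im₃ : IsInt m₃) (im₄ : IsInt m₄) (is₂ : IsInt s₂) (is₃ : IsInt s₃) :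
    nsum R (racahTerm q p₁ p₂ p₃ p₄ r₁ r₂ r₃) =
    sgn p₁ * (qFact q (p₁ + 1) * qInvFact q n * qInvFact q s₂ * qInvFact q s₃ * qInvFact q m₂
      * qInvFact q m₃ * qInvFact q m₄)
      * qPhi q n (p₁ + 2) (-s₂) (-s₃) (m₂ - n + 1) (m₃ - n + 1) (m₄ - n + 1) := by
  obtain ⟨M, rfl⟩ := hR
  rw [nsum_natCast]
  have h1 := sum_shift (racahTerm q p₁ p₂ p₃ p₄ r₁ r₂ r₃) 0 p₁ 1 M n (Or.inl rfl)
    (hp₁.isInt.sub ⟨0, by simp⟩) (by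
      intro i hi
      unfold racahTerm at hi
      rw [zero_add] at hi ⊢
      simp only [mul_ne_zero_iff] at hi
      obtain ⟨⟨⟨⟨⟨⟨⟨_, i1⟩, _⟩, _⟩, _⟩, i5⟩, i6⟩, i7⟩ := hi
      have i1 := nonneg_of_qInvFact_ne_zero i1
      have i5 := nonneg_of_qInvFact_ne_zero i5
      have i6 := nonneg_of_qInvFact_ne_zero i6
      have i7 := nonneg_of_qInvFact_ne_zero i7
      have h0 := hp₁.nonneg
      refine ⟨?_, ?_, by linarith, by linarith⟩
      · have : (0 : ℚ) ≤ i := by linarith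
        exact_mod_cast this
      · exact_mod_cast h i (by linarith) (by linarith) (by linarith))
  simp only [zero_add, one_mul] at h1
  rw [h1, mul_assoc, show p₁ + 2 = p₁ + 1 + 1 by ring]
  have h2 := sum_eq_qPhi_103 hq (n := n) (x := p₁ + 1) (v₁ := s₂) (v₂ := s₃) (w₁ := m₂ - n)
    (w₂ := m₃ - n) (w₃ := m₄ - n) (hp₁.add ⟨1, by simp⟩) is₂ is₃ (im₂.sub (isInt_natCast n))
    (im₃.sub (isInt_natCast n)) (im₄.sub (isInt_natCast n))
  simp only [sub_add_cancel] at h2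
  rw [← h2, mul_sum]
  refine sum_congr rfl fun z _ => ?_
  unfold racahTerm
  rw [sgn_add _ (isInt_natCast z), sgn_natCast, show p₁ + z - p₁ = (z : ℚ) by ring,
    show r₁ - (p₁ + z) = n - z by linarith, hm₂, hm₃, hm₄, hs₂, hs₃,
    show p₁ + z - p₂ = p₁ - p₂ + n - n + z by ring, show p₁ + z - p₃ = p₁ - p₃ + n - n + z by ring,
    show p₁ + z - p₄ = p₁ - p₄ + n - n + z by ring, show r₂ - (p₁ + z) = r₂ - p₁ - z by ring,
    show r₃ - (p₁ + z) = r₃ - p₁ - z by ring, show p₁ + z + 1 = p₁ + 1 + z by ring]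
  ring

variable {a b e f g j : ℚ} (h₁ : Tri a b e) (h₂ : Tri e f g) (h₃ : Tri a g j) (h₄ : Tri b f j)
include h₁ h₂ h₃ h₄

/-- The sum is read from a+g+j to g+b+j+e, of length b+e-a. Sears' transformation with the upper
parameter j-b-f fixed, followed by reversal, leaves j only in the two lower parameters that make up
a pair. -/
lemma racah_eq_hatA : racah q a b e f g j =
    sgn (g + j + b + e) * (qFact q (a + g + j + 1) * qFact q (b + f + j + 1)
        * qInvFact q (g + j - a)
      * qInvFact q (b + j - f) * qInvFact q (e + f - g) * qInvFact q (a + b - e)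
      * qInvFact q (f + g - e) * qInvFact q (a + e - b)) * hatA q a b e f g j := by
  obtain ⟨n, hn⟩ := h₁.n3
  have hr := nsum_racahTerm hq (p₁ := a + g + j) (p₂ := a + b + e) (p₃ := f + g + e)
    (p₄ := f + b + j) (r₁ := g + b + j + e) (r₂ := a + b + f + g) (r₃ := a + f + j + e)
    (R := a + b + f + g) (m₂ := g + j - a) (m₃ := b + j - f) (m₄ := e + g - f) (s₂ := b + f - j)
    (s₃ := e + f - g) (n := n) (by linarith) ((h₃.sum.add h₄.n1).of_eq (by ring))
    (fun z _ h _ => h) h₃.sum (by linarith) (by linarith) (by linarith) (by ring) (by ring)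
    h₃.n3.isInt h₄.n2.isInt h₂.n2.isInt h₄.n1.isInt h₂.n1.isInt
  have hr' := show racah q a b e f g j = _ from Eq.trans (by
    rw [racah]; congr 1; funext z; unfold racahTerm; ring) hr
  have hh := sum_eq_qPhi_211 hq (n := n) (x₁ := a + b - e) (x₂ := f + g - e)
    (y := 2 * e) (v := g - f + e) (w₁ := a + f - e - j) (w₂ := a + f - e + j + 1)
    h₁.n1 h₂.n3 (h₁.n2.of_eq (by linarith)) (h₂.n2.isInt.of_eq (by ring))
    ((h₄.n1.isInt.sub h₁.n3.isInt).of_eq (by ring))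
    ((h₄.sum_one.isInt.sub h₁.n3.isInt).of_eq (by ring))
  have hat := show hatA q a b e f g j = _ from Eq.trans (by
    rw [hatA, hn, nsum_natCast]
    refine sum_congr rfl fun z _ => ?_
    rw [termA, jPair, hn, sgn_natCast, show a + f - e + z - j = a + f - e - j + z by ring,
      show a + f - e + z + j + 1 = a + f - e + j + 1 + z by ring]
    ring) hh
  have hphi : qPhi q n (a + g + j + 2) (-(b + f - j)) (-(e + f - g)) (g + j - a - n + 1)
      (b + j - f - n + 1) (e + g - f - n + 1) =
      qPhi q n (a + b - e + 1) (f + g - e + 1) (-(g - f + e)) (-(2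
          * e)) (a + f - e - j + 1) (a + f - e + j + 1 + 1) := by
    calc
      _ = qPhi q n (a + g + j + 2) (j - b - f) (g - f - e) (g + j - b - e + 1) (a + j - f - e + 1)
          (a + g - f - b + 1) := by congr 1 <;> linarith
      _ = qPhi q n (j - b - f) (a + g + j + 2) (g - f - e) (a + g - f - b + 1) (g + j - b - e + 1)
          (a + j - f - e + 1) := by
        unfold qPhi; exact sum_congr rfl fun z _ => by ring
      _ = qPhi q n (j - b - f) (-(f + b + j + 1)) (a - b + e + 1) (a + g - f - b + 1)
          (a - g - b - f) (-(2
              * b)) := qPhi_sears hq (by linarith) (by linarith) (by linarith) (by linarith)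
                  (by linarith)
      _ = qPhi q n (-(g - f + e)) (f + g - e + 1) (a + b - e + 1) (a + f - e - j + 1)
          (a + f - e + j + 1 + 1) (-(2
              * e)) := qPhi_reverse (by linarith) (by linarith) (by linarith) (by linarith)
                  (by linarith) (by linarith)
      _ = qPhi q n (a + b - e + 1) (f + g - e + 1) (-(g - f + e)) (-(2
          * e)) (a + f - e - j + 1) (a + f - e + j + 1 + 1) := by
        unfold qPhi; exact sum_congr rfl fun z _ => by ring
  have hs : sgn (g + j + b + e) * (-1) ^ n = sgn (a + g + j) := by
    rw [← sgn_natCast, ← sgn_add _ (isInt_natCast n), ← hn]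
    exact sgn_congr (h₁.n3.isInt.of_eq (by ring))
  rw [hr', hat, hphi, ← hs, show 2 * e - (n : ℚ) = a + e - b by linarith,
    show a + f - e - j + (n : ℚ) = b + f - j by linarith,
    show a + f - e + j + 1 + (n : ℚ) = b + f + j + 1 by linarith,
        show g - f + e = e + g - f by ring]
  rw [qInvFact_of_nonneg h₁.n1.nonneg, qInvFact_of_nonneg h₂.n3.nonneg,
    qInvFact_of_nonneg h₁.n2.nonneg, qInvFact_of_nonneg h₄.sum_one.nonneg]
  have := qFact_ne_zero hq (a + b - e)
  have := qFact_ne_zero hq (f + g - e)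
  have := qFact_ne_zero hq (a + e - b)
  have := qFact_ne_zero hq (b + f + j + 1)
  field_simp

/-- The sum is read from a+g+j to a+f+j+e, of length e+f-g. Sears' transformation with the upper
parameter a-b-e fixed leaves j only in two lower parameters, one from a numerator factorial and one
from a denominator factorial: a ratio. -/
lemma racah_eq_hatB : racah q a b e f g j =
    sgn (a + g + j) * (qFact q (a + g + j + 1) * qInvFact q (f + j - b) * qInvFact q (b + f - j)
      * qInvFact q (g + j - a) * qFact q (e + f + g + 1) * qInvFact q (a + e - b)
      * qInvFact q (e + g - f) * qInvFact q (a + b - e)) * hatB q a b e f g j := by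
  obtain ⟨n, hn⟩ := h₂.n1
  have hr := nsum_racahTerm hq (p₁ := a + g + j) (p₂ := a + b + e) (p₃ := f + g + e)
    (p₄ := f + b + j) (r₁ := a + f + j + e) (r₂ := a + b + f + g) (r₃ := g + b + j + e)
    (R := a + b + f + g) (m₂ := f + j - b) (m₃ := a + j - g) (m₄ := a + e - b) (s₂ := b + f - j)
    (s₃ := b + e - a) (n := n) (by linarith) ((h₃.sum.add h₄.n1).of_eq (by ring))
    (fun z _ h _ => h) h₃.sum (by linarith) (by linarith) (by linarith) (by ring) (by ring)
    h₄.n3.isInt h₃.n2.isInt h₁.n2.isInt h₄.n1.isInt h₁.n3.isInt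
  have hr' := show racah q a b e f g j = _ from Eq.trans (by
    rw [racah]; congr 1; funext z; unfold racahTerm; ring) hr
  have hh := sum_eq_qPhi_122 hq (n := n) (x := a + b - e) (y₁ := 2 * e) (y₂ := e + f - a + j)
    (v₁ := b - a + e) (v₂ := e + f + g + 1) (w := j - (e + f - a)) h₁.n1
    (h₂.n2.of_eq (by linarith)) (h₃.n3.of_eq (by linarith)) (h₁.n3.isInt.of_eq (by ring))
    (h₂.sum_one.isInt.of_eq (by ring)) ((h₃.n2.isInt.sub h₂.n1.isInt).of_eq (by ring))
  have hat := show hatB q a b e f g j = _ from Eq.trans (by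
    rw [hatB, hn, nsum_natCast]
    refine sum_congr rfl fun z _ => ?_
    rw [termB, jRatio, hn, sgn_natCast, show e + f - a - z + j = e + f - a + j - z by ring,
      show j - (e + f - a - z) = j - (e + f - a) + z by ring]
    ring) hh
  have hphi : qPhi q n (a + g + j + 2) (-(b + f - j)) (-(b + e - a)) (f + j - b - n + 1)
      (a + j - g - n + 1) (a + e - b - n + 1) =
      qPhi q n (a + b - e + 1) (-(b - a + e)) (-(e + f + g + 1)) (-(2
          * e)) (-(e + f - a + j)) (j - (e + f - a) + 1) := by
    calc
      _ = qPhi q n (a + g + j + 2) (-(b + f - j)) (a - b - e) (g + j - b - e + 1)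
          (a + j - e - f + 1) (a + g - f - b + 1) := by congr 1 <;> linarith
      _ = qPhi q n (a - b - e) (a + g + j + 2) (-(b + f - j)) (a + j - e - f + 1)
          (g + j - b - e + 1) (a + g - f - b + 1) := by
        unfold qPhi; exact sum_congr rfl fun z _ => by ring
      _ = qPhi q n (a - b - e) (-(e + f + g + 1)) (a + b - e + 1) (a + j - e - f + 1)
          (-(e + f - a + j)) (-(2
              * e)) := qPhi_sears hq (by linarith) (by linarith) (by linarith) (by linarith)
                  (by linarith)
      _ = qPhi q n (a + b - e + 1) (a - b - e) (-(e + f + g + 1)) (-(2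
          * e)) (-(e + f - a + j)) (a + j - e - f + 1) := by
        unfold qPhi; exact sum_congr rfl fun z _ => by ring
      _ = qPhi q n (a + b - e + 1) (-(b - a + e)) (-(e + f + g + 1)) (-(2
          * e)) (-(e + f - a + j)) (j - (e + f - a) + 1) := by congr 1 <;> linarith
  rw [hr', hat, hphi, show 2 * e - (n : ℚ) = e + g - f by linarith,
    show e + f - a + j - (n : ℚ) = g + j - a by linarith,
    show j - (e + f - a) + (n : ℚ) = a + j - g by linarith, show b - a + e = b + e - a by ring]
  rw [qInvFact_of_nonneg h₁.n1.nonneg, qInvFact_of_nonneg h₂.n2.nonneg,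
    qInvFact_of_nonneg h₃.n3.nonneg, qInvFact_of_nonneg h₂.sum_one.nonneg]
  have := qFact_ne_zero hq (a + b - e)
  have := qFact_ne_zero hq (e + g - f)
  have := qFact_ne_zero hq (g + j - a)
  have := qFact_ne_zero hq (e + f + g + 1)
  field_simp

/-- The sum is read between the limits a+b+e and a+b+f+g, both free of j. After reversal, Sears'
transformation with j-a-g fixed leaves j only in two upper parameters. -/
lemma racah_eq_hatC : racah q a b e f g j =
    sgn (a + b + f + g) * (qFact q (a + g + j + 1) * qInvFact q (f + j - b) * qInvFact q (b + f - j)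
      * qInvFact q (g + j - a) * qFact q (e + f + g + 1) * qInvFact q (a + e - b)
      * qInvFact q (e + g - f) * qInvFact q (a + b - e)) * hatC q a b e f g j := by
  obtain ⟨n, hn⟩ := h₂.n3
  have hn : f + g - e = n := by linarith
  have hr := nsum_racahTerm hq (p₁ := a + b + e) (p₂ := a + g + j) (p₃ := f + g + e)
    (p₄ := f + b + j) (r₁ := a + b + f + g) (r₂ := a + f + j + e) (r₃ := g + b + j + e)
    (R := a + b + f + g) (m₂ := b + f - j) (m₃ := a + b - e) (m₄ := a + g - j) (s₂ := f + j - b)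
    (s₃ := g + j - a) (n := n) (by linarith) ((h₃.sum.add h₄.n1).of_eq (by ring))
    (fun z h _ _ => h) h₁.sum (by linarith) (by linarith) (by linarith) (by ring) (by ring)
    h₄.n1.isInt h₁.n1.isInt h₃.n1.isInt h₄.n3.isInt h₃.n3.isInt
  have hr' := show racah q a b e f g j = _ from Eq.trans (by
    rw [racah]; congr 1; funext z; unfold racahTerm; ring) hr
  have hh := sum_eq_qPhi_033 hq (n := n) (y₁ := a - b + f + g) (y₂ := a + b + f + g + 1)
    (y₃ := 2 * g) (v₁ := e + f + g + 1) (v₂ := a + g - j) (v₃ := a + g + j + 1)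
    (h₁.n2.of_eq (by linarith)) (h₁.sum_one.of_eq (by linarith)) (h₂.n2.of_eq (by linarith))
    h₂.sum_one.isInt h₃.n1.isInt h₃.sum_one.isInt
  have hat := show hatC q a b e f g j = _ from Eq.trans (by
    rw [hatC, hn, nsum_natCast]
    refine sum_congr rfl fun z _ => ?_
    rw [termC, jPair, hn, sgn_natCast, show a + g - z - j = a + g - j - z by ring,
      show a + g - z + j + 1 = a + g + j + 1 - z by ring]
    ring) hh
  have hphi : qPhi q n (a + b + e + 2) (-(f + j - b)) (-(g + j - a)) (b + f - j - n + 1)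
      (a + b - e - n + 1) (a + g - j - n + 1) =
      qPhi q n (-(e + f + g + 1)) (-(a + g - j)) (-(a + g + j + 1)) (-(a - b + f + g))
          (-(a + b + f + g + 1)) (-(2 * g)) := by
    calc
      _ = qPhi q n (j - b - f) (e - a - b) (j - a - g) (-(a + b + f + g + 1)) (1 + e + j - b - g)
          (1 + e + j - a - f) := qPhi_reverse (by linarith) (by linarith) (by linarith)
              (by linarith) (by linarith) (by linarith)
      _ = qPhi q n (j - a - g) (j - b - f) (e - a - b) (-(a + b + f + g + 1)) (1 + e + j - b - g)
          (1 + e + j - a - f) := by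
        unfold qPhi; exact sum_congr rfl fun z _ => by ring
      _ = qPhi q n (j - a - g) (-(a + g + j + 1)) (-(e + f + g + 1)) (-(a + b + f + g + 1))
          (-(a - b + f + g)) (-(2
              * g)) := qPhi_sears hq (by linarith) (by linarith) (by linarith) (by linarith)
                  (by linarith)
      _ = qPhi q n (-(e + f + g + 1)) (j - a - g) (-(a + g + j + 1)) (-(a - b + f + g))
          (-(a + b + f + g + 1)) (-(2 * g)) := by
        unfold qPhi; exact sum_congr rfl fun z _ => by ring
      _ = qPhi q n (-(e + f + g + 1)) (-(a + g - j)) (-(a + g + j + 1)) (-(a - b + f + g))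
          (-(a + b + f + g + 1)) (-(2 * g)) := by congr 1; linarith
  have hs : sgn (a + b + f + g) * (-1) ^ n = sgn (a + b + e) := by
    rw [← sgn_natCast, ← sgn_add _ (isInt_natCast n), ← hn]
    exact sgn_congr (h₂.n3.isInt.of_eq (by ring))
  rw [hr', hat, hphi, ← hs, show a - b + f + g - (n : ℚ) = a + e - b by linarith,
    show a + b + f + g + 1 - (n : ℚ) = a + b + e + 1 by linarith,
    show 2 * g - (n : ℚ) = e + g - f by linarith]
  rw [qInvFact_of_nonneg h₁.n2.nonneg, qInvFact_of_nonneg h₂.n2.nonneg,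
    qInvFact_of_nonneg h₃.sum_one.nonneg, qInvFact_of_nonneg h₂.sum_one.nonneg]
  have := qFact_ne_zero hq (a + e - b)
  have := qFact_ne_zero hq (e + g - f)
  have := qFact_ne_zero hq (a + g + j + 1)
  have := qFact_ne_zero hq (e + f + g + 1)
  field_simp

/-- The same reversed series as for representation C, but with e-a-b as the fixed parameter in
Sears' transformation. -/
lemma racah_eq_hatD : racah q a b e f g j =
    sgn (a + b + f + g) * (qFact q (a + b + e + 1) * qFact q (e + f + g + 1)
        * qInvFact q (b + f - j)
      * qInvFact q (a + g - j) * qInvFact q (f + j - b) * qInvFact q (a + j - g)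
      * qInvFact q (b + e - a) * qInvFact q (e + g - f)) * hatD q a b e f g j := by
  obtain ⟨n, hn⟩ := h₂.n3
  have hn : f + g - e = n := by linarith
  have hr := nsum_racahTerm hq (p₁ := a + b + e) (p₂ := a + g + j) (p₃ := f + g + e)
    (p₄ := f + b + j) (r₁ := a + b + f + g) (r₂ := a + f + j + e) (r₃ := g + b + j + e)
    (R := a + b + f + g) (m₂ := b + f - j) (m₃ := a + b - e) (m₄ := a + g - j) (s₂ := f + j - b)
    (s₃ := g + j - a) (n := n) (by linarith) ((h₃.sum.add h₄.n1).of_eq (by ring))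
    (fun z h _ _ => h) h₁.sum (by linarith) (by linarith) (by linarith) (by ring) (by ring)
    h₄.n1.isInt h₁.n1.isInt h₃.n1.isInt h₄.n3.isInt h₃.n3.isInt
  have hr' := show racah q a b e f g j = _ from Eq.trans (by
    rw [racah]; congr 1; funext z; unfold racahTerm; ring) hr
  have hh := sum_eq_qPhi_211 hq (n := n) (x₁ := b + e - a) (x₂ := e - f + g)
    (y := a + f - e + j) (v := a + b - e) (w₁ := 2 * e + 1) (w₂ := j - (a + f - e))
    h₁.n3 (h₂.n2.of_eq (by ring)) (h₃.n2.of_eq (by linarith)) h₁.n1.isInt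
    (h₁.two3.isInt.add isInt_one) ((h₃.n3.isInt.sub h₂.n3.isInt).of_eq (by ring))
  have hat := show hatD q a b e f g j = _ from Eq.trans (by
    rw [hatD, hn, nsum_natCast]
    refine sum_congr rfl fun z _ => ?_
    rw [termD, jRatio, hn, sgn_natCast, show a + f - e - z + j = a + f - e + j - z by ring,
      show j - (a + f - e - z) = j - (a + f - e) + z by ring]
    ring) hh
  have hphi : qPhi q n (a + b + e + 2) (-(f + j - b)) (-(g + j - a)) (b + f - j - n + 1)
      (a + b - e - n + 1) (a + g - j - n + 1) =
      qPhi q n (b + e - a + 1) (e - f + g + 1) (-(a + b - e)) (-(a + f - e + j)) (2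
          * e + 1 + 1) (j - (a + f - e) + 1) := by
    calc
      _ = qPhi q n (j - b - f) (e - a - b) (j - a - g) (-(a + b + f + g + 1)) (1 + e + j - b - g)
          (1 + e + j - a - f) := qPhi_reverse (by linarith) (by linarith) (by linarith)
              (by linarith) (by linarith) (by linarith)
      _ = qPhi q n (e - a - b) (j - b - f) (j - a - g) (1 + e + j - a - f) (-(a + b + f + g + 1))
          (1 + e + j - b - g) := by
        unfold qPhi; exact sum_congr rfl fun z _ => by ring
      _ = qPhi q n (e - a - b) (b + e - a + 1) (e - f + g + 1) (1 + e + j - a - f) (2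
          * e + 1 + 1) (-(a + f - e + j)) := qPhi_sears hq (by linarith) (by linarith)
              (by linarith) (by linarith) (by linarith)
      _ = qPhi q n (b + e - a + 1) (e - f + g + 1) (e - a - b) (-(a + f - e + j)) (2
          * e + 1 + 1) (1 + e + j - a - f) := by
        unfold qPhi; exact sum_congr rfl fun z _ => by ring
      _ = qPhi q n (b + e - a + 1) (e - f + g + 1) (-(a + b - e)) (-(a + f - e + j)) (2
          * e + 1 + 1) (j - (a + f - e) + 1) := by congr 1 <;> linarith
  have hs : sgn (a + b + f + g) * (-1) ^ n = sgn (a + b + e) := by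
    rw [← sgn_natCast, ← sgn_add _ (isInt_natCast n), ← hn]
    exact sgn_congr (h₂.n3.isInt.of_eq (by ring))
  rw [hr', hat, hphi, ← hs, show a + f - e + j - (n : ℚ) = a + j - g by linarith,
    show 2 * e + 1 + (n : ℚ) = e + f + g + 1 by linarith,
    show j - (a + f - e) + (n : ℚ) = g + j - a by linarith, show e - f + g = e + g - f by ring]
  rw [qInvFact_of_nonneg h₁.n3.nonneg, qInvFact_of_nonneg h₂.n2.nonneg,
    qInvFact_of_nonneg h₃.n2.nonneg, qInvFact_of_nonneg h₂.sum_one.nonneg]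
  have := qFact_ne_zero hq (b + e - a)
  have := qFact_ne_zero hq (e + g - f)
  have := qFact_ne_zero hq (a + j - g)
  have := qFact_ne_zero hq (e + f + g + 1)
  field_simp

end

/-! ### The summation over the intermediate angular momentum -/

/-- `Σ f (j₀ + i)` over `0 ≤ i ≤ N`. -/
def jsum (j₀ : ℚ) (N : ℕ) (f : ℚ → ℂ) : ℂ := ∑ i ∈ range (N + 1), f (j₀ + i)

/-- The weight of the summation over `j`. -/
def jWeight (q : ℂ) (j : ℚ) : ℂ := qPow q (-(j * (j + 1))) * qNum q (2 * j + 1)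

lemma qFact_two_mul_add_one {q : ℂ} (hq : IsGeneric q) {u : ℚ} (h : IsNat (2 * u)) :
    qNum q (2 * u + 1) * qFact q (2 * u) * qInvFact q (2 * u + 1) = 1 := by
  rw [← qFact_add_one h, qFact_mul_qInvFact hq (h.add ⟨1, by simp⟩).nonneg]

/-- The source of all recurrences in the j-sums: multiplied into a summand, the first product on the
right raises the parameter u of a ratio, the second lowers the parameter x of a pair. -/
lemma qNum_three_term {q : ℂ} (hq : IsGeneric q) (x u j : ℚ) :
    qNum q (x - u) * qNum q (x + u + 1) =
      qNum q (j - u) * qNum q (j + u + 1) + qNum q (x - j) * qNum q (x + j + 1) := by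
  have q0 := hq.ne_zero
  by_cases h : q = 1
  · subst h; simp only [qNum_base_one]; push_cast; ring
  · simp only [qNum_of_ne h, qPow_add q0, qPow_sub q0]
    have := qPow_ne_zero q0 x
    have := qPow_ne_zero q0 u
    have := qPow_ne_zero q0 j
    have := qPow_ne_zero q0 1
    have ht := hq.sub_inv_ne_zero h
    generalize q - q⁻¹ = t at *
    field_simp
    ring

section
variable {q : ℂ} (hq : IsGeneric q)
include hq

lemma jPair_sub_one {x j : ℚ} (h : IsInt (x - j)) (h' : IsInt (2 * j)) :
    jPair q (x - 1) j = qNum q (x - j) * qNum q (x + j + 1) * jPair q x j := by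
  unfold jPair
  rw [show x - 1 - j = x - j - 1 by ring, show x - 1 + j + 1 = x + j + 1 - 1 by ring,
    qInvFact_sub_one hq h, qInvFact_sub_one hq ((h.add h').add isInt_one |>.of_eq (by ring))]
  ring

lemma jRatio_add_one {u j : ℚ} (h : IsInt (j - u)) (h' : IsNat (u + j)) :
    jRatio q (u + 1) j = qNum q (j - u) * qNum q (j + u + 1) * jRatio q u j := by
  unfold jRatio
  rw [show j - (u + 1) = j - u - 1 by ring, qInvFact_sub_one hq h,
    show u + 1 + j = u + j + 1 by ring, qFact_add_one h', show u + j + 1 = j + u + 1 by ring]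
  ring

/-- The closed form satisfies the recurrence of the j-sum, by the addition formula for [x+u+1] =
[(x-v)+(u+v+1)]. The factorial [u+v]! enters only through its step from u to u+1 and is therefore
replaced by an abstract G; later G is a shifted factorial, which makes sense for u+v < 0 as well. -/
lemma closed_form_rec {x u v : ℚ} {G G' : ℂ} (hG : G' = qNum q (u + v + 1) * G)
    (hxu : IsInt (x - u)) (hxv : IsInt (x - v)) :
    qNum q (x - u) * qNum q (x + u + 1)
      * (qPow q (u * v - x * (u + v + 1)) * G * qInvFact q (x - u) * qInvFact q (x - v)) =
    qPow q ((u + 1) * v - x * (u + 1 + v + 1)) * G' * qInvFact q (x - (u + 1))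
        * qInvFact q (x - v)
      + qPow q (u * v - (x - 1) * (u + v + 1)) * G * qInvFact q (x - 1 - u)
        * qInvFact q (x - 1 - v) := by
  have q0 := hq.ne_zero
  rw [show x - (u + 1) = x - u - 1 by ring, show x - 1 - u = x - u - 1 by ring,
    show x - 1 - v = x - v - 1 by ring, qInvFact_sub_one hq hxu, qInvFact_sub_one hq hxv, hG]
  have e1 : qPow q ((u + 1) * v - x * (u + 1 + v + 1))
      = qPow q (u * v - x * (u + v + 1)) * qPow q (-(x - v)) := by
    rw [← qPow_add q0]; congr 1; ring
  have e2 : qPow q (u * v - (x - 1) * (u + v + 1))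
      = qPow q (u * v - x * (u + v + 1)) * qPow q (u + v + 1) := by
    rw [← qPow_add q0]; congr 1; ring
  have e3 : qNum q (x + u + 1) = qPow q (u + v + 1) * qNum q (x - v)
      + qPow q (-(x - v)) * qNum q (u + v + 1) := by
    rw [← qNum_add hq]; congr 1; ring
  rw [e1, e2, e3]
  ring

/-- Induction on x - u: the recurrence expresses the value at (x, u) through those at (x, u+1) and
(x-1, u). The condition 0 ≤ u keeps [x+u+1] different from 0, so that the recurrence can be solved.
-/
lemma jsum_eq_of_nonneg {j₀ : ℚ} {N : ℕ} (h0 : IsNat (2 * j₀)) (h1 : j₀ < 1) {v : ℚ}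
    (hv : IsInt (v - j₀)) (m : ℕ) : ∀ x u : ℚ, IsInt (u - j₀) → 0 ≤ u → 0 ≤ u + v →
    x + 1 = u + m → x ≤ j₀ + N →
    jsum j₀ N (fun j => jWeight q j * jRatio q u j * jRatio q v j * jPair q x j) =
      qPow q (u * v - x * (u + v + 1)) * qFact q (u + v) * qInvFact q (x - u)
        * qInvFact q (x - v) := by
  have h00 := h0.nonneg
  induction m with
  | zero =>
    intro x u hu hu0 huv hx hxN
    simp only [Nat.cast_zero] at hx
    rw [qInvFact_of_neg (x := x - u) (by linarith)]
    simp only [mul_zero, zero_mul]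
    refine sum_eq_zero fun i _ => ?_
    dsimp only [jRatio, jPair]
    rcases lt_or_ge (j₀ + i) u with h | h
    · rw [qInvFact_of_neg (x := j₀ + i - u) (by linarith)]; ring
    · rw [qInvFact_of_neg (x := x - (j₀ + i)) (by linarith)]; ring
  | succ m ih =>
    intro x u hu hu0 huv hx hxN
    obtain _ | m := m
    -- For x = u only j = u contributes, and there [2u+1] [2u]! / [2u+1]! = 1.
    · obtain rfl : x = u := by push_cast at hx; linarith
      obtain ⟨i₀, hi₀⟩ := (hu.add isInt_one).isNat (by linarith)
      obtain ⟨i, rfl⟩ : ∃ i : ℕ, x = j₀ + i := by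
        obtain ⟨k, hk⟩ := hu
        have : -1 < (k : ℚ) := by linarith
        have : -1 < k := by exact_mod_cast this
        obtain ⟨i, rfl⟩ := Int.eq_ofNat_of_zero_le (show 0 ≤ k by omega)
        exact ⟨i, by push_cast at hk; linarith⟩
      have hi : i ≤ N := by
        have : (i : ℚ) ≤ N := by linarith
        exact_mod_cast this
      rw [jsum, sum_eq_single_of_mem i (mem_range.2 (by omega))]
      · have e1 := qFact_two_mul_add_one hq (u := j₀ + i)
          ((h0.add (isNat_natCast (2 * i))).of_eq (by push_cast; ring))
        unfold jWeight jRatio jPair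
        rw [sub_self, qInvFact_zero, show j₀ + i + (j₀ + i) = 2 * (j₀ + i) by ring,
          show (j₀ + i) * v - (j₀ + i) * (j₀ + i + v + 1) = -((j₀ + i) * (j₀ + i + 1)) by ring,
          add_comm v]
        linear_combination (qPow q (-((j₀ + i) * (j₀ + i + 1))) * qFact q (j₀ + i + v)
          * qInvFact q (j₀ + i - v)) * e1
      · intro k _ hk
        have hk' : (k : ℚ) ≠ i := by exact_mod_cast hk
        unfold jRatio jPair
        rcases lt_or_gt_of_ne hk' with h | h
        · rw [qInvFact_of_neg (x := j₀ + k - (j₀ + i)) (by linarith)]; ring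
        · rw [qInvFact_of_neg (x := j₀ + i - (j₀ + k)) (by linarith)]; ring
    · push_cast at hx
      have hm : (0 : ℚ) ≤ m := by positivity
      have hxu : IsInt (x - u) := ⟨m + 1, by push_cast; linarith⟩
      have hxv : IsInt (x - v) := (hxu.add (hu.sub hv)).of_eq (by ring)
      have huv' : IsNat (u + v) :=
        IsInt.isNat ((((hu.add hv).add h0.isInt)).of_eq (by ring)) huv
      have hne : qNum q (x - u) * qNum q (x + u + 1) ≠ 0 := by
        refine mul_ne_zero (qNum_ne_zero hq hxu (by linarith)) (qNum_ne_zero hq ?_ (by linarith))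
        exact ((hxu.add (hu.add hu)).add (h0.isInt.add isInt_one)).of_eq (by ring)
      refine mul_left_cancel₀ hne ?_
      have hG : qFact q (u + 1 + v) = qNum q (u + v + 1) * qFact q (u + v) := by
        rw [← qFact_add_one huv']; congr 1; ring
      rw [closed_form_rec hq hG hxu hxv, ← ih x (u + 1) ((hu.add isInt_one).of_eq (by ring))
        (by linarith) (by linarith) (by push_cast; linarith) hxN,
        ← ih (x - 1) u hu hu0 huv (by push_cast; linarith) (by linarith)]
      unfold jsum
      rw [mul_sum, ← sum_add_distrib]
      refine sum_congr rfl fun i _ => ?_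
      have hj : IsInt (j₀ + i - u) := ((isInt_natCast i).sub hu).of_eq (by ring)
      have h2j : IsInt (2 * (j₀ + i)) :=
        (h0.isInt.add (isInt_natCast (2 * i))).of_eq (by push_cast; ring)
      have hi0 : (0 : ℚ) ≤ i := by positivity
      beta_reduce
      rw [jRatio_add_one hq hj (IsInt.isNat ((h2j.sub hj).of_eq (by ring)) (by linarith)),
        jPair_sub_one hq ((hxu.sub hj).of_eq (by ring)) h2j]
      linear_combination (jWeight q (j₀ + i) * jRatio q u (j₀ + i) * jRatio q v (j₀ + i)
        * jPair q x (j₀ + i)) * qNum_three_term hq x u (j₀ + i)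

/-- The summation formula over `j` on which the triple sum formulas rest. -/
theorem jsum_jRatio_jRatio_jPair {j₀ : ℚ} {N : ℕ} (h0 : IsNat (2 * j₀)) (h1 : j₀ < 1) {x u v : ℚ}
    (hu : IsInt (u - j₀)) (hv : IsInt (v - j₀)) (hx : IsInt (x - j₀)) (huv : 0 ≤ u + v)
    (hxN : x ≤ j₀ + N) :
    jsum j₀ N (fun j => jWeight q j * jRatio q u j * jRatio q v j * jPair q x j) =
      qPow q (u * v - x * (u + v + 1)) * qFact q (u + v) * qInvFact q (x - u)
        * qInvFact q (x - v) := by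
  have key : ∀ u v : ℚ, IsInt (u - j₀) → IsInt (v - j₀) → 0 ≤ u → 0 ≤ u + v →
      jsum j₀ N (fun j => jWeight q j * jRatio q u j * jRatio q v j * jPair q x j) =
      qPow q (u * v - x * (u + v + 1)) * qFact q (u + v) * qInvFact q (x - u)
        * qInvFact q (x - v) := by
    intro u v hu hv hu0 huv
    rcases lt_or_ge x u with h | h
    · rw [qInvFact_of_neg (x := x - u) (by linarith)]
      simp only [mul_zero, zero_mul]
      refine sum_eq_zero fun i _ => ?_
      dsimp only [jRatio, jPair]
      rcases lt_or_ge (j₀ + i) u with h' | h'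
      · rw [qInvFact_of_neg (x := j₀ + i - u) (by linarith)]; ring
      · rw [qInvFact_of_neg (x := x - (j₀ + i)) (by linarith)]; ring
    · obtain ⟨m, hm⟩ := IsInt.isNat ((hx.sub hu).of_eq (show x - u = _ by ring)) (by linarith)
      exact jsum_eq_of_nonneg hq h0 h1 hv (m + 1) x u hu hu0 huv (by push_cast; linarith) hxN
  -- The formula is symmetric in u and v, and u + v ≥ 0 forces one of them to be non-negative.
  rcases le_total 0 u with h | h
  · exact key u v hu hv h huv
  · have e := key v u hv hu (by linarith) (by linarith)
    rw [show v * u - x * (v + u + 1) = u * v - x * (u + v + 1) by ring, add_comm v u] at e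
    rw [mul_right_comm, ← e]
    unfold jsum
    exact sum_congr rfl fun i _ => by ring

/-! ### Vanishing sums -/

omit hq in
lemma prod_map_range_qNum (c : ℚ) (z l : ℕ) :
    (((List.range l).map fun i : ℕ => c + i).map fun c => qNum q (c + z)).prod
      = qPoch q (c + z) l := by
  induction l with
  | zero => simp [qPoch_zero]
  | succ l ih =>
    rw [List.range_succ, List.map_append, List.map_append, List.prod_append, ih, qPoch_succ]
    simp only [List.map_cons, List.map_nil, List.prod_singleton]
    congr 2; ring

lemma sum_qBin_qPoch_eq_zero (c₁ c₂ c₃ : ℚ) (l₁ l₂ l₃ n : ℕ) (κ : ℤ)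
    (h1 : l₁ + l₂ + l₃ + κ + 1 ≤ n) (h1' : l₁ + l₂ + l₃ - κ + 1 ≤ n)
    (h2 : (l₁ + l₂ + l₃ + κ + 1 - n) % 2 = 0) :
    ∑ z ∈ range (n + 1), qBin q n z * ((-1) ^ z * qPow q (κ * z)
      * (qPoch q (c₁ + z) l₁ * qPoch q (c₂ + z) l₂ * qPoch q (c₃ + z) l₃)) = 0 := by
  have h := sum_qBin_prod_eq_zero hq (((List.range l₁).map fun i : ℕ => c₁ + i)
    ++ ((List.range l₂).map fun i : ℕ => c₂ + i) ++ ((List.range l₃).map fun i : ℕ => c₃ + i)) n κ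
    (by simp only [List.length_append, List.length_map, List.length_range]; push_cast; omega)
    (by simp only [List.length_append, List.length_map, List.length_range]; push_cast; omega)
    (by simp only [List.length_append, List.length_map, List.length_range]; push_cast; omega)
  simpa only [List.map_append, List.prod_append, prod_map_range_qNum] using h

lemma qFact_mul_qInvFact_sub {x y : ℚ} {l : ℕ} (hx : IsNat x) (hy : x - y = l) :
    qFact q x * qInvFact q y = qPoch q (y + 1) l := by
  have hy' : IsInt y := (hx.isInt.sub (isInt_natCast l)).of_eq (by linarith)
  rw [qInvFact_eq_qPoch_mul hq hy' l, ← hy, show y + (x - y) = x by ring]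
  linear_combination qPoch q (y + 1) l * qFact_mul_qInvFact hq hx.nonneg

lemma qFact_mul_qInvFact_sub' {x y : ℚ} {l : ℕ} (hx : IsNat x) (hy : x - y = l) :
    qFact q x * qInvFact q y = (-1) ^ l * qPoch q (-x) l := by
  rw [qFact_mul_qInvFact_sub hq hx hy, qPoch_neg]
  congr 2; linarith

/-- For a+g < j ≤ b+f the quotients of factorials become products of e+g-f, b+f-j and j-a-g-1 linear
factors, together n-1 with n = b+e-a. An alternating q-binomial sum of order n annihilates such a
product. The binomial comes from 1/[b-a+e-z]!, hence the change of the upper limit. -/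
lemma hatB_eq_zero {a b e f g j : ℚ} (h₁ : Tri a b e) (h₂ : Tri e f g) (hj : IsInt (j - a - g))
    (hj1 : a + g < j) (hj2 : j ≤ b + f) : hatB q a b e f g j = 0 := by
  obtain ⟨n, hn⟩ := h₁.n3
  obtain ⟨l₁, hl₁⟩ := h₂.n2
  obtain ⟨l₂, hl₂⟩ : IsNat (b + f - j) := IsInt.isNat
    (((h₁.n3.isInt.add h₂.n1.isInt).sub (hj.add h₂.two1.isInt)).of_eq (by ring)) (by linarith)
  obtain ⟨l₃, hl₃⟩ : IsNat (j - a - g - 1) := (hj.sub isInt_one).isNat (by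
    have := hj.neg.le_neg_one (by linarith)
    linarith)
  have i1 := h₁.n1
  have i2 := h₁.n2.nonneg
  rw [hatB, nsum_range (M := b + e - a) h₂.n1 h₁.n3, hn, nsum_natCast]
  · have hlen : (l₁ : ℤ) + l₂ + l₃ + 1 = n := by
      have : (l₁ : ℚ) + l₂ + l₃ + 1 = n := by linarith
      exact_mod_cast this
    have h := sum_qBin_qPoch_eq_zero hq (-(2 * e)) (j - (e + f - a) + 1) (-(e + f - a + j)) l₁ l₂ l₃
      n 0 (by omega) (by omega) (by omega)
    rw [← mul_right_inj' (a := (-1) ^ l₁ * (-1) ^ l₃ * qInvFact q n)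
      (mul_ne_zero (mul_ne_zero (by simp) (by simp)) (qInvFact_ne_zero hq (by positivity))),
      mul_zero, mul_sum] at h
    rw [← h]
    refine sum_congr rfl fun z hz => ?_
    have hz' : (z : ℚ) ≤ n := by exact_mod_cast Nat.lt_succ_iff.1 (mem_range.1 hz)
    have iz := isInt_natCast z
    have e1 := qFact_mul_qInvFact_sub' hq (x := 2 * e - z) (y := e + f - g - z) (l := l₁)
      (IsInt.isNat (h₁.two3.isInt.sub iz) (by linarith)) (by linarith)
    have e2 := qFact_mul_qInvFact_sub hq (x := a + b - e + z) (y := j - (e + f - a - z)) (l := l₂)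
      (i1.add (isNat_natCast z)) (by linarith)
    have e3 := qFact_mul_qInvFact_sub' hq (x := e + f - a - z + j) (y := e + f + g + 1 - z)
        (l := l₃)
      (IsInt.isNat (((hj.add h₂.sum.isInt).sub iz).of_eq (by ring))
        (by linarith [h₂.n3.nonneg])) (by linarith)
    have e4 := qInvFact_mul_eq_qBin hq n z
    rw [termB, jRatio, sgn_natCast, show b - a + e - z = n - z by linarith]
    rw [show -(2 * e - (z : ℚ)) = -(2 * e) + z by ring] at e1
    rw [show j - (e + f - a - (z : ℚ)) + 1 = j - (e + f - a) + 1 + z by ring] at e2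
    rw [show -(e + f - a - (z : ℚ) + j) = -(e + f - a + j) + z by ring] at e3
    simp only [Int.cast_zero, zero_mul, qPow_zero]
    calc _ = (-1) ^ z * (qFact q (2 * e - z) * qInvFact q (e + f - g - z))
          * (qFact q (a + b - e + z) * qInvFact q (j - (e + f - a - z)))
          * (qFact q (e + f - a - z + j) * qInvFact q (e + f + g + 1 - z))
          * (qInvFact q z * qInvFact q (n - z)) := by ring
      _ = _ := by rw [e1, e2, e3, e4]; ring
  · intro z _ hz
    have hz := left_ne_zero_of_mul hz
    unfold termB at hz
    simp only [mul_ne_zero_iff] at hz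
    have c1 := nonneg_of_qInvFact_ne_zero hz.2.1.1.2
    have c2 := nonneg_of_qInvFact_ne_zero hz.2.1.2
    constructor <;> linarith

/-- The product which the summation over `j` leaves of `jPair`, as far as it depends on `x`. -/
def closedPair (q : ℂ) (U V x : ℚ) : ℂ :=
  qPow q (-(x * (U + V + 1))) * (qInvFact q (x - U) * qInvFact q (x - V))

/-- An n-th difference applied to fewer than n linear factors, now with a power q^(κz), κ = -(U+V+1)
≥ 0; the number of factors plus κ is n-1. For U+V = -1 this is the vanishing of `hatA` outside the
triangle; the general case is needed for exchanging representations. -/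
lemma nsum_termA_eq_zero {a b e f g U V : ℚ} (h₁ : Tri a b e) (h₂ : Tri e f g)
    (hU : IsNat (U - (a - g))) (hV : IsNat (V - (f - b))) (hUV : U + V < 0) :
    nsum (b + e - a) (fun z => termA q a b e f g z * closedPair q U V (a + f - e + z)) = 0 := by
  obtain ⟨n, hn⟩ := h₁.n3
  obtain ⟨l₁, hl₁⟩ := hU
  obtain ⟨l₂, hl₂⟩ := hV
  obtain ⟨l₃, hl₃⟩ := h₂.n1
  obtain ⟨κ, hκ⟩ : IsInt (-(U + V + 1)) :=
    ⟨(l₃ : ℤ) + n - 1 - l₁ - l₂ - 2 * l₃, by push_cast; linarith⟩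
  have i1 := h₁.n2.nonneg
  have hκ0 : (0 : ℤ) ≤ κ := by
    have : -1 < (κ : ℚ) := by linarith
    have : -1 < κ := by exact_mod_cast this
    omega
  rw [hn, nsum_natCast]
  have hlen : (l₁ : ℤ) + l₂ + l₃ + κ + 1 = n := by
    have : (l₁ : ℚ) + l₂ + l₃ + κ + 1 = n := by linarith
    exact_mod_cast this
  have h := sum_qBin_qPoch_eq_zero hq (a + f - e - U + 1) (a + f - e - V + 1) (-(2 * e)) l₁ l₂ l₃
      n κ (by omega) (by omega) (by omega)
  rw [← mul_right_inj' (a := (-1) ^ l₃ * qInvFact q n * qPow q ((a + f - e) * κ))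
      (mul_ne_zero (mul_ne_zero (by simp) (qInvFact_ne_zero hq (by positivity)))
        (qPow_ne_zero hq.ne_zero _)), mul_zero, mul_sum] at h
  rw [← h]
  refine sum_congr rfl fun z hz => ?_
  have hz' : (z : ℚ) ≤ n := by exact_mod_cast Nat.lt_succ_iff.1 (mem_range.1 hz)
  have iz := isInt_natCast z
  have e1 := qFact_mul_qInvFact_sub hq (x := f + g - e + z) (y := a + f - e - U + z) (l := l₁)
      ((h₂.n3.of_eq (by ring)).add (isNat_natCast z)) (by linarith)
  have e2 := qFact_mul_qInvFact_sub hq (x := a + b - e + z) (y := a + f - e - V + z) (l := l₂)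
      (h₁.n1.add (isNat_natCast z)) (by linarith)
  have e3 := qFact_mul_qInvFact_sub' hq (x := 2 * e - z) (y := g - f + e - z) (l := l₃)
      (IsInt.isNat (h₁.two3.isInt.sub iz) (by linarith)) (by linarith)
  have e4 := qInvFact_mul_eq_qBin hq n z
  have e5 : qPow q (-((a + f - e + z) * (U + V + 1)))
      = qPow q ((a + f - e) * κ) * qPow q (κ * z) := by
    rw [← qPow_add hq.ne_zero, ← hκ]; congr 1; ring
  rw [termA, closedPair, sgn_natCast, hn, e5, show a + f - e + z - U = a + f - e - U + z by ring,
    show a + f - e + z - V = a + f - e - V + z by ring]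
  rw [show a + f - e - U + (z : ℚ) + 1 = a + f - e - U + 1 + z by ring] at e1
  rw [show a + f - e - V + (z : ℚ) + 1 = a + f - e - V + 1 + z by ring] at e2
  rw [show -(2 * e - (z : ℚ)) = -(2 * e) + z by ring] at e3
  calc _ = (-1) ^ z * (qPow q ((a + f - e) * κ) * qPow q (κ * z))
        * (qFact q (f + g - e + z) * qInvFact q (a + f - e - U + z))
        * (qFact q (a + b - e + z) * qInvFact q (a + f - e - V + z))
        * (qFact q (2 * e - z) * qInvFact q (g - f + e - z))
        * (qInvFact q z * qInvFact q (n - z)) := by ring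
    _ = _ := by rw [e1, e2, e3, e4]; ring

lemma nsum_termC_eq_zero {a b e f g U V : ℚ} (h₁ : Tri a b e) (h₂ : Tri e f g)
    (hU : IsNat (U - (a - g))) (hV : IsNat (V - (b - f))) (hUV : U + V < 0) :
    nsum (f + g - e) (fun z => termC q a b e f g z * closedPair q U V (a + g - z)) = 0 := by
  obtain ⟨l₁, hl₁⟩ := h₁.n2
  obtain ⟨l₂, hl₂⟩ := h₁.n1
  obtain ⟨l₃, hl₃⟩ := hU
  have hV0 := hV.nonneg
  have i1 := h₁.two1
  have i2 := h₂.n3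
  obtain ⟨κ, hκ⟩ : IsInt (U + V + 1) := by
    obtain ⟨l₄, hl₄⟩ := hV
    obtain ⟨l₅, hl₅⟩ := i2
    exact ⟨l₃ + l₄ + 1 + l₂ - l₅, by push_cast; linarith⟩
  -- The q-binomial is supplied by the factor 1/[a+g-z-V]! of `closedPair`; the factor 1/[f+g-e-z]!
  -- is part of a product of linear factors.
  obtain ⟨n, hn⟩ : IsNat (a + g - V) := IsInt.isNat ⟨l₃ + l₁ + l₂ - κ + 1, by push_cast; linarith⟩
    (by linarith [i1.nonneg, show (0 : ℚ) ≤ l₃ by positivity])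
  have hκ0 : κ ≤ 0 := by
    have : (κ : ℚ) < 1 := by linarith
    have : κ < 1 := by exact_mod_cast this
    omega
  have hlen : (l₁ : ℤ) + l₂ + l₃ - κ + 1 = n := by
    have : (l₁ : ℚ) + l₂ + l₃ - κ + 1 = n := by linarith
    exact_mod_cast this
  rw [nsum_range (M := (n : ℚ)) i2 (isNat_natCast n), nsum_natCast]
  · have h := sum_qBin_qPoch_eq_zero hq (-(a - b + f + g)) (-(a + b + f + g + 1)) (-(2
      * g)) l₁ l₂ l₃
      n κ (by omega) (by omega) (by omega)
    rw [← mul_right_inj' (a := (-1) ^ l₁ * (-1) ^ l₂ * (-1) ^ l₃ * qInvFact q n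
        * qPow q (-((a + g) * κ))) (mul_ne_zero (mul_ne_zero (by simp)
          (qInvFact_ne_zero hq (by positivity))) (qPow_ne_zero hq.ne_zero _)), mul_zero,
      mul_sum] at h
    rw [← h]
    refine sum_congr rfl fun z hz => ?_
    have hz' : (z : ℚ) ≤ n := by exact_mod_cast Nat.lt_succ_iff.1 (mem_range.1 hz)
    have iz := isInt_natCast z
    have hx1 : IsNat (a - b + f + g - z) := IsInt.isNat
      (((h₁.n2.isInt.add h₂.n3.isInt).sub iz).of_eq (by ring)) (by linarith)
    have e1 := qFact_mul_qInvFact_sub' hq (x := a - b + f + g - z) (y := f + g - e - z) (l := l₁)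
      hx1 (by linarith)
    have e2 := qFact_mul_qInvFact_sub' hq (x := a + b + f + g + 1 - z) (y := e + f + g + 1 - z)
      (l := l₂) (IsInt.isNat (((h₁.n1.isInt.add h₂.sum_one.isInt).sub iz).of_eq (by ring))
        (by linarith [hx1.nonneg, h₁.two2.nonneg])) (by linarith)
    have e4 := qInvFact_mul_eq_qBin hq n z
    have e5 : qPow q (-((a + g - z) * (U + V + 1)))
        = qPow q (-((a + g) * κ)) * qPow q (κ * z) := by
      rw [← qPow_add hq.ne_zero, ← hκ]; congr 1; ring
    rw [show -(a - b + f + g - (z : ℚ)) = -(a - b + f + g) + z by ring] at e1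
    rw [show -(a + b + f + g + 1 - (z : ℚ)) = -(a + b + f + g + 1) + z by ring] at e2
    rw [termC, closedPair, sgn_natCast, e5, show a + g - z - V = n - z by linarith]
    -- For z > 2g the factorial [2g-z]! has only its default value, but then both sides vanish: the
    -- left one through 1/[f+g-e-z]!, the right one through the shifted factorial that replaces it.
    rcases lt_or_ge (2 * g) (z : ℚ) with h2 | h2
    · have hI : qInvFact q (f + g - e - z) = 0 := qInvFact_of_neg (by linarith [h₂.n2.nonneg])
      have hP : qPoch q (-(a - b + f + g) + z) l₁ = 0 := by
        rw [hI, mul_zero] at e1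
        exact (mul_eq_zero.1 e1.symm).resolve_left (by simp)
      rw [hI, hP]; ring
    · have e3 := qFact_mul_qInvFact_sub' hq (x := 2 * g - z) (y := a + g - z - U) (l := l₃)
        (IsInt.isNat (h₂.two3.isInt.sub iz) (by linarith)) (by linarith)
      rw [show -(2 * g - (z : ℚ)) = -(2 * g) + z by ring] at e3
      calc _ = (-1) ^ z * (qPow q (-((a + g) * κ)) * qPow q (κ * z))
            * (qFact q (a - b + f + g - z) * qInvFact q (f + g - e - z))
            * (qFact q (a + b + f + g + 1 - z) * qInvFact q (e + f + g + 1 - z))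
            * (qFact q (2 * g - z) * qInvFact q (a + g - z - U))
            * (qInvFact q z * qInvFact q (n - z)) := by ring
        _ = _ := by rw [e1, e2, e3, e4]; ring
  · intro z _ hz
    unfold termC closedPair at hz
    simp only [mul_ne_zero_iff] at hz
    have c1 := nonneg_of_qInvFact_ne_zero hz.1.2.1.2
    have c2 := nonneg_of_qInvFact_ne_zero hz.2.2.2
    constructor <;> linarith

end

/-! ### Weighted `₃φ₂` series in terms of factorials -/

/-- A terminating `₃φ₂` series with weights, the denominators cleared. -/
def qPsi (q : ℂ) (n : ℕ) (b c d e : ℚ) (W : ℕ → ℂ) : ℂ :=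
  ∑ z ∈ range (n + 1), qBin q n z * ((-1) ^ z * qPoch q b z * qPoch q c z
      * qPoch q (d + z) (n - z) * qPoch q (e + z) (n - z) * W z)

section
variable {q : ℂ} (hq : IsGeneric q)

lemma qPsi_congr {n : ℕ} {b c d e b' c' d' e' : ℚ} {W W' : ℕ → ℂ} {k : ℂ} (hb : b = b')
    (hc : c = c') (hd : d = d') (he : e = e') (hW : ∀ z : ℕ, W z = k * W' z) :
    qPsi q n b c d e W = k * qPsi q n b' c' d' e' W' := by
  subst hb hc hd he
  rw [qPsi, qPsi, mul_sum]
  exact sum_congr rfl fun z _ => by rw [hW]; ring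

lemma qPsi_swap_num (n : ℕ) (b c d e : ℚ) (W : ℕ → ℂ) :
    qPsi q n b c d e W = qPsi q n c b d e W :=
  sum_congr rfl fun z _ => by ring

lemma qPsi_swap_den (n : ℕ) (b c d e : ℚ) (W : ℕ → ℂ) :
    qPsi q n b c d e W = qPsi q n b c e d W :=
  sum_congr rfl fun z _ => by ring

include hq

lemma qPsi_transform {P : ℚ → ℂ} (hP : IsQPow q P) {n : ℕ} {b c d e b' c' e' s t : ℚ}
    (hb : b' = d - b) (hc : c' = d - c) (he : e' = d + e - b - c) (hs : s = e' + n - 1)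
    (ht : t = b + c - d) :
    qPsi q n b c d e (fun z => P (-(z * s))) =
      qPsi q n b' c' d e' (fun z => P (-(z * s) + (n - z) * t)) := by
  subst hb hc hs he ht
  exact qThreePhiTwo hq hP b c d e n

/-- The dictionary between factorials and parameters, as for the balanced series, now with an
arbitrary weight W to carry the power of q. -/
lemma sum_eq_qPsi_1111 {n : ℕ} {x y v w : ℚ} {W : ℕ → ℂ} (hx : IsNat x) (hy : IsNat (y - n))
    (hv : IsInt v) (hw : IsInt w) :
    ∑ z ∈ range (n + 1), (-1) ^ z * qFact q (x + z) * qFact q (y - z)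
      * (qInvFact q z * qInvFact q ((n : ℚ) - z)) * qInvFact q (v - z) * qInvFact q (w + z) * W z =
    (-1) ^ n * qFact q x * qFact q (y - n) * qInvFact q n * qInvFact q v * qInvFact q (w + n)
      * qPsi q n (x + 1) (-v) (-y) (w + 1) W := by
  rw [qPsi, mul_sum]
  refine sum_congr rfl fun z hz => ?_
  have hz' : z ≤ n := Nat.lt_succ_iff.1 (mem_range.1 hz)
  rw [qFact_add_natCast hx, qFact_sub hy hz', qInvFact_sub hq hv, qInvFact_add hq hw hz',
    qInvFact_mul_eq_qBin hq]
  have s0 : (-1 : ℂ) ^ n = (-1) ^ (n - z) * (-1) ^ z := by rw [← pow_add]; congr 1; omega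
  rw [s0]; ring

lemma sum_eq_qPsi_1012 {n : ℕ} {x v w₁ w₂ : ℚ} {W : ℕ → ℂ} (hx : IsNat x) (hv : IsInt v)
    (hw₁ : IsInt w₁) (hw₂ : IsInt w₂) :
    ∑ z ∈ range (n + 1), qFact q (x + z) * (qInvFact q z * qInvFact q ((n : ℚ) - z))
      * qInvFact q (v - z) * qInvFact q (w₁ + z) * qInvFact q (w₂ + z) * W z =
    qFact q x * qInvFact q n * qInvFact q v * qInvFact q (w₁ + n) * qInvFact q (w₂ + n)
      * qPsi q n (x + 1) (-v) (w₁ + 1) (w₂ + 1) W := by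
  rw [qPsi, mul_sum]
  refine sum_congr rfl fun z hz => ?_
  have hz' : z ≤ n := Nat.lt_succ_iff.1 (mem_range.1 hz)
  rw [qFact_add_natCast hx, qInvFact_sub hq hv, qInvFact_add hq hw₁ hz', qInvFact_add hq hw₂ hz',
    qInvFact_mul_eq_qBin hq]
  ring

lemma sum_eq_qPsi_0121 {n : ℕ} {y v₁ v₂ w : ℚ} {W : ℕ → ℂ} (hy : IsNat (y - n)) (hv₁ : IsInt v₁)
    (hv₂ : IsInt v₂) (hw : IsInt w) :
    ∑ z ∈ range (n + 1), qFact q (y - z) * (qInvFact q z * qInvFact q ((n : ℚ) - z))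
      * qInvFact q (v₁ - z) * qInvFact q (v₂ - z) * qInvFact q (w + z) * W z =
    (-1) ^ n * qFact q (y - n) * qInvFact q n * qInvFact q v₁ * qInvFact q v₂ * qInvFact q (w + n)
      * qPsi q n (-v₁) (-v₂) (-y) (w + 1) W := by
  rw [qPsi, mul_sum]
  refine sum_congr rfl fun z hz => ?_
  have hz' : z ≤ n := Nat.lt_succ_iff.1 (mem_range.1 hz)
  rw [qFact_sub hy hz', qInvFact_sub hq hv₁, qInvFact_sub hq hv₂, qInvFact_add hq hw hz',
    qInvFact_mul_eq_qBin hq]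
  have s0 : (-1 : ℂ) ^ n = (-1) ^ (n - z) * (-1) ^ z := by rw [← pow_add]; congr 1; omega
  rw [s0]; ring

lemma sum_eq_qPsi_0220 {n : ℕ} {y₁ y₂ v₁ v₂ : ℚ} {W : ℕ → ℂ} (hy₁ : IsNat (y₁ - n))
    (hy₂ : IsNat (y₂ - n)) (hv₁ : IsInt v₁) (hv₂ : IsInt v₂) :
    ∑ z ∈ range (n + 1), (-1) ^ z * qFact q (y₁ - z) * qFact q (y₂ - z)
      * (qInvFact q z * qInvFact q ((n : ℚ) - z)) * qInvFact q (v₁ - z) * qInvFact q (v₂ - z)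
      * W z =
    qFact q (y₁ - n) * qFact q (y₂ - n) * qInvFact q n * qInvFact q v₁ * qInvFact q v₂
      * qPsi q n (-v₁) (-v₂) (-y₁) (-y₂) W := by
  rw [qPsi, mul_sum]
  refine sum_congr rfl fun z hz => ?_
  have hz' : z ≤ n := Nat.lt_succ_iff.1 (mem_range.1 hz)
  rw [qFact_sub hy₁ hz', qFact_sub hy₂ hz', qInvFact_sub hq hv₁, qInvFact_sub hq hv₂,
    qInvFact_mul_eq_qBin hq]
  have s1 := neg_one_pow_mul_self (n - z)
  have s2 := neg_one_pow_mul_self z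
  generalize (-1 : ℂ) ^ (n - z) = s at *
  generalize (-1 : ℂ) ^ z = t at *
  have s3 : s * s * (t * t * t) = t := by
    rw [show s * s * (t * t * t) = (s * s) * (t * t) * t by ring, s1, s2]; ring
  linear_combination (qFact q (y₁ - n) * qFact q (y₂ - n) * qInvFact q n * qInvFact q v₁
    * qInvFact q v₂ * qBin q n z * qPoch q (-v₁) z * qPoch q (-v₂) z * qPoch q (-y₁ + z) (n - z)
    * qPoch q (-y₂ + z) (n - z) * W z) * s3

lemma sum_eq_qPsi_2002 {n : ℕ} {x₁ x₂ w₁ w₂ : ℚ} {W : ℕ → ℂ} (hx₁ : IsNat x₁) (hx₂ : IsNat x₂)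
    (hw₁ : IsInt w₁) (hw₂ : IsInt w₂) :
    ∑ z ∈ range (n + 1), (-1) ^ z * qFact q (x₁ + z) * qFact q (x₂ + z)
      * (qInvFact q z * qInvFact q ((n : ℚ) - z)) * qInvFact q (w₁ + z) * qInvFact q (w₂ + z)
      * W z =
    qFact q x₁ * qFact q x₂ * qInvFact q n * qInvFact q (w₁ + n) * qInvFact q (w₂ + n)
      * qPsi q n (x₁ + 1) (x₂ + 1) (w₁ + 1) (w₂ + 1) W := by
  rw [qPsi, mul_sum]
  refine sum_congr rfl fun z hz => ?_
  have hz' : z ≤ n := Nat.lt_succ_iff.1 (mem_range.1 hz)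
  rw [qFact_add_natCast hx₁, qFact_add_natCast hx₂, qInvFact_add hq hw₁ hz',
    qInvFact_add hq hw₂ hz', qInvFact_mul_eq_qBin hq]
  ring

lemma sum_eq_qPsi_0022 {n : ℕ} {v₁ v₂ w₁ w₂ : ℚ} {W : ℕ → ℂ} (hv₁ : IsInt v₁) (hv₂ : IsInt v₂)
    (hw₁ : IsInt w₁) (hw₂ : IsInt w₂) :
    ∑ z ∈ range (n + 1), (-1) ^ z * (qInvFact q z * qInvFact q ((n : ℚ) - z)) * qInvFact q (v₁ - z)
      * qInvFact q (v₂ - z) * qInvFact q (w₁ + z) * qInvFact q (w₂ + z) * W z =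
    qInvFact q n * qInvFact q v₁ * qInvFact q v₂ * qInvFact q (w₁ + n) * qInvFact q (w₂ + n)
      * qPsi q n (-v₁) (-v₂) (w₁ + 1) (w₂ + 1) W := by
  rw [qPsi, mul_sum]
  refine sum_congr rfl fun z hz => ?_
  have hz' : z ≤ n := Nat.lt_succ_iff.1 (mem_range.1 hz)
  rw [qInvFact_sub hq hv₁, qInvFact_sub hq hv₂, qInvFact_add hq hw₁ hz', qInvFact_add hq hw₂ hz',
    qInvFact_mul_eq_qBin hq]
  linear_combination (qInvFact q n * qInvFact q v₁ * qInvFact q v₂ * qInvFact q (w₁ + n)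
    * qInvFact q (w₂ + n) * qBin q n z * qPoch q (-v₁) z * qPoch q (-v₂) z
    * qPoch q (w₁ + 1 + z) (n - z) * qPoch q (w₂ + 1 + z) (n - z) * W z * (-1) ^ z)
    * neg_one_pow_mul_self z

end

/-! ### Exchange of a ratio for a pair after the summation over `j` -/

/-- `termB` without the factor `1 / [e+f-g-z]!`. -/
def coreB (q : ℂ) (a b e f g z : ℚ) : ℂ :=
  sgn z * (qFact q (2 * e - z) * qFact q (a + b - e + z) * qInvFact q z
    * qInvFact q (b - a + e - z) * qInvFact q (e + f + g + 1 - z))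

/-- The result of the summation over `j` of a ratio with two pairs. -/
def closedPairPair (q : ℂ) (x y u : ℚ) : ℂ :=
  qPow q (x * y - u * (x + y + 1)) * qInvFact q (x - u) * qInvFact q (y - u)
    * qInvFact q (x + y + 1)

/-- The single sum which links the two sides for the smallest ratio. -/
def midBC (q : ℂ) (a b e f g x Z : ℚ) : ℂ :=
  qFact q (Z + 1) * qInvFact q (Z - (a + g + x)) * qInvFact q (Z - (e + f + g))
    * qInvFact q (Z - (a + b + e)) * qInvFact q (a + b + f + g - Z) * qInvFact q (b + e + g + x - Z)
    * qPow q (-((a - b + e + 1) * Z))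

section
variable {q : ℂ} (hq : IsGeneric q)
include hq

section
variable {a b e f g x : ℚ} (h₁ : Tri a b e) (h₂ : Tri e f g) (hx : IsInt (x - (a - g)))
include h₁ h₂ hx

/-- At the smallest ratio parameter u = a-g one has u + v = e+f-g-z for v = e+f-a-z, so the
numerator [u+v]! is exactly cancelled by the factor missing from `coreB`. A ₃φ₂ series remains and
is transformed with the character q^(-x). -/
lemma coreB_sum_eq_midBC (hx1 : a - g ≤ x) {n : ℕ} (hn : b + e - a = n) :
    nsum (b - a + e) (fun z => coreB q a b e f g z
      * (qPow q ((a - g) * (e + f - a - z) - x * (a - g + (e + f - a - z) + 1))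
        * qInvFact q (x - (e + f - a - z))))
      * (qFact q (a + g + x + 1) * qInvFact q (b + f - x) * qInvFact q (x - (a - g))) =
    (-1) ^ n * (qFact q (a + e - b) * qFact q (a + b - e) * qInvFact q (e + f + g + 1))
      * qPow q ((a - g) * (e + f - a) - x * (a - g + (e + f - a) + 1)
        - (b + e - a) * (b - e - g - x - 1) + (a - b + e + 1) * (a + g + x))
      * ∑ w ∈ range (n + 1), midBC q a b e f g x (a + g + x + w) := by
  have q0 := hq.ne_zero
  have hxn : IsNat (x - (a - g)) := hx.isNat (by linarith)
  have ib : IsInt (b + f - x) := ((h₁.n3.isInt.add h₂.n3.isInt).sub hx).of_eq (by ring)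
  have iw : IsInt (x - (e + f - a)) :=
    ((hx.add h₁.two1.isInt).sub h₂.sum.isInt).of_eq (by ring)
  have hl := sum_eq_qPsi_1111 hq (n := n) (x := a + b - e) (y := 2 * e) (v := e + f + g + 1)
    (w := x - (e + f - a))
    (W := fun z : ℕ => qPow q ((a - g) * (e + f - a - z) - x * (a - g + (e + f - a - z) + 1)))
    h₁.n1 (h₁.n2.of_eq (by linarith)) h₂.sum_one.isInt iw
  have hm := sum_eq_qPsi_1012 hq (n := n) (x := a + g + x + 1) (v := b + f - x)
    (w₁ := x - (e + f - a)) (w₂ := g + x - b - e)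
    (W := fun z : ℕ => qPow q (-((a - b + e + 1) * (a + g + x + z))))
    (((hxn.add h₁.two1).add isNat_one).of_eq (by ring)) ib iw ((hx.sub h₁.n3.isInt).of_eq (by ring))
  have hpsi := qPsi_transform hq (isQPow_qPow_neg hq) (n := n) (b := a + b - e + 1)
    (c := -(e + f + g + 1)) (d := x - (e + f - a) + 1) (e := -(2 * e)) (b' := -(b + f - x))
    (c' := a + g + x + 1 + 1) (e' := g + x - b - e + 1) (s := x - (a - g))
    (t := b - e - g - x - 1) (by ring) (by ring) (by ring) (by linarith) (by ring)
  rw [qPsi_swap_den, qPsi_congr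
    (k := qPow q ((a - g) * (e + f - a) - x * (a - g + (e + f - a) + 1)))
    (W' := fun z : ℕ => qPow q (-(-(z * (x - (a - g)))))) rfl rfl rfl rfl (fun z => by
      rw [← qPow_add q0]; congr 1; ring), hpsi, qPsi_swap_num, qPsi_congr
    (k := qPow q (-((b + e - a) * (b - e - g - x - 1)) + (a - b + e + 1) * (a + g + x)))
    (W' := fun z : ℕ => qPow q (-((a - b + e + 1) * (a + g + x + z)))) rfl rfl rfl rfl (fun z => by
      rw [← qPow_add q0, hn]; congr 1; rw [← hn]; ring)] at hl
  have hl' := show nsum (b - a + e) (fun z => coreB q a b e f g z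
      * (qPow q ((a - g) * (e + f - a - z) - x * (a - g + (e + f - a - z) + 1))
        * qInvFact q (x - (e + f - a - z)))) = _ from Eq.trans (by
    rw [show b - a + e = (n : ℚ) by linarith, nsum_natCast]
    refine sum_congr rfl fun z _ => ?_
    rw [coreB, sgn_natCast, show b - a + e - z = n - z by linarith,
      show x - (e + f - a - z) = x - (e + f - a) + z by ring]
    ring) hl
  have hm' := show ∑ w ∈ range (n + 1), midBC q a b e f g x (a + g + x + w) = _ from Eq.trans (by
    refine sum_congr rfl fun z _ => ?_
    rw [midBC, show a + g + x + z + 1 = a + g + x + 1 + z by ring,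
      show a + g + x + z - (a + g + x) = (z : ℚ) by ring,
      show a + g + x + z - (e + f + g) = x - (e + f - a) + z by ring,
      show a + g + x + z - (a + b + e) = g + x - b - e + z by ring,
      show a + b + f + g - (a + g + x + z) = b + f - x - z by ring,
      show b + e + g + x - (a + g + x + z) = n - z by linarith]
    ring) hm
  rw [hl', hm', show 2 * e - (n : ℚ) = a + e - b by linarith,
    show g + x - b - e + (n : ℚ) = x - (a - g) by linarith]
  have e0 : qPow q ((a - g) * (e + f - a) - x * (a - g + (e + f - a) + 1)
        - (b + e - a) * (b - e - g - x - 1) + (a - b + e + 1) * (a + g + x)) =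
      qPow q ((a - g) * (e + f - a) - x * (a - g + (e + f - a) + 1))
      * qPow q (-((b + e - a) * (b - e - g - x - 1)) + (a - b + e + 1) * (a + g + x)) := by
    rw [← qPow_add q0]; congr 1; ring
  rw [e0]
  ring

/-- The C-side at u = a-g is likewise a ₃φ₂ series, because [2g-z]! is cancelled by the inverse
factorial from the closed form. Its transform is the same single sum, read from the upper end
a+b+f+g downwards. -/
lemma termC_sum_eq_midBC {n : ℕ} (hn : f + g - e = n) :
    nsum (f + g - e) (fun z => sgn z * (qFact q (a - b + f + g - z)
        * qFact q (a + b + f + g + 1 - z) * qInvFact q z * qInvFact q (f + g - e - z)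
        * qInvFact q (e + f + g + 1 - z))
      * (qPow q (x * (a + g - z) - (a - g) * (x + (a + g - z) + 1))
        * qInvFact q (x + (a + g - z) + 1)))
      * (qInvFact q (a + b - e) * qInvFact q (b + f - x) * qInvFact q (x - (a - g))) =
    (-1) ^ n * (qFact q (a + e - b) * qInvFact q (e + f + g + 1) * qInvFact q (a + g + x + 1))
      * qPow q (x * (a + g) - (a - g) * (x + (a + g) + 1)
        + (f + g - e) * (b - e - g - x - 1) + (a - b + e + 1) * (a + b + f + g))
      * ∑ w ∈ range (n + 1), midBC q a b e f g x (a + b + f + g - w) := by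
  have q0 := hq.ne_zero
  have ib : IsInt (b + f - x) := ((h₁.n3.isInt.add h₂.n3.isInt).sub hx).of_eq (by ring)
  have hl := sum_eq_qPsi_0220 hq (n := n) (y₁ := a - b + f + g) (y₂ := a + b + f + g + 1)
    (v₁ := e + f + g + 1) (v₂ := a + g + x + 1)
    (W := fun z : ℕ => qPow q (x * (a + g - z) - (a - g) * (x + (a + g - z) + 1)))
    (h₁.n2.of_eq (by linarith)) (h₁.sum_one.of_eq (by linarith)) h₂.sum_one.isInt
    (((hx.add h₁.two1.isInt).add isInt_one).of_eq (by ring))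
  have hm := sum_eq_qPsi_0121 hq (n := n) (y := a + b + f + g + 1) (v₁ := a + b - e)
    (v₂ := b + f - x) (w := e + x - a - f)
    (W := fun z : ℕ => qPow q (-((a - b + e + 1) * (a + b + f + g - z))))
    (h₁.sum_one.of_eq (by linarith)) h₁.n1.isInt ib
    ((hx.sub h₂.n3.isInt).of_eq (by ring))
  have hpsi := qPsi_transform hq (isQPow_qPow hq) (n := n) (b := -(e + f + g + 1))
    (c := -(a + g + x + 1)) (d := -(a + b + f + g + 1)) (e := -(a - b + f + g)) (b' := -(a + b - e))
    (c' := -(b + f - x)) (e' := e + x - a - f + 1) (s := x - (a - g))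
    (t := b - e - g - x - 1) (by ring) (by ring) (by ring) (by linarith) (by ring)
  rw [qPsi_swap_den, qPsi_congr
    (k := qPow q (x * (a + g) - (a - g) * (x + (a + g) + 1)))
    (W' := fun z : ℕ => qPow q (-(z * (x - (a - g))))) rfl rfl rfl rfl (fun z => by
      rw [← qPow_add q0]; congr 1; ring), hpsi, qPsi_congr
    (k := qPow q ((f + g - e) * (b - e - g - x - 1) + (a - b + e + 1) * (a + b + f + g)))
    (W' := fun z : ℕ => qPow q (-((a - b + e + 1) * (a + b + f + g - z)))) rfl rfl rfl rfl
    (fun z => by rw [← qPow_add q0, hn]; congr 1; rw [← hn]; ring)] at hl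
  have hl' := show nsum (f + g - e) (fun z => sgn z * (qFact q (a - b + f + g - z)
        * qFact q (a + b + f + g + 1 - z) * qInvFact q z * qInvFact q (f + g - e - z)
        * qInvFact q (e + f + g + 1 - z))
      * (qPow q (x * (a + g - z) - (a - g) * (x + (a + g - z) + 1))
        * qInvFact q (x + (a + g - z) + 1))) = _ from Eq.trans (by
    rw [hn, nsum_natCast]
    refine sum_congr rfl fun z _ => ?_
    rw [sgn_natCast, show x + (a + g - z) + 1 = a + g + x + 1 - z by ring]
    ring) hl
  have hm' := show ∑ w ∈ range (n + 1),
      midBC q a b e f g x (a + b + f + g - w) = _ from Eq.trans (by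
    refine sum_congr rfl fun z _ => ?_
    rw [midBC, show a + b + f + g - z + 1 = a + b + f + g + 1 - z by ring,
      show a + b + f + g - z - (a + g + x) = b + f - x - z by ring,
      show a + b + f + g - z - (e + f + g) = a + b - e - z by ring,
      show a + b + f + g - z - (a + b + e) = n - z by linarith,
      show a + b + f + g - (a + b + f + g - z) = (z : ℚ) by ring,
      show b + e + g + x - (a + b + f + g - z) = e + x - a - f + z by ring]
    ring) hm
  rw [hl', hm', show a - b + f + g - (n : ℚ) = a + e - b by linarith,
    show e + x - a - f + (n : ℚ) = x - (a - g) by linarith]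
  have e0 : qPow q (x * (a + g) - (a - g) * (x + (a + g) + 1)
        + (f + g - e) * (b - e - g - x - 1) + (a - b + e + 1) * (a + b + f + g)) =
      qPow q (x * (a + g) - (a - g) * (x + (a + g) + 1))
      * qPow q ((f + g - e) * (b - e - g - x - 1) + (a - b + e + 1) * (a + b + f + g)) := by
    rw [← qPow_add q0]; congr 1; ring
  rw [e0]
  linear_combination (- qFact q (a + e - b) * qFact q (a + b + f + g + 1 - n) * qInvFact q n
    * qInvFact q (e + f + g + 1) * qInvFact q (a + g + x + 1)
    * qInvFact q (a + b - e) * qInvFact q (b + f - x) * qInvFact q (x - (a - g))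
    * qPow q (x * (a + g) - (a - g) * (x + (a + g) + 1))
    * qPow q ((f + g - e) * (b - e - g - x - 1) + (a - b + e + 1) * (a + b + f + g))
    * qPsi q n (-(a + b - e)) (-(b + f - x)) (-(a + b + f + g + 1)) (e + x - a - f + 1)
      fun z : ℕ => qPow q (-((a - b + e + 1) * (a + b + f + g - z)))) * neg_one_pow_mul_self n

/-- For x < a-g both sides are zero. Otherwise the two transforms are one sum over Z counted from
opposite ends. The bound x ≤ b+f makes the auxiliary factor 1/[b+f-x]! invertible. -/
lemma coreB_sum_eq_termC_sum (hxb : x ≤ b + f) :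
    nsum (b - a + e) (fun z => coreB q a b e f g z
      * (qPow q ((a - g) * (e + f - a - z) - x * (a - g + (e + f - a - z) + 1))
        * qInvFact q (x - (a - g)) * qInvFact q (x - (e + f - a - z)))) =
    sgn (b + f - (a - g)) * nsum (f + g - e) (fun z => termC q a b e f g z
      * closedPairPair q x (a + g - z) (a - g)) := by
  rcases lt_or_ge x (a - g) with hxu | hxu
  · simp only [closedPairPair, qInvFact_of_neg (q := q) (x := x - (a - g)) (by linarith)]
    simp [nsum]
  obtain ⟨n, hn⟩ := h₁.n3
  obtain ⟨m, hm⟩ := h₂.n3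
  have hL := coreB_sum_eq_midBC hq h₁ h₂ hx hxu hn
  have hR := termC_sum_eq_midBC hq h₁ h₂ hx hm
  have hxn : IsNat (x - (a - g)) := hx.isNat (by linarith)
  have hpn : IsNat (a + g + x + 1) := ((hxn.add h₁.two1).add isNat_one).of_eq (by ring)
  have hshift := sum_shift (midBC q a b e f g x) (a + g + x) (a + b + f + g) (-1) n m (Or.inr rfl)
    (((h₁.n3.isInt.add h₂.n3.isInt).sub hx).of_eq (by ring)) (by
      intro i hi
      unfold midBC at hi
      simp only [mul_ne_zero_iff] at hi
      obtain ⟨⟨⟨⟨⟨⟨_, i1⟩, _⟩, i3⟩, i4⟩, i5⟩, _⟩ := hi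
      have i1 := nonneg_of_qInvFact_ne_zero i1
      have i3 := nonneg_of_qInvFact_ne_zero i3
      have i4 := nonneg_of_qInvFact_ne_zero i4
      have i5 := nonneg_of_qInvFact_ne_zero i5
      refine ⟨?_, ?_, by linarith, by linarith⟩
      · have : (0 : ℚ) ≤ i := by linarith
        exact_mod_cast this
      · have : (i : ℚ) ≤ n := by linarith
        exact_mod_cast this)
  simp only [neg_one_mul, ← sub_eq_add_neg] at hshift
  rw [hshift] at hL
  have e1 : nsum (b - a + e) (fun z => coreB q a b e f g z
      * (qPow q ((a - g) * (e + f - a - z) - x * (a - g + (e + f - a - z) + 1))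
        * qInvFact q (x - (a - g)) * qInvFact q (x - (e + f - a - z)))) =
      qInvFact q (x - (a - g)) * nsum (b - a + e) (fun z => coreB q a b e f g z
      * (qPow q ((a - g) * (e + f - a - z) - x * (a - g + (e + f - a - z) + 1))
        * qInvFact q (x - (e + f - a - z)))) := by
    rw [← nsum_mul_left]; congr 1; funext z; ring
  have e2 : nsum (f + g - e) (fun z => termC q a b e f g z
      * closedPairPair q x (a + g - z) (a - g)) =
      qInvFact q (x - (a - g)) * nsum (f + g - e) (fun z => sgn z * (qFact q (a - b + f + g - z)
        * qFact q (a + b + f + g + 1 - z) * qInvFact q z * qInvFact q (f + g - e - z)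
        * qInvFact q (e + f + g + 1 - z))
      * (qPow q (x * (a + g - z) - (a - g) * (x + (a + g - z) + 1))
        * qInvFact q (x + (a + g - z) + 1))) := by
    rw [← nsum_mul_left]
    refine nsum_congr h₂.n3 fun z _ hz => ?_
    have h2 := qFact_mul_qInvFact hq (x := 2 * g - z) (by linarith [hz.nonneg, h₂.n2.nonneg])
    rw [termC, closedPairPair, show a + g - z - (a - g) = 2 * g - z by ring]
    linear_combination (qInvFact q (x - (a - g)) * (sgn z * (qFact q (a - b + f + g - z)
        * qFact q (a + b + f + g + 1 - z) * qInvFact q z * qInvFact q (f + g - e - z)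
        * qInvFact q (e + f + g + 1 - z))
      * (qPow q (x * (a + g - z) - (a - g) * (x + (a + g - z) + 1))
        * qInvFact q (x + (a + g - z) + 1)))) * h2
  rw [e1, e2]
  have hs : sgn (b + f - (a - g)) = (-1) ^ n * (-1) ^ m := by
    rw [← sgn_natCast, ← sgn_natCast, ← sgn_add _ (isInt_natCast m), ← hn, ← hm]
    congr 1; ring
  rw [hs]
  have hne : qFact q (a + g + x + 1) * qInvFact q (b + f - x) * qInvFact q (x - (a - g)) ≠ 0 :=
    mul_ne_zero (mul_ne_zero (qFact_ne_zero hq _) (qInvFact_ne_zero hq (by linarith)))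
      (qInvFact_ne_zero hq (by linarith))
  have f1 := qFact_mul_qInvFact hq h₁.n1.nonneg
  have f2 := qFact_mul_qInvFact hq hpn.nonneg
  rw [show (a - g) * (e + f - a) - x * (a - g + (e + f - a) + 1)
        - (b + e - a) * (b - e - g - x - 1) + (a - b + e + 1) * (a + g + x) =
        x * (a + g) - (a - g) * (x + (a + g) + 1)
        + (f + g - e) * (b - e - g - x - 1) + (a - b + e + 1) * (a + b + f + g) by ring] at hL
  refine mul_right_cancel₀ hne ?_
  have s1 := neg_one_pow_mul_self m
  generalize nsum (b - a + e) _ = S at *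
  generalize nsum (f + g - e) _ = T at *
  generalize ∑ w ∈ range (m + 1), midBC q a b e f g x (a + b + f + g - w) = M at *
  generalize qPow q _ = p at *
  generalize (-1 : ℂ) ^ n = s at *
  generalize (-1 : ℂ) ^ m = t at *
  generalize qInvFact q (x - (a - g)) = Ix at *
  generalize qInvFact q (b + f - x) = Ib at *
  linear_combination Ix * hL - Ix * s * t * qFact q (a + g + x + 1) * qFact q (a + b - e) * hR
    + Ix * s * t * qFact q (a + g + x + 1) * Ib * Ix * T * f1
    - Ix * s * qFact q (a + e - b) * qFact q (a + b - e) * qInvFact q (e + f + g + 1) * p * M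
      * (f2 * t * t + s1)

end

/-- The recurrence of `closed_form_rec` up to the sign of the term with u+1; an alternating sign in
u compensates for it. -/
lemma closedPairPair_rec {x y u : ℚ} (hxu : IsInt (x - u)) (hyu : IsInt (y - u))
    (hxy : IsInt (x + y + 1)) :
    qNum q (x - u) * qNum q (x + u + 1) * closedPairPair q x y u =
      -closedPairPair q x y (u + 1) + closedPairPair q (x - 1) y u := by
  have q0 := hq.ne_zero
  unfold closedPairPair
  rw [show x - (u + 1) = x - u - 1 by ring, show x - 1 - u = x - u - 1 by ring,
    show y - (u + 1) = y - u - 1 by ring, show x - 1 + y + 1 = x + y + 1 - 1 by ring,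
    qInvFact_sub_one hq hxu, qInvFact_sub_one hq hyu, qInvFact_sub_one hq hxy]
  have e1 : qPow q (x * y - (u + 1) * (x + y + 1))
      = qPow q (x * y - u * (x + y + 1)) * qPow q (-(x + y + 1)) := by
    rw [← qPow_add q0]; congr 1; ring
  have e2 : qPow q ((x - 1) * y - u * (x + y + 1 - 1))
      = qPow q (x * y - u * (x + y + 1)) * qPow q (u - y) := by
    rw [← qPow_add q0]; congr 1; ring
  have e3 : qNum q (x + u + 1) = qPow q (u - y) * qNum q (x + y + 1)
      - qPow q (-(x + y + 1)) * qNum q (y - u) := by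
    rw [sub_eq_add_neg, ← mul_neg, ← qNum_neg, neg_sub, ← qNum_add hq]; congr 1; ring
  rw [e1, e2, e3]
  ring

/-- Induction on L = u - (a-g): the common recurrence gives the values at u+1 from those at u for x
and x-1, which is why x is quantified inside the induction. On the left `qPoch` takes the place of
[u+v]!/[e+f-g-z]!. -/
theorem coreB_sum_eq_sgn_mul_termC_sum {a b e f g : ℚ} (h₁ : Tri a b e) (h₂ : Tri e f g) (L : ℕ) :
    ∀ x : ℚ, IsInt (x - (a - g)) → x ≤ b + f →
    nsum (b - a + e) (fun z => coreB q a b e f g z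
      * (qPow q ((a - g + L) * (e + f - a - z) - x * (a - g + L + (e + f - a - z) + 1))
        * qPoch q (e + f - g - z + 1) L * qInvFact q (x - (a - g + L))
        * qInvFact q (x - (e + f - a - z)))) =
    sgn (b + f - (a - g + L)) * nsum (f + g - e) (fun z => termC q a b e f g z
      * closedPairPair q x (a + g - z) (a - g + L)) := by
  induction L with
  | zero =>
    intro x hx hxb
    simpa only [Nat.cast_zero, add_zero, qPoch_zero, mul_one]
      using coreB_sum_eq_termC_sum hq h₁ h₂ hx hxb
  | succ L ih =>
    intro x hx hxb
    have i1 := ih x hx hxb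
    have i2 := ih (x - 1) ((hx.sub isInt_one).of_eq (by ring)) (by linarith)
    have hxu : IsInt (x - (a - g + L)) := (hx.sub (isInt_natCast L)).of_eq (by ring)
    have hs : sgn (b + f - (a - g + (L + 1 : ℕ))) = - sgn (b + f - (a - g + L)) := by
      rw [show b + f - (a - g + ((L + 1 : ℕ) : ℚ)) = b + f - (a - g + L) - 1 by push_cast; ring,
        sgn_sub _ isInt_one]
      simp [sgn]
    have cL : nsum (b - a + e) (fun z => coreB q a b e f g z
        * (qPow q ((a - g + (L + 1 : ℕ)) * (e + f - a - z)
            - x * (a - g + (L + 1 : ℕ) + (e + f - a - z) + 1))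
        * qPoch q (e + f - g - z + 1) (L + 1) * qInvFact q (x - (a - g + (L + 1 : ℕ)))
        * qInvFact q (x - (e + f - a - z)))) =
        qNum q (x - (a - g + L)) * qNum q (x + (a - g + L) + 1) * nsum (b - a + e)
        (fun z => coreB q a b e f g z
      * (qPow q ((a - g + L) * (e + f - a - z) - x * (a - g + L + (e + f - a - z) + 1))
        * qPoch q (e + f - g - z + 1) L * qInvFact q (x - (a - g + L))
        * qInvFact q (x - (e + f - a - z)))) - nsum (b - a + e) (fun z => coreB q a b e f g z
      * (qPow q ((a - g + L) * (e + f - a - z) - (x - 1) * (a - g + L + (e + f - a - z) + 1))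
        * qPoch q (e + f - g - z + 1) L * qInvFact q (x - 1 - (a - g + L))
        * qInvFact q (x - 1 - (e + f - a - z)))) := by
      rw [← nsum_mul_left, ← nsum_sub]
      refine nsum_congr (h₁.n3.of_eq (by ring)) fun z hz _ => ?_
      have hrec := closed_form_rec hq (x := x) (u := a - g + L) (v := e + f - a - z)
        (G := qPoch q (e + f - g - z + 1) L) (G' := qPoch q (e + f - g - z + 1) (L + 1))
        (by rw [qPoch_succ, mul_comm]; congr 2; ring) hxu
        ((((hx.sub h₂.n1.isInt).add hz.isInt).add (h₁.two1.isInt.sub h₂.two3.isInt)).of_eq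
            (by ring))
      rw [show a - g + ((L + 1 : ℕ) : ℚ) = a - g + L + 1 by push_cast; ring]
      linear_combination -coreB q a b e f g z * hrec
    have cR : nsum (f + g - e) (fun z => termC q a b e f g z
        * closedPairPair q x (a + g - z) (a - g + (L + 1 : ℕ))) =
        - (qNum q (x - (a - g + L)) * qNum q (x + (a - g + L) + 1) * nsum (f + g - e)
          (fun z => termC q a b e f g z * closedPairPair q x (a + g - z) (a - g + L))
        - nsum (f + g - e)
          (fun z => termC q a b e f g z * closedPairPair q (x - 1) (a + g - z) (a - g + L))) := by
      rw [← nsum_mul_left, ← nsum_sub, ← neg_one_mul, ← nsum_mul_left]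
      refine nsum_congr h₂.n3 fun z hz _ => ?_
      have hrec := closedPairPair_rec hq (x := x) (y := a + g - z) (u := a - g + L) hxu
        (((h₂.two3.isInt.sub hz.isInt).sub (isInt_natCast L)).of_eq (by ring))
        ((((hx.add h₁.two1.isInt).sub hz.isInt).add isInt_one).of_eq (by ring))
      rw [show a - g + ((L + 1 : ℕ) : ℚ) = a - g + L + 1 by push_cast; ring]
      linear_combination termC q a b e f g z * hrec
    rw [cL, cR, i1, i2, hs]
    ring

end

/-! ### Exchange of one ratio for another after the summation over `j` -/

/-- `termD` without the factor `1 / [a+b-e-z]!`. -/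
def coreD (q : ℂ) (a b e f g z : ℚ) : ℂ :=
  sgn z * (qFact q (b + e - a + z) * qFact q (e - f + g + z) * qInvFact q z
    * qInvFact q (f + g - e - z) * qInvFact q (2 * e + 1 + z))

/-- The coefficient in the representation by numerator factorials. -/
def termE (q : ℂ) (a b e f g z : ℚ) : ℂ :=
  sgn z * (qFact q (2 * e - z) * qInvFact q z * qInvFact q (a - b + e - z)
    * qInvFact q (e + f - g - z) * qInvFact q (e + f + g + 1 - z)
    * qInvFact q (a + b + e + 1 - z))

/-- The closed form which belongs to a pair of numerator factorials. -/
def closedNum (q : ℂ) (x w u : ℚ) : ℂ :=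
  qPow q (u * (w + 1) - x * (u + w + 2)) * qFact q (u + w + 1) * qFact q (w - x)
    * qInvFact q (x - u)

/-- The single sum which links the two sides for the smallest ratio. -/
def midDE (q : ℂ) (a b e f g x Z : ℚ) : ℂ :=
  sgn Z * qInvFact q (Z - (a + g + x)) * qInvFact q (Z - (a + b + e)) * qInvFact q (Z - (b + f + x))
    * qInvFact q (a + b + f + g - Z) * qInvFact q (a + f + e + x - Z)
    * qInvFact q (g + b + e + x - Z) * qPow q (-((e + f + g + 1) * Z))

section
variable {q : ℂ} (hq : IsGeneric q)
include hq

section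
variable {a b e f g x : ℚ} (h₁ : Tri a b e) (h₂ : Tri e f g) (hx : IsInt (x - (b - f)))
include h₁ h₂ hx

/-- As for B and C: at u = b-f the sum u + v is a+b-e-z, so the factorial missing from `coreD`
cancels [u+v]! and a ₃φ₂ series is left. -/
lemma coreD_sum_eq_midDE {n : ℕ} (hn : f + g - e = n) :
    nsum (f + g - e) (fun z => coreD q a b e f g z
      * (qPow q ((b - f) * (a + f - e - z) - x * (b - f + (a + f - e - z) + 1))
        * qInvFact q (x - (a + f - e - z))))
      * (qInvFact q (b + f - x) * qInvFact q (a + g - x) * qInvFact q (x - (b - f))) =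
    sgn (a + b + f + g) * (qFact q (b + e - a) * qFact q (e - f + g) * qInvFact q (e + f + g + 1))
      * qPow q ((b - f) * (a + f - e) - x * (b - f + (a + f - e) + 1)
        - (f + g - e) * (b + e + g - x + 1) + (e + f + g + 1) * (a + b + f + g))
      * ∑ w ∈ range (n + 1), midDE q a b e f g x (a + b + f + g - w) := by
  have q0 := hq.ne_zero
  have ib : IsInt (b + f - x) := (h₂.two2.isInt.sub hx).of_eq (by ring)
  have ia : IsInt (a + g - x) :=
    (((h₁.n2.isInt.add h₂.n3.isInt).sub hx)).of_eq (by ring)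
  have iw : IsInt (x - (a + f - e)) :=
    ((hx.add h₁.n3.isInt).sub h₂.two2.isInt).of_eq (by ring)
  have hl := sum_eq_qPsi_2002 hq (n := n) (x₁ := b + e - a) (x₂ := e - f + g) (w₁ := 2 * e + 1)
    (w₂ := x - (a + f - e))
    (W := fun z : ℕ => qPow q ((b - f) * (a + f - e - z) - x * (b - f + (a + f - e - z) + 1)))
    h₁.n3 (h₂.n2.of_eq (by ring)) (h₁.two3.isInt.add isInt_one) iw
  have hm := sum_eq_qPsi_0022 hq (n := n) (v₁ := b + f - x) (v₂ := a + g - x)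
    (w₁ := x - (a + f - e)) (w₂ := e + x - b - g)
    (W := fun z : ℕ => qPow q (-((e + f + g + 1) * (a + b + f + g - z)))) ib ia iw
    ((hx.sub h₂.n3.isInt).of_eq (by ring))
  have hpsi := qPsi_transform hq (isQPow_qPow_neg hq) (n := n) (b := b + e - a + 1)
    (c := e - f + g + 1) (d := x - (a + f - e) + 1) (e := 2 * e + 1 + 1) (b' := -(b + f - x))
    (c' := -(a + g - x)) (e' := e + x - b - g + 1) (s := x - (b - f))
    (t := b + e + g - x + 1) (by ring) (by ring) (by ring) (by linarith) (by ring)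
  rw [qPsi_swap_den, qPsi_congr
    (k := qPow q ((b - f) * (a + f - e) - x * (b - f + (a + f - e) + 1)))
    (W' := fun z : ℕ => qPow q (-(-(z * (x - (b - f)))))) rfl rfl rfl rfl (fun z => by
      rw [← qPow_add q0]; congr 1; ring), hpsi, qPsi_congr
    (k := qPow q (-((f + g - e) * (b + e + g - x + 1)) + (e + f + g + 1) * (a + b + f + g)))
    (W' := fun z : ℕ => qPow q (-((e + f + g + 1) * (a + b + f + g - z)))) rfl rfl rfl rfl
    (fun z => by rw [← qPow_add q0, hn]; congr 1; rw [← hn]; ring)] at hl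
  have hl' := show nsum (f + g - e) (fun z => coreD q a b e f g z
      * (qPow q ((b - f) * (a + f - e - z) - x * (b - f + (a + f - e - z) + 1))
        * qInvFact q (x - (a + f - e - z)))) = _ from Eq.trans (by
    rw [hn, nsum_natCast]
    refine sum_congr rfl fun z _ => ?_
    rw [coreD, sgn_natCast, hn, show x - (a + f - e - z) = x - (a + f - e) + z by ring]
    ring) hl
  have hm' : ∑ w ∈ range (n + 1), midDE q a b e f g x (a + b + f + g - w) =
      sgn (a + b + f + g) * _ := Eq.trans (by
    rw [mul_sum]
    refine sum_congr rfl fun z _ => ?_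
    rw [midDE, sgn_sub _ (isInt_natCast z), sgn_natCast,
      show a + b + f + g - z - (a + g + x) = b + f - x - z by ring,
      show a + b + f + g - z - (a + b + e) = n - z by linarith,
      show a + b + f + g - z - (b + f + x) = a + g - x - z by ring,
      show a + b + f + g - (a + b + f + g - z) = (z : ℚ) by ring,
      show a + f + e + x - (a + b + f + g - z) = e + x - b - g + z by ring,
      show g + b + e + x - (a + b + f + g - z) = x - (a + f - e) + z by ring]
    ring) (congrArg (fun t => sgn (a + b + f + g) * t) hm)
  rw [hl', hm', show 2 * e + 1 + (n : ℚ) = e + f + g + 1 by linarith,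
    show e + x - b - g + (n : ℚ) = x - (b - f) by linarith]
  have e0 : qPow q ((b - f) * (a + f - e) - x * (b - f + (a + f - e) + 1)
        - (f + g - e) * (b + e + g - x + 1) + (e + f + g + 1) * (a + b + f + g)) =
      qPow q ((b - f) * (a + f - e) - x * (b - f + (a + f - e) + 1))
      * qPow q (-((f + g - e) * (b + e + g - x + 1)) + (e + f + g + 1) * (a + b + f + g)) := by
    rw [← qPow_add q0]; congr 1; ring
  rw [e0]
  have s1 := sgn_mul_self (a + b + f + g)
  generalize sgn (a + b + f + g) = s at *
  generalize qPsi q n _ _ _ _ _ = Ψ at *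
  clear e0
  generalize qPow q ((b - f) * (a + f - e) - x * (b - f + (a + f - e) + 1)) = p₁ at *
  generalize qPow q (-((f + g - e) * (b + e + g - x + 1)) + (e + f + g + 1)
      * (a + b + f + g)) = p₂ at *
  linear_combination (- qFact q (b + e - a) * qFact q (e - f + g) * qInvFact q (e + f + g + 1)
    * p₁ * p₂ * qInvFact q n * qInvFact q (b + f - x) * qInvFact q (a + g - x)
    * qInvFact q (x - (a + f - e) + n) * qInvFact q (x - (b - f)) * Ψ) * s1

lemma termE_sum_eq_midDE (hxa : x ≤ a + g) {n : ℕ} (hn : e + f - g = n) :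
    nsum (e + f - g) (fun z => sgn z * (qFact q (2 * e - z) * qFact q (e + a + f - z - x)
        * qInvFact q z * qInvFact q (a - b + e - z) * qInvFact q (e + f - g - z)
        * qInvFact q (e + f + g + 1 - z))
      * qPow q ((b - f) * (e + a + f - z + 1) - x * (b - f + (e + a + f - z) + 2)))
      * (qInvFact q (b + f - x) * qInvFact q (b + e - a) * qInvFact q (x - (b - f))) =
    (-1) ^ n * sgn (a + g + x) * (qFact q (e - f + g) * qFact q (a + g - x)
      * qInvFact q (e + f + g + 1))
      * qPow q ((b - f) * (a + g + 1) - x * (b - f + (a + g) + 2)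
        - (e + f - g) * (x - b - e - g - 1) + (e + f + g + 1) * (a + g + x))
      * ∑ w ∈ range (n + 1), midDE q a b e f g x (a + g + x + w) := by
  have q0 := hq.ne_zero
  have ib : IsInt (b + f - x) := (h₂.two2.isInt.sub hx).of_eq (by ring)
  have ia : IsNat (a + g - x) := IsInt.isNat
    ((((h₁.n2.isInt.add h₂.n3.isInt).sub hx)).of_eq (by ring)) (by linarith)
  have iab : IsInt (a + g - b - f) := (ia.isInt.sub ib).of_eq (by ring)
  have hl := sum_eq_qPsi_2002 hq (n := n) (x₁ := e - f + g) (x₂ := a + g - x)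
    (w₁ := a + g - b - f) (w₂ := 2 * g + 1)
    (W := fun z : ℕ => qPow q ((b - f) * (a + g + z + 1) - x * (b - f + (a + g + z) + 2)))
    (h₂.n2.of_eq (by ring)) ia iab (h₂.two3.isInt.add isInt_one)
  have hm := sum_eq_qPsi_0022 hq (n := n) (v₁ := b + f - x) (v₂ := b + e - a)
    (w₁ := g + x - b - e) (w₂ := a + g - b - f)
    (W := fun z : ℕ => qPow q (-((e + f + g + 1) * (a + g + x + z)))) ib h₁.n3.isInt
    ((hx.sub h₂.n1.isInt).of_eq (by ring)) iab
  have hpsi := qPsi_transform hq (isQPow_qPow hq) (n := n) (b := -(b + f - x))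
    (c := -(b + e - a)) (d := a + g - b - f + 1) (e := g + x - b - e + 1) (b' := a + g - x + 1)
    (c' := e - f + g + 1) (e' := 2 * g + 1 + 1) (s := e + f + g + 1)
    (t := x - b - e - g - 1) (by ring) (by ring) (by ring) (by linarith) (by ring)
  rw [qPsi_congr
    (k := qPow q ((b - f) * (a + g + 1) - x * (b - f + (a + g) + 2)))
    (W' := fun z : ℕ => qPow q (-(z * (x - (b - f))))) rfl rfl rfl rfl (fun z => by
      rw [← qPow_add q0]; congr 1; ring)] at hl
  rw [qPsi_swap_den, qPsi_congr
    (k := qPow q (-((e + f + g + 1) * (a + g + x))))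
    (W' := fun z : ℕ => qPow q (-(z * (e + f + g + 1)))) rfl rfl rfl rfl (fun z => by
      rw [← qPow_add q0]; congr 1; ring), hpsi, qPsi_swap_num, qPsi_congr
    (k := qPow q ((e + f - g) * (x - b - e - g - 1)))
    (W' := fun z : ℕ => qPow q (-(z * (x - (b - f))))) rfl rfl rfl rfl (fun z => by
      rw [← qPow_add q0, hn]; congr 1; rw [← hn]; ring)] at hm
  have hl' : nsum (e + f - g) (fun z => sgn z * (qFact q (2 * e - z) * qFact q (e + a + f - z - x)
        * qInvFact q z * qInvFact q (a - b + e - z) * qInvFact q (e + f - g - z)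
        * qInvFact q (e + f + g + 1 - z))
      * qPow q ((b - f) * (e + a + f - z + 1) - x * (b - f + (e + a + f - z) + 2))) =
      (-1) ^ n * _ := Eq.trans (by
    -- The order of summation is reversed so that the numerator factorials rise from [e-f+g]! and
    -- [a+g-x]!; the latter is a genuine factorial because x ≤ a+g.
    rw [hn, nsum_natCast, ← sum_range_reflect, mul_sum]
    refine sum_congr rfl fun z hz => ?_
    have hz' : z ≤ n := Nat.lt_succ_iff.1 (mem_range.1 hz)
    rw [show n + 1 - 1 - z = n - z by omega, sgn_natCast, Nat.cast_sub hz']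
    have hs : (-1 : ℂ) ^ (n - z) = (-1) ^ n * (-1) ^ z := by
      have : (-1 : ℂ) ^ n = (-1) ^ (n - z) * (-1) ^ z := by rw [← pow_add]; congr 1; omega
      rw [this]
      linear_combination (-(-1 : ℂ) ^ (n - z)) * neg_one_pow_mul_self z
    rw [hs, show 2 * e - ((n : ℚ) - z) = e - f + g + z by linarith,
      show e + a + f - ((n : ℚ) - z) = a + g + z by linarith,
      show a + g + z - x = a + g - x + z by ring,
      show a - b + e - ((n : ℚ) - z) = a + g - b - f + z by linarith,
      show (n : ℚ) - (n - z) = z by ring,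
      show e + f + g + 1 - ((n : ℚ) - z) = 2 * g + 1 + z by linarith]
    ring) (congrArg (fun t => (-1) ^ n * t) hl)
  have hm' : ∑ w ∈ range (n + 1), midDE q a b e f g x (a + g + x + w) =
      sgn (a + g + x) * _ := Eq.trans (by
    rw [mul_sum]
    refine sum_congr rfl fun z _ => ?_
    rw [midDE, sgn_add _ (isInt_natCast z), sgn_natCast,
      show a + g + x + z - (a + g + x) = (z : ℚ) by ring,
      show a + g + x + z - (a + b + e) = g + x - b - e + z by ring,
      show a + g + x + z - (b + f + x) = a + g - b - f + z by ring,
      show a + b + f + g - (a + g + x + z) = b + f - x - z by ring,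
      show a + f + e + x - (a + g + x + z) = n - z by linarith,
      show g + b + e + x - (a + g + x + z) = b + e - a - z by ring]
    ring) (congrArg (fun t => sgn (a + g + x) * t) hm)
  rw [hl', hm', show 2 * g + 1 + (n : ℚ) = e + f + g + 1 by linarith,
    show g + x - b - e + (n : ℚ) = x - (b - f) by linarith]
  have e0 : qPow q ((b - f) * (a + g + 1) - x * (b - f + (a + g) + 2)) =
      qPow q ((b - f) * (a + g + 1) - x * (b - f + (a + g) + 2)
        - (e + f - g) * (x - b - e - g - 1) + (e + f + g + 1) * (a + g + x))
      * (qPow q (-((e + f + g + 1) * (a + g + x))) * qPow q ((e + f - g)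
          * (x - b - e - g - 1))) := by
    rw [← qPow_add q0, ← qPow_add q0]; congr 1; ring
  rw [e0]
  have s1 := sgn_mul_self (a + g + x)
  generalize sgn (a + g + x) = s at *
  generalize qPsi q n _ _ _ _ _ = Ψ at *
  clear e0
  generalize qPow q ((b - f) * (a + g + 1) - x * (b - f + (a + g) + 2)
    - (e + f - g) * (x - b - e - g - 1) + (e + f + g + 1) * (a + g + x)) = p₁ at *
  generalize qPow q (-((e + f + g + 1) * (a + g + x))) = p₂ at *
  generalize qPow q ((e + f - g) * (x - b - e - g - 1)) = p₃ at *
  linear_combination (- (-1) ^ n * qFact q (e - f + g) * qFact q (a + g - x)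
    * qInvFact q (e + f + g + 1) * p₁ * p₂ * p₃ * qInvFact q n * qInvFact q (b + f - x)
    * qInvFact q (b + e - a) * qInvFact q (x - (b - f)) * qInvFact q (a + g - b - f + n) * Ψ) * s1

lemma coreD_sum_eq_termE_sum (hxb : x ≤ b + f) (hxa : x ≤ a + g) :
    nsum (f + g - e) (fun z => coreD q a b e f g z
      * (qPow q ((b - f) * (a + f - e - z) - x * (b - f + (a + f - e - z) + 1))
        * qInvFact q (x - (b - f)) * qInvFact q (x - (a + f - e - z)))) =
    sgn (b + f - x + (e + f - g)) * nsum (e + f - g) (fun z => termE q a b e f g z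
      * closedNum q x (e + a + f - z) (b - f)) := by
  rcases lt_or_ge x (b - f) with hxu | hxu
  · simp only [closedNum, qInvFact_of_neg (q := q) (x := x - (b - f)) (by linarith)]
    simp [nsum]
  obtain ⟨n, hn⟩ := h₂.n1
  obtain ⟨m, hm⟩ := h₂.n3
  have hL := coreD_sum_eq_midDE hq h₁ h₂ hx hm
  have hR := termE_sum_eq_midDE hq h₁ h₂ hx hxa hn
  have ib : IsInt (b + f - x) := (h₂.two2.isInt.sub hx).of_eq (by ring)
  have hshift := sum_shift (midDE q a b e f g x) (a + g + x) (a + b + f + g) (-1) n m (Or.inr rfl)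
    (ib.of_eq (by ring)) (by
      intro i hi
      unfold midDE at hi
      simp only [mul_ne_zero_iff] at hi
      obtain ⟨⟨⟨⟨⟨⟨⟨_, i1⟩, i2⟩, _⟩, i4⟩, i5⟩, _⟩, _⟩ := hi
      have i1 := nonneg_of_qInvFact_ne_zero i1
      have i2 := nonneg_of_qInvFact_ne_zero i2
      have i4 := nonneg_of_qInvFact_ne_zero i4
      have i5 := nonneg_of_qInvFact_ne_zero i5
      refine ⟨?_, ?_, by linarith, by linarith⟩
      · have : (0 : ℚ) ≤ i := by linarith
        exact_mod_cast this
      · have : (i : ℚ) ≤ n := by linarith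
        exact_mod_cast this)
  simp only [neg_one_mul, ← sub_eq_add_neg] at hshift
  rw [hshift] at hR
  have e1 : nsum (f + g - e) (fun z => coreD q a b e f g z
      * (qPow q ((b - f) * (a + f - e - z) - x * (b - f + (a + f - e - z) + 1))
        * qInvFact q (x - (b - f)) * qInvFact q (x - (a + f - e - z)))) =
      qInvFact q (x - (b - f)) * nsum (f + g - e) (fun z => coreD q a b e f g z
      * (qPow q ((b - f) * (a + f - e - z) - x * (b - f + (a + f - e - z) + 1))
        * qInvFact q (x - (a + f - e - z)))) := by
    rw [← nsum_mul_left]; congr 1; funext z; ring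
  have e2 : nsum (e + f - g) (fun z => termE q a b e f g z
      * closedNum q x (e + a + f - z) (b - f)) =
      qInvFact q (x - (b - f)) * nsum (e + f - g) (fun z => sgn z * (qFact q (2 * e - z)
        * qFact q (e + a + f - z - x) * qInvFact q z * qInvFact q (a - b + e - z)
        * qInvFact q (e + f - g - z) * qInvFact q (e + f + g + 1 - z))
      * qPow q ((b - f) * (e + a + f - z + 1) - x * (b - f + (e + a + f - z) + 2))) := by
    rw [← nsum_mul_left]
    refine nsum_congr h₂.n1 fun z _ hz => ?_
    have h2 := qFact_mul_qInvFact hq (x := a + b + e + 1 - z)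
      (by linarith [hz.nonneg, h₂.n2.nonneg, h₁.n1.nonneg])
    rw [termE, closedNum, show b - f + (e + a + f - z) + 1 = a + b + e + 1 - z by ring]
    linear_combination (qInvFact q (x - (b - f)) * (sgn z * (qFact q (2 * e - z)
        * qFact q (e + a + f - z - x) * qInvFact q z * qInvFact q (a - b + e - z)
        * qInvFact q (e + f - g - z) * qInvFact q (e + f + g + 1 - z))
      * qPow q ((b - f) * (e + a + f - z + 1) - x * (b - f + (e + a + f - z) + 2)))) * h2
  rw [e1, e2]
  have iP : IsInt (a + g + x) :=
    ((h₁.n1.isInt.add h₂.n2.isInt).add hx).of_eq (by ring)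
  have hs : sgn (b + f - x + (e + f - g)) * sgn (a + g + x) = sgn (a + b + f + g) * (-1) ^ n := by
    rw [← sgn_natCast, ← hn, ← sgn_add _ h₂.n1.isInt, ← sgn_add _ iP]
    congr 1; ring
  have hne : qInvFact q (b + f - x) * qInvFact q (x - (b - f)) ≠ 0 :=
    mul_ne_zero (qInvFact_ne_zero hq (by linarith)) (qInvFact_ne_zero hq (by linarith))
  have f1 := qFact_mul_qInvFact hq h₁.n3.nonneg
  have f2 := qFact_mul_qInvFact hq (x := a + g - x) (by linarith)
  rw [show (b - f) * (a + f - e) - x * (b - f + (a + f - e) + 1)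
        - (f + g - e) * (b + e + g - x + 1) + (e + f + g + 1) * (a + b + f + g) =
        (b - f) * (a + g + 1) - x * (b - f + (a + g) + 2)
        - (e + f - g) * (x - b - e - g - 1) + (e + f + g + 1) * (a + g + x) by ring] at hL
  refine mul_right_cancel₀ hne ?_
  have s1 := neg_one_pow_mul_self n
  generalize nsum (f + g - e) _ = S at *
  generalize nsum (e + f - g) _ = T at *
  generalize ∑ w ∈ range (m + 1), midDE q a b e f g x (a + b + f + g - w) = M at *
  generalize qPow q _ = p at *
  generalize (-1 : ℂ) ^ n = t at *
  generalize qInvFact q (x - (b - f)) = Ix at *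
  generalize qInvFact q (b + f - x) = Ib at *
  generalize sgn (b + f - x + (e + f - g)) = σ at *
  generalize sgn (a + g + x) = sP at *
  generalize sgn (a + b + f + g) = sR at *
  linear_combination Ix * qFact q (a + g - x) * hL - Ix * S * Ib * Ix * f2
    - Ix * σ * qFact q (b + e - a) * hR + Ix * σ * T * Ib * Ix * f1
    - Ix * qFact q (b + e - a) * qFact q (a + g - x) * qFact q (e - f + g)
      * qInvFact q (e + f + g + 1) * p * M * (t * hs + sR * s1)

end
end

/-- Forward substitution; it supplies the coefficients of the correction in the exchange of D for E.
-/
lemma exists_triangular_solution (A : ℕ → ℕ → ℂ) (D : ℕ → ℂ) (h0 : ∀ m i, m < i → A m i = 0)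
    (h1 : ∀ m, A m m ≠ 0) (N : ℕ) :
    ∃ c : ℕ → ℂ, ∀ m < N, D m = ∑ i ∈ range N, c i * A m i := by
  induction N with
  | zero => exact ⟨0, by simp⟩
  | succ N ih =>
    obtain ⟨c, hc⟩ := ih
    refine ⟨Function.update c N ((D N - ∑ i ∈ range N, c i * A N i) / A N N), fun m hm => ?_⟩
    have hs : ∀ k, ∑ i ∈ range N, Function.update c N
        ((D N - ∑ i ∈ range N, c i * A N i) / A N N) i * A k i = ∑ i ∈ range N, c i * A k i :=
      fun k => sum_congr rfl fun i hi => by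
        rw [Function.update_of_ne (mem_range.1 hi).ne]
    rw [sum_range_succ, hs, Function.update_self]
    rcases Nat.lt_succ_iff_lt_or_eq.1 hm with h | rfl
    · rw [h0 m N h, mul_zero, add_zero, ← hc m h]
    · rw [div_mul_cancel₀ _ (h1 m)]; ring

section
variable {q : ℂ} (hq : IsGeneric q)
include hq

/-- Here the term with x-1 carries the opposite sign, so the compensating sign in the exchange of D
for E alternates with x instead of u. -/
lemma closedNum_rec {x w u : ℚ} (hxu : IsInt (x - u)) (hwx : IsNat (w - x))
    (huw : IsNat (u + w + 1)) :
    qNum q (x - u) * qNum q (x + u + 1) * closedNum q x w u =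
      closedNum q x w (u + 1) - closedNum q (x - 1) w u := by
  have q0 := hq.ne_zero
  unfold closedNum
  rw [show x - (u + 1) = x - u - 1 by ring, show x - 1 - u = x - u - 1 by ring,
    show u + 1 + w + 1 = u + w + 1 + 1 by ring, show w - (x - 1) = w - x + 1 by ring,
    qInvFact_sub_one hq hxu, qFact_add_one hwx, qFact_add_one huw]
  have e1 : qPow q ((u + 1) * (w + 1) - x * (u + 1 + w + 2))
      = qPow q (u * (w + 1) - x * (u + w + 2)) * qPow q (w - x + 1) := by
    rw [← qPow_add q0]; congr 1; ring
  have e2 : qPow q (u * (w + 1) - (x - 1) * (u + w + 2))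
      = qPow q (u * (w + 1) - x * (u + w + 2)) * qPow q (u + w + 1 + 1) := by
    rw [← qPow_add q0]; congr 1; ring
  have e3 : qNum q (x + u + 1) = qPow q (w - x + 1) * qNum q (u + w + 1 + 1)
      - qPow q (u + w + 1 + 1) * qNum q (w - x + 1) := by
    have h := qNum_add' hq (u + w + 1 + 1) (-(w - x + 1))
    rw [qNum_neg, neg_neg] at h
    rw [show x + u + 1 = u + w + 1 + 1 + -(w - x + 1) by ring, h]; ring
  rw [e1, e2, e3]
  ring

/-- At u = b-f the exchange is exact for x ≤ b+f only. The defect at larger x is written as a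
combination of products of a ratio and a pair at j = b+f+1+i. By the three-term relation each such
product obeys the same recurrence in (x, u), so the coefficients fixed at u = b-f serve for all u;
they depend neither on u nor on x. -/
theorem exists_coreD_sum_eq {a b e f g : ℚ} (h₁ : Tri a b e) (h₂ : Tri e f g) :
    ∃ (c : ℕ → ℂ) (N : ℕ), ∀ (L : ℕ) (x : ℚ), IsInt (x - (b - f)) → x ≤ a + g →
    nsum (f + g - e) (fun z => coreD q a b e f g z
      * (qPow q ((b - f + L) * (a + f - e - z) - x * (b - f + L + (a + f - e - z) + 1))
        * qPoch q (a + b - e - z + 1) L * qInvFact q (x - (b - f + L))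
        * qInvFact q (x - (a + f - e - z)))) =
    sgn (b + f - x + (e + f - g)) * nsum (e + f - g) (fun z => termE q a b e f g z
      * closedNum q x (e + a + f - z) (b - f + L))
    + ∑ i ∈ range N, c i * (jRatio q (b - f + L) (b + f + 1 + i) * jPair q x (b + f + 1 + i)) := by
  set D : ℚ → ℂ := fun x => nsum (f + g - e) (fun z => coreD q a b e f g z
      * (qPow q ((b - f) * (a + f - e - z) - x * (b - f + (a + f - e - z) + 1))
        * qInvFact q (x - (b - f)) * qInvFact q (x - (a + f - e - z)))) -
    sgn (b + f - x + (e + f - g)) * nsum (e + f - g) (fun z => termE q a b e f g z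
      * closedNum q x (e + a + f - z) (b - f)) with hD
  have hb := h₁.two2
  have hf := h₂.two2
  -- The system is triangular because a pair vanishes for j > x, and its diagonal entries are
  -- non-zero. Since x ≤ a+g and x = b+f+1+m, the number ⌊a+g⌋ of unknowns suffices.
  obtain ⟨c, hc⟩ := exists_triangular_solution
    (fun m i => jRatio q (b - f) (b + f + 1 + i) * jPair q (b + f + 1 + m) (b + f + 1 + i))
    (fun m => D (b + f + 1 + m))
    (fun m i hmi => by
      have : (m : ℚ) < i := by exact_mod_cast hmi
      rw [jPair, qInvFact_of_neg (by linarith)]; ring)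
    (fun m => by
      have hm : (0 : ℚ) ≤ m := by positivity
      have := hb.nonneg
      have := hf.nonneg
      unfold jRatio jPair
      refine mul_ne_zero (mul_ne_zero (qFact_ne_zero hq _) (qInvFact_ne_zero hq (by linarith)))
        (mul_ne_zero (qInvFact_ne_zero hq (by linarith)) (qInvFact_ne_zero hq (by linarith))))
    ⌊a + g⌋₊
  refine ⟨c, ⌊a + g⌋₊, fun L => ?_⟩
  induction L with
  | zero =>
    intro x hx hxa
    simp only [Nat.cast_zero, add_zero, qPoch_zero, mul_one]
    rw [← sub_eq_iff_eq_add']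
    rcases le_or_gt x (b + f) with hxb | hxb
    · rw [coreD_sum_eq_termE_sum hq h₁ h₂ hx hxb hxa, sub_self]
      refine (sum_eq_zero fun i _ => ?_).symm
      have hi : (0 : ℚ) ≤ i := by positivity
      rw [jPair, qInvFact_of_neg (by linarith)]; ring
    · obtain ⟨m, hm⟩ : IsNat (x - (b + f + 1)) := by
        have hi : IsInt (b + f - x) := (hf.isInt.sub hx).of_eq (by ring)
        exact IsInt.isNat ((hi.neg.sub isInt_one).of_eq (by ring))
          (by linarith [hi.le_neg_one (by linarith)])
      obtain rfl : x = b + f + 1 + m := by linarith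
      refine hc m ((Nat.le_floor ?_ : m + 1 ≤ _))
      push_cast
      linarith [hb.nonneg, hf.nonneg]
  | succ L ih =>
    intro x hx hxa
    have i1 := ih x hx hxa
    have i2 := ih (x - 1) ((hx.sub isInt_one).of_eq (by ring)) (by linarith)
    have hxu : IsInt (x - (b - f + L)) := (hx.sub (isInt_natCast L)).of_eq (by ring)
    have ia : IsNat (a + g - x) := IsInt.isNat
      (((h₁.n2.isInt.add h₂.n3.isInt).sub hx).of_eq (by ring)) (by linarith)
    have hs : sgn (b + f - (x - 1) + (e + f - g)) = - sgn (b + f - x + (e + f - g)) := by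
      rw [show b + f - (x - 1) + (e + f - g) = b + f - x + (e + f - g) + 1 by ring,
        sgn_add _ isInt_one]
      simp [sgn]
    have cL : nsum (f + g - e) (fun z => coreD q a b e f g z
        * (qPow q ((b - f + (L + 1 : ℕ)) * (a + f - e - z)
            - x * (b - f + (L + 1 : ℕ) + (a + f - e - z) + 1))
        * qPoch q (a + b - e - z + 1) (L + 1) * qInvFact q (x - (b - f + (L + 1 : ℕ)))
        * qInvFact q (x - (a + f - e - z)))) =
        qNum q (x - (b - f + L)) * qNum q (x + (b - f + L) + 1) * nsum (f + g - e)
        (fun z => coreD q a b e f g z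
      * (qPow q ((b - f + L) * (a + f - e - z) - x * (b - f + L + (a + f - e - z) + 1))
        * qPoch q (a + b - e - z + 1) L * qInvFact q (x - (b - f + L))
        * qInvFact q (x - (a + f - e - z)))) - nsum (f + g - e) (fun z => coreD q a b e f g z
      * (qPow q ((b - f + L) * (a + f - e - z) - (x - 1) * (b - f + L + (a + f - e - z) + 1))
        * qPoch q (a + b - e - z + 1) L * qInvFact q (x - 1 - (b - f + L))
        * qInvFact q (x - 1 - (a + f - e - z)))) := by
      rw [← nsum_mul_left, ← nsum_sub]
      refine nsum_congr h₂.n3 fun z hz _ => ?_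
      have hrec := closed_form_rec hq (x := x) (u := b - f + L) (v := a + f - e - z)
        (G := qPoch q (a + b - e - z + 1) L) (G' := qPoch q (a + b - e - z + 1) (L + 1))
        (by rw [qPoch_succ, mul_comm]; congr 2; ring) hxu
        ((((hx.add h₁.n3.isInt).sub h₂.two2.isInt).add hz.isInt).of_eq (by ring))
      rw [show b - f + ((L + 1 : ℕ) : ℚ) = b - f + L + 1 by push_cast; ring]
      linear_combination -coreD q a b e f g z * hrec
    have cR : nsum (e + f - g) (fun z => termE q a b e f g z
        * closedNum q x (e + a + f - z) (b - f + (L + 1 : ℕ))) =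
        qNum q (x - (b - f + L)) * qNum q (x + (b - f + L) + 1) * nsum (e + f - g)
          (fun z => termE q a b e f g z * closedNum q x (e + a + f - z) (b - f + L))
        + nsum (e + f - g)
          (fun z => termE q a b e f g z * closedNum q (x - 1) (e + a + f - z) (b - f + L)) := by
      rw [← nsum_mul_left, ← nsum_add]
      refine nsum_congr h₂.n1 fun z _ hz => ?_
      have hrec := closedNum_rec hq (x := x) (w := e + a + f - z) (u := b - f + L) hxu
        ((ia.add hz).of_eq (by ring))
        (((((h₁.n1.add h₂.n2).add hz).add (isNat_natCast L)).add isNat_one).of_eq (by ring))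
      rw [show b - f + ((L + 1 : ℕ) : ℚ) = b - f + L + 1 by push_cast; ring]
      linear_combination -termE q a b e f g z * hrec
    have cS : ∑ i ∈ range ⌊a + g⌋₊, c i * (jRatio q (b - f + (L + 1 : ℕ)) (b + f + 1 + i)
          * jPair q x (b + f + 1 + i)) =
        qNum q (x - (b - f + L)) * qNum q (x + (b - f + L) + 1) * (∑ i ∈ range ⌊a + g⌋₊,
          c i * (jRatio q (b - f + L) (b + f + 1 + i) * jPair q x (b + f + 1 + i)))
        - ∑ i ∈ range ⌊a + g⌋₊,
          c i * (jRatio q (b - f + L) (b + f + 1 + i) * jPair q (x - 1) (b + f + 1 + i)) := by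
      rw [mul_sum, ← sum_sub_distrib]
      refine sum_congr rfl fun i _ => ?_
      have iN := isNat_natCast i
      have iL := isNat_natCast L
      have hi : IsInt (b + f + 1 + i - (b - f + L)) :=
        (((hf.isInt.add isInt_one).add iN.isInt).sub iL.isInt).of_eq (by ring)
      rw [show b - f + ((L + 1 : ℕ) : ℚ) = b - f + L + 1 by push_cast; ring,
        jRatio_add_one hq hi ((((hb.add isNat_one).add iN).add iL).of_eq (by ring)),
        jPair_sub_one hq ((hxu.sub hi).of_eq (by ring))
        (((((hb.add hf).add isNat_one).add isNat_one).add (iN.add iN)).isInt.of_eq (by ring))]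
      linear_combination (- c i * jRatio q (b - f + L) (b + f + 1 + i)
        * jPair q x (b + f + 1 + i)) * qNum_three_term hq x (b - f + L) (b + f + 1 + i)
    rw [cL, cR, cS, i1, i2, hs]
    ring

end

/-! ### The `9j` coefficient as a sum over the intermediate angular momentum -/

/-- The rows and columns of a `9j` coefficient are triads. -/
structure NineTri (a b e c d f h k g : ℚ) : Prop where
  abe : Tri a b e
  cdf : Tri c d f
  hkg : Tri h k g
  ach : Tri a c h
  bdk : Tri b d k
  efg : Tri e f g

/-- The square of the triangle coefficient. -/
def deltaSq (q : ℂ) (a b c : ℚ) : ℂ :=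
  qFact q (a + b - c) * qFact q (a + c - b) * qFact q (b + c - a) * qInvFact q (a + b + c + 1)

lemma qFactSqrt_mul_self (q : ℂ) (x : ℚ) : qFactSqrt q x * qFactSqrt q x = qFact q x := by
  unfold qFactSqrt
  have h := Complex.cpow_nat_inv_pow (qFact q x) (n := 2) (by norm_num)
  rw [← sq, one_div]
  exact_mod_cast h

lemma qFactSqrt_ne_zero {q : ℂ} (hq : IsGeneric q) (x : ℚ) : qFactSqrt q x ≠ 0 := fun h =>
  qFact_ne_zero hq x (by rw [← qFactSqrt_mul_self, h, mul_zero])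

lemma triDelta_swap12 (q : ℂ) (a b c : ℚ) : triDelta q a b c = triDelta q b a c := by
  unfold triDelta
  rw [show b + a - c = a + b - c by ring, show b - a + c = b + c - a by ring,
    show a + c - b = a - b + c by ring, show b + a + c + 1 = a + b + c + 1 by ring]
  ring

lemma triDelta_swap23 (q : ℂ) (a b c : ℚ) : triDelta q a b c = triDelta q a c b := by
  unfold triDelta
  rw [show a + c - b = a - b + c by ring, show a - c + b = a + b - c by ring,
    show c + b - a = b + c - a by ring, show a + c + b + 1 = a + b + c + 1 by ring]
  ring

lemma triDelta_mul_self {q : ℂ} {a b c : ℚ} (h : Tri a b c) :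
    triDelta q a b c * triDelta q a b c = deltaSq q a b c := by
  unfold triDelta deltaSq
  rw [qInvFact_of_nonneg h.sum_one.nonneg, ← qFactSqrt_mul_self q (a + b - c),
    ← qFactSqrt_mul_self q (a + c - b), ← qFactSqrt_mul_self q (b + c - a),
    ← qFactSqrt_mul_self q (a + b + c + 1), show a + c - b = a - b + c by ring, mul_inv]
  ring

lemma sixJ_of_tri {q : ℂ} {a b e d c f : ℚ} (h₁ : Tri a b e) (h₂ : Tri a c f) (h₃ : Tri d b f)
    (h₄ : Tri d c e) : sixJ q a b e d c f =
      triDelta q a b e * triDelta q a c f * triDelta q d b f * triDelta q d c e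
        * nsum (a + b + c + d) (racahTerm q (a + b + e) (a + c + f) (d + b + f) (d + c + e)
          (a + b + c + d) (a + d + e + f) (b + c + e + f)) := by
  unfold sixJ
  rw [if_pos ⟨h₁.triad, h₂.triad, h₃.triad, h₄.triad⟩]
  congr 1
  refine sum_congr rfl fun z _ => ?_
  simp only [qRatio, racahTerm, List.map_cons, List.map_nil, List.prod_cons, List.prod_nil]
  ring

lemma sixJ_of_not_tri {q : ℂ} {a b e d c f : ℚ}
    (h : ¬ (Tri a b e ∧ Tri a c f ∧ Tri d b f ∧ Tri d c e)) : sixJ q a b e d c f = 0 := by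
  unfold sixJ
  rw [if_neg]
  simpa only [triad_iff] using h

open Classical in
/-- The term of the summation over `j`, without the factors which do not depend on `j`. -/
def coreTerm (q : ℂ) (a b e c d f h k g j : ℚ) : ℂ :=
  if Tri a g j ∧ Tri b f j ∧ Tri c k j then
    sgn (2 * j) * jWeight q j * (deltaSq q a g j * deltaSq q b f j * deltaSq q c k j)
      * (racah q k g h a c j * racah q f c d k b j * racah q a b e f g j)
  else 0

/-- Each of the triads (agj), (bfj), (ckj) belongs to two of the three 6j coefficients, so its
triangle coefficient appears squared; the six triads without j factor out of the sum. -/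
lemma nineJ_term_eq {q : ℂ} (hq : IsGeneric q) {a b e c d f h k g : ℚ}
    (H : NineTri a b e c d f h k g) (j : ℚ) :
    sgn (2 * j) * qPow q (Zexp d e h - j * (j + 1)) * qNum q (2 * j + 1) *
      sixJ q a c h k g j * sixJ q k j c f d b * sixJ q a g j f b e =
    qPow q (Zexp d e h) * (triDelta q a b e * triDelta q c d f * triDelta q h k g
      * triDelta q a c h * triDelta q b d k * triDelta q e f g)
      * coreTerm q a b e c d f h k g j := by
  unfold coreTerm
  split_ifs with hj
  · obtain ⟨hag, hbf, hck⟩ := hj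
    rw [sixJ_of_tri H.ach hag hck.swap12 H.hkg.rot,
      sixJ_of_tri hck.rot H.bdk.rot.rot.swap23 hbf.rot H.cdf.rot.rot.swap23,
      sixJ_of_tri hag H.abe H.efg.rot hbf.swap12]
    have eA : nsum (a + c + g + k) (racahTerm q (a + c + h) (a + g + j) (k + c + j) (k + g + h)
        (a + c + g + k) (a + k + h + j) (c + g + h + j)) = racah q k g h a c j := by
      rw [racah, show k + g + a + c = a + c + g + k by ring,
        show k + a + j + h = a + k + h + j by ring, show c + g + j + h = c + g + h + j by ring]
      congr 1; funext z; unfold racahTerm; ring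
    have eB : nsum (k + j + d + f) (racahTerm q (k + j + c) (k + d + b) (f + j + b) (f + d + c)
        (k + j + d + f) (k + f + c + b) (j + d + c + b)) = racah q f c d k b j := by
      rw [racah, show k + j + c = k + c + j by ring, show k + d + b = k + b + d by ring,
        show f + j + b = f + b + j by ring, show f + d + c = f + c + d by ring,
        show k + f + c + b = f + c + k + b by ring, show f + k + j + d = k + j + d + f by ring,
        show b + c + j + d = j + d + c + b by ring]
      -- The upper limits of the two sums differ, but both are arguments of inverse factorials in
      -- the summand and so bound its support.
      rw [nsum_range (M := f + c + k + b)
        ((hck.sum.add H.cdf.n3).of_eq (by ring)) ((hck.n1.add hbf.sum).of_eq (by ring))]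
      · congr 1; funext z; unfold racahTerm; ring
      · intro z _ hz
        unfold racahTerm at hz
        simp only [mul_ne_zero_iff] at hz
        have c1 := nonneg_of_qInvFact_ne_zero hz.1.1.2
        have c2 := nonneg_of_qInvFact_ne_zero hz.1.2
        constructor <;> linarith
    have eC : nsum (a + g + b + f) (racahTerm q (a + g + j) (a + b + e) (f + g + e) (f + b + j)
        (a + g + b + f) (a + f + j + e) (g + b + j + e)) = racah q a b e f g j := by
      rw [racah, show a + b + f + g = a + g + b + f by ring]
    rw [eA, eB, eC, ← triDelta_mul_self hag, ← triDelta_mul_self hbf, ← triDelta_mul_self hck,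
      triDelta_swap23 q k j c, triDelta_swap12 q k c j, triDelta_swap23 q f j b,
      triDelta_swap12 q f b j]
    rw [show triDelta q k g h = triDelta q h k g by
        rw [triDelta_swap23 q k g h, triDelta_swap12 q k h g],
      show triDelta q k d b = triDelta q b d k by
        rw [triDelta_swap12 q k d b, triDelta_swap23 q d k b, triDelta_swap12 q d b k],
      show triDelta q f d c = triDelta q c d f by
        rw [triDelta_swap12 q f d c, triDelta_swap23 q d f c, triDelta_swap12 q d c f],
      show triDelta q f g e = triDelta q e f g by
        rw [triDelta_swap23 q f g e, triDelta_swap12 q f e g]]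
    rw [jWeight, sub_eq_add_neg, qPow_add hq.ne_zero]
    ring
  · rw [mul_zero]
    by_cases h1 : Tri a g j
    · by_cases h2 : Tri b f j
      · rw [sixJ_of_not_tri (a := k) (b := j)]
        · ring
        · rintro ⟨h3, _⟩
          exact hj ⟨h1, h2, h3.rot.rot⟩
      · rw [sixJ_of_not_tri (a := a) (b := g)]
        · ring
        · rintro ⟨_, _, _, h3⟩
          exact h2 h3.swap12
    · rw [sixJ_of_not_tri (a := a) (b := g)]
      · ring
      · rintro ⟨h3, _⟩
        exact h1 h3

/-- If (agj) is a triad, then j is congruent to a+g modulo 1, so among all half-integers only the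
class of the offset j₀ contributes; the correspondence is 2j = 2j₀ + 2i. -/
lemma nineJ_eq_jsum {q : ℂ} (hq : IsGeneric q) {a b e c d f h k g : ℚ}
    (H : NineTri a b e c d f h k g) {j₀ : ℚ} {N : ℕ} (h0 : IsNat (2 * j₀)) (h1 : j₀ < 1)
    (hj : IsInt (a + g - j₀)) (hN : a + g ≤ j₀ + N) :
    nineJ q a b e c d f h k g =
    qPow q (Zexp d e h) * (triDelta q a b e * triDelta q c d f * triDelta q h k g
      * triDelta q a c h * triDelta q b d k * triDelta q e f g)
      * jsum j₀ N (coreTerm q a b e c d f h k g) := by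
  unfold nineJ
  simp only [nineJ_term_eq hq H]
  rw [← mul_sum]
  congr 1
  unfold jsum
  have key : ∀ j : ℚ, coreTerm q a b e c d f h k g j ≠ 0 → Tri a g j := by
    intro j hne
    unfold coreTerm at hne
    by_contra hn
    exact hne (if_neg fun hh => hn hh.1)
  have ha := H.abe.two1
  have hg := H.efg.two3
  obtain ⟨t, ht⟩ := h0
  obtain ⟨M, hM⟩ := ha.add hg
  rw [show 2 * (a + g) = (M : ℚ) by linarith, Nat.floor_natCast]
  symm
  refine sum_bij_ne_zero (fun i _ _ => t + 2 * i) ?_ ?_ ?_ ?_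
  · intro i _ hi
    have := (key _ hi).n1.nonneg
    have : (t : ℚ) + 2 * i ≤ M := by linarith
    have : t + 2 * i ≤ M := by exact_mod_cast this
    exact mem_range.2 (by omega)
  · intro i _ _ i' _ _ h
    omega
  · intro n _ hn
    have hT := key _ hn
    have e1 := hT.n1
    obtain ⟨p, hp⟩ := (hj.sub e1.isInt).of_eq (show (n : ℚ) / 2 - j₀ = _ by ring)
    have hp2 : (n : ℤ) = t + 2 * p := by
      have : (n : ℚ) = t + 2 * p := by linarith
      exact_mod_cast this
    have ht1 : t < 2 := by
      have : (t : ℚ) < 2 := by linarith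
      exact_mod_cast this
    have hp0 : 0 ≤ p := by omega
    obtain ⟨i, rfl⟩ := Int.eq_ofNat_of_zero_le hp0
    have hni : n = t + 2 * i := by omega
    have hji : j₀ + i = (n : ℚ) / 2 := by
      push_cast at hp; linarith
    refine ⟨i, mem_range.2 ?_, by rw [hji]; exact hn, hni.symm⟩
    have := e1.nonneg
    have : (i : ℚ) ≤ N := by linarith
    have : i ≤ N := by exact_mod_cast this
    omega
  · intro i _ _
    congr 1
    push_cast
    linarith

lemma deltaSq_swap (q : ℂ) (a b c : ℚ) : deltaSq q a b c = deltaSq q b a c := by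
  unfold deltaSq
  rw [show b + a - c = a + b - c by ring, show b + a + c + 1 = a + b + c + 1 by ring]
  ring

lemma NineTri.cycle {a b e c d f h k g : ℚ} (H : NineTri a b e c d f h k g) :
    NineTri f c d g h k e a b :=
  ⟨H.cdf.rot.rot, H.hkg.rot.rot, H.abe.rot.rot, H.efg.rot, H.ach.rot, H.bdk.rot⟩

/-- The rearrangement permutes the three Racah sums and the three squared triangle coefficients
cyclically. It makes B·B·C available with C placed on another 6j coefficient. -/
lemma coreTerm_cycle (q : ℂ) (a b e c d f h k g j : ℚ) :
    coreTerm q f c d g h k e a b j = coreTerm q a b e c d f h k g j := by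
  unfold coreTerm
  have hiff : (Tri f b j ∧ Tri c k j ∧ Tri g a j) ↔ (Tri a g j ∧ Tri b f j ∧ Tri c k j) :=
    ⟨fun h => ⟨h.2.2.swap12, h.1.swap12, h.2.1⟩, fun h => ⟨h.2.1.swap12, h.2.2, h.1.swap12⟩⟩
  by_cases hj : Tri a g j ∧ Tri b f j ∧ Tri c k j
  · rw [if_pos hj, if_pos (hiff.2 hj), deltaSq_swap q f b, deltaSq_swap q g a]
    ring
  · rw [if_neg hj, if_neg (mt hiff.1 hj)]

/-! ### The summation over `j` -/

lemma exists_of_nsum_ne_zero {N : ℚ} {f : ℚ → ℂ} (h : nsum N f ≠ 0) : ∃ z, IsNat z ∧ f z ≠ 0 := by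
  obtain ⟨z, _, hz⟩ := exists_ne_zero_of_sum_ne_zero h
  exact ⟨z, isNat_natCast z, hz⟩

section
variable {q : ℂ} {a b e f g z : ℚ}

lemma le_of_termA_ne_zero (h : termA q a b e f g z ≠ 0) : z ≤ b + e - a ∧ z ≤ g - f + e := by
  unfold termA at h
  simp only [mul_ne_zero_iff] at h
  have h1 := nonneg_of_qInvFact_ne_zero h.2.1.2
  have h2 := nonneg_of_qInvFact_ne_zero h.2.2
  constructor <;> linarith

lemma le_of_termB_ne_zero (h : termB q a b e f g z ≠ 0) : z ≤ e + f - g ∧ z ≤ b - a + e := by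
  unfold termB at h
  simp only [mul_ne_zero_iff] at h
  have h1 := nonneg_of_qInvFact_ne_zero h.2.1.1.2
  have h2 := nonneg_of_qInvFact_ne_zero h.2.1.2
  constructor <;> linarith

lemma le_of_termC_ne_zero (h : termC q a b e f g z ≠ 0) : 0 ≤ z ∧ z ≤ f + g - e := by
  unfold termC at h
  simp only [mul_ne_zero_iff] at h
  have h1 := nonneg_of_qInvFact_ne_zero h.2.1.2
  have h2 := nonneg_of_qInvFact_ne_zero h.2.1.1.2
  constructor <;> linarith

lemma le_of_termD_ne_zero (h : termD q a b e f g z ≠ 0) : z ≤ a + b - e ∧ z ≤ f + g - e := by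
  unfold termD at h
  simp only [mul_ne_zero_iff] at h
  have h1 := nonneg_of_qInvFact_ne_zero h.2.1.1.2
  have h2 := nonneg_of_qInvFact_ne_zero h.2.1.2
  constructor <;> linarith

lemma le_of_jPair_ne_zero {x j : ℚ} (h : jPair q x j ≠ 0) : j ≤ x := by
  have := nonneg_of_qInvFact_ne_zero (left_ne_zero_of_mul h)
  linarith

lemma le_of_jRatio_ne_zero {u j : ℚ} (h : jRatio q u j ≠ 0) : u ≤ j := by
  have := nonneg_of_qInvFact_ne_zero (right_ne_zero_of_mul h)
  linarith

lemma le_of_hatA_ne_zero {j : ℚ} (h : hatA q a b e f g j ≠ 0) : j ≤ b + f ∧ j ≤ a + g := by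
  obtain ⟨z, _, hz⟩ := exists_of_nsum_ne_zero h
  have h1 := le_of_termA_ne_zero (left_ne_zero_of_mul hz)
  have h2 := le_of_jPair_ne_zero (right_ne_zero_of_mul hz)
  constructor <;> linarith

lemma le_of_hatB_ne_zero {j : ℚ} (h : hatB q a b e f g j ≠ 0) : g - a ≤ j ∧ f - b ≤ j := by
  obtain ⟨z, _, hz⟩ := exists_of_nsum_ne_zero h
  have h1 := le_of_termB_ne_zero (left_ne_zero_of_mul hz)
  have h2 := le_of_jRatio_ne_zero (right_ne_zero_of_mul hz)
  constructor <;> linarith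

lemma le_of_hatC_ne_zero {j : ℚ} (h : hatC q a b e f g j ≠ 0) : j ≤ a + g := by
  obtain ⟨z, _, hz⟩ := exists_of_nsum_ne_zero h
  have h1 := le_of_termC_ne_zero (left_ne_zero_of_mul hz)
  have h2 := le_of_jPair_ne_zero (right_ne_zero_of_mul hz)
  linarith

lemma le_of_hatD_ne_zero {j : ℚ} (h : hatD q a b e f g j ≠ 0) : f - b ≤ j ∧ a - g ≤ j := by
  obtain ⟨z, _, hz⟩ := exists_of_nsum_ne_zero h
  have h1 := le_of_termD_ne_zero (left_ne_zero_of_mul hz)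
  have h2 := le_of_jRatio_ne_zero (right_ne_zero_of_mul hz)
  constructor <;> linarith

/-- For U + V = -1 the power of q disappears and a plain pair is left, so the vanishing theorems for
`closedPair` apply to `hatA` and `hatC` at a single j. -/
lemma closedPair_neg_one_sub (x j : ℚ) :
    closedPair q (-1 - j) j x = jPair q x j ∧ closedPair q j (-1 - j) x = jPair q x j := by
  unfold closedPair jPair
  rw [show -(x * (-1 - j + j + 1)) = 0 by ring, show -(x * (j + (-1 - j) + 1)) = 0 by ring,
    qPow_zero, show x - (-1 - j) = x + j + 1 by ring]
  constructor <;> ring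

/-- `Σ_j` of the product of three summands. -/
def closedTriple (q : ℂ) (x u v : ℚ) : ℂ :=
  qPow q (u * v - x * (u + v + 1)) * qFact q (u + v) * qInvFact q (x - u) * qInvFact q (x - v)

/-- The j-sum is moved inside and evaluated termwise; the closed form is required only where the
coefficients do not vanish, and there u + v ≥ 0. -/
lemma jsum_mul_nsum (hq : IsGeneric q) {j₀ : ℚ} {N : ℕ} (h0 : IsNat (2 * j₀)) (h1 : j₀ < 1)
    {N₁ N₂ N₃ : ℚ} (hN₁ : IsNat N₁) (hN₂ : IsNat N₂) (hN₃ : IsNat N₃) {F₁ F₂ F₃ : ℚ → ℂ}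
    {x u v : ℚ → ℚ} (hx : ∀ z, IsNat z → IsNat (N₁ - z) → IsInt (x z - j₀) ∧ x z ≤ j₀ + N)
    (hu : ∀ z, IsNat z → IsInt (u z - j₀)) (hv : ∀ z, IsNat z → IsInt (v z - j₀))
    (huv : ∀ y z, F₂ y ≠ 0 → F₃ z ≠ 0 → 0 ≤ u y + v z) :
    jsum j₀ N (fun j => jWeight q j * (nsum N₁ (fun z => F₁ z * jPair q (x z) j)
      * nsum N₂ (fun z => F₂ z * jRatio q (u z) j) * nsum N₃ (fun z => F₃ z * jRatio q (v z) j))) =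
    nsum N₁ fun z₁ => nsum N₂ fun z₂ => nsum N₃ fun z₃ =>
      F₁ z₁ * F₂ z₂ * F₃ z₃ * closedTriple q (x z₁) (u z₂) (v z₃) := by
  have hjn : ∀ (M : ℚ) (G : ℚ → ℚ → ℂ),
      jsum j₀ N (fun j => nsum M fun z => G z j) = nsum M fun z => jsum j₀ N fun j => G z j := by
    intro M G
    simp only [jsum, nsum]
    exact sum_comm
  have hmul : ∀ j, jWeight q j * (nsum N₁ (fun z => F₁ z * jPair q (x z) j)
      * nsum N₂ (fun z => F₂ z * jRatio q (u z) j) * nsum N₃ (fun z => F₃ z * jRatio q (v z) j)) =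
      nsum N₁ fun z₁ => nsum N₂ fun z₂ => nsum N₃ fun z₃ => F₁ z₁ * F₂ z₂ * F₃ z₃
        * (jWeight q j * jRatio q (u z₂) j * jRatio q (v z₃) j * jPair q (x z₁) j) := by
    intro j
    simp only [nsum]
    rw [sum_mul_sum, sum_mul, mul_sum]
    refine sum_congr rfl fun z₁ _ => ?_
    rw [sum_mul, mul_sum]
    refine sum_congr rfl fun z₂ _ => ?_
    rw [mul_sum, mul_sum]
    refine sum_congr rfl fun z₃ _ => ?_
    ring
  simp only [hmul, hjn]
  refine nsum_congr hN₁ fun z₁ i₁ i₁' => nsum_congr hN₂ fun z₂ i₂ _ => nsum_congr hN₃ fun z₃ i₃ _ => ?_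
  rw [show jsum j₀ N (fun j => F₁ z₁ * F₂ z₂ * F₃ z₃ * (jWeight q j * jRatio q (u z₂) j
      * jRatio q (v z₃) j * jPair q (x z₁) j)) = F₁ z₁ * F₂ z₂ * F₃ z₃ * jsum j₀ N (fun j =>
      jWeight q j * jRatio q (u z₂) j * jRatio q (v z₃) j
          * jPair q (x z₁) j) from (mul_sum ..).symm]
  by_cases hF : F₂ z₂ = 0 ∨ F₃ z₃ = 0
  · rcases hF with hF | hF <;> simp [hF]
  · push Not at hF
    rw [jsum_jRatio_jRatio_jPair hq h0 h1 (hu _ i₂) (hv _ i₃) (hx _ i₁ i₁').1 (huv _ _ hF.1 hF.2)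
      (hx _ i₁ i₁').2]
    rfl

end

/-! ### Cancellation of the j-dependent prefactors and vanishing outside the triangle region -/

section
variable {q : ℂ} (hq : IsGeneric q) {a b e c d f h k g j : ℚ} (H : NineTri a b e c d f h k g)

/-- The factors which multiply the summations `A`, `B`, `D`. -/
def factorABD (q : ℂ) (a b e c d f h k g : ℚ) : ℂ :=
  sgn (c + h - a) * (qInvFact q (h + a - c) * qInvFact q (k + g - h) * qInvFact q (a + c - h)
    * qInvFact q (k + h - g)) * (qFact q (d + k + b + 1) * qInvFact q (f + d - c)
    * qInvFact q (d + b - k) * qInvFact q (f + c - d)) * (qFact q (a + b + e + 1)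
    * qFact q (e + f + g + 1) * qInvFact q (b + e - a) * qInvFact q (e + g - f))

/-- The factors which multiply the summations `B`, `B`, `C`. -/
def factorBBC (q : ℂ) (a b e c d f h k g : ℚ) : ℂ :=
  sgn (c + k - a - g) * (qFact q (h + a + c + 1) * qInvFact q (k + h - g) * qInvFact q (h + c - a)
    * qInvFact q (k + g - h)) * (qFact q (d + k + b + 1) * qInvFact q (f + d - c)
    * qInvFact q (d + b - k) * qInvFact q (f + c - d)) * (qFact q (e + f + g + 1)
    * qInvFact q (a + e - b) * qInvFact q (e + g - f) * qInvFact q (a + b - e))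

include hq H

omit H in
lemma deltaSq_mul_eq_one {a b c : ℚ} (h : Tri a b c) : deltaSq q a b c * (qFact q (a + b + c + 1)
    * qInvFact q (a + b - c) * qInvFact q (a + c - b) * qInvFact q (b + c - a)) = 1 := by
  have h₁ := qFact_mul_qInvFact hq h.n1.nonneg
  have h₂ := qFact_mul_qInvFact hq h.n2.nonneg
  have h₃ := qFact_mul_qInvFact hq h.n3.nonneg
  have h₄ := qFact_mul_qInvFact hq h.sum_one.nonneg
  calc _ = (qFact q (a + b - c) * qInvFact q (a + b - c))
        * (qFact q (a + c - b) * qInvFact q (a + c - b))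
        * (qFact q (b + c - a) * qInvFact q (b + c - a))
        * (qFact q (a + b + c + 1) * qInvFact q (a + b + c + 1)) := by unfold deltaSq; ring
    _ = 1 := by rw [h₁, h₂, h₃, h₄]; ring

omit H in
lemma eq_of_eq_deltaSq_mul (h₁ : Tri a g j) (h₂ : Tri b f j) (h₃ : Tri c k j) {X Y : ℂ}
    (hXY : X = deltaSq q a g j * (qFact q (a + g + j + 1) * qInvFact q (a + g - j)
      * qInvFact q (a + j - g) * qInvFact q (g + j - a))
      * (deltaSq q b f j * (qFact q (b + f + j + 1) * qInvFact q (b + f - j)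
      * qInvFact q (b + j - f) * qInvFact q (f + j - b)))
      * (deltaSq q c k j * (qFact q (c + k + j + 1) * qInvFact q (c + k - j)
      * qInvFact q (c + j - k) * qInvFact q (k + j - c))) * Y) : X = Y := by
  rw [hXY, deltaSq_mul_eq_one hq h₁, deltaSq_mul_eq_one hq h₂, deltaSq_mul_eq_one hq h₃]
  ring

/-- The j-dependent parts of the three prefactors multiply to the inverse of the product of the
squared triangle coefficients. The exponents of the four signs add up to an integer congruent to
c+h-a modulo 2. -/
lemma coreTerm_eq_ABD (h₁ : Tri a g j) (h₂ : Tri b f j) (h₃ : Tri c k j) :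
    coreTerm q a b e c d f h k g j = factorABD q a b e c d f h k g * (jWeight q j
      * (hatA q k g h a c j * hatB q f c d k b j * hatD q a b e f g j)) := by
  have i₁ : IsInt (c + j + g + h) :=
    ((h₃.sum.isInt.add H.hkg.sum.isInt).sub H.hkg.two2.isInt).of_eq (by ring)
  have i₂ : IsInt (f + b + j) := h₂.sum.isInt.of_eq (by ring)
  have i₃ : IsInt (a + b + f + g) :=
    ((h₁.sum.isInt.add h₂.sum.isInt).sub h₁.two3.isInt).of_eq (by ring)
  have hs : sgn (c + h - a)
      = sgn (2 * j) * sgn (c + j + g + h) * sgn (f + b + j) * sgn (a + b + f + g) := by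
    rw [← sgn_add _ i₁, ← sgn_add _ i₂, ← sgn_add _ i₃]
    exact sgn_congr ((h₁.sum.add h₂.sum).isInt.neg.of_eq (by ring))
  unfold coreTerm factorABD
  rw [if_pos ⟨h₁, h₂, h₃⟩, hs, racah_eq_hatA hq H.hkg.rot H.ach.rot.rot h₃.swap12 h₁.swap12,
    racah_eq_hatB hq H.cdf.rot.rot H.bdk.rot h₂.swap12 h₃,
    racah_eq_hatD hq H.abe H.efg h₁ h₂]
  rw [show k + c + j + 1 = c + k + j + 1 by ring, show g + a + j + 1 = a + g + j + 1 by ring,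
    show f + b + j + 1 = b + f + j + 1 by ring]
  refine eq_of_eq_deltaSq_mul hq h₁ h₂ h₃ ?_
  ring

lemma coreTerm_eq_BBC (h₁ : Tri a g j) (h₂ : Tri b f j) (h₃ : Tri c k j) :
    coreTerm q a b e c d f h k g j = factorBBC q a b e c d f h k g * (jWeight q j
      * (hatC q a b e f g j * hatB q k g h a c j * hatB q f c d k b j)) := by
  have i₁ : IsInt (k + c + j) := h₃.sum.isInt.of_eq (by ring)
  have i₂ : IsInt (f + b + j) := h₂.sum.isInt.of_eq (by ring)
  have i₃ : IsInt (a + b + f + g) :=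
    ((h₁.sum.isInt.add h₂.sum.isInt).sub h₁.two3.isInt).of_eq (by ring)
  have hs : sgn (c + k - a - g)
      = sgn (2 * j) * sgn (k + c + j) * sgn (f + b + j) * sgn (a + b + f + g) := by
    rw [← sgn_add _ i₁, ← sgn_add _ i₂, ← sgn_add _ i₃]
    exact sgn_congr ((h₁.sum.add h₂.sum).isInt.neg.of_eq (by ring))
  unfold coreTerm factorBBC
  rw [if_pos ⟨h₁, h₂, h₃⟩, hs, racah_eq_hatB hq H.hkg.rot H.ach.rot.rot h₃.swap12 h₁.swap12,
    racah_eq_hatB hq H.cdf.rot.rot H.bdk.rot h₂.swap12 h₃,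
    racah_eq_hatC hq H.abe H.efg h₁ h₂]
  rw [show k + c + j + 1 = c + k + j + 1 by ring, show g + a - j = a + g - j by ring,
    show f + b + j + 1 = b + f + j + 1 by ring]
  refine eq_of_eq_deltaSq_mul hq h₁ h₂ h₃ ?_
  ring

section
variable (hj : IsInt (a + g - j)) (h2j : IsInt (2 * j))
  (hT : ¬ (Tri a g j ∧ Tri b f j ∧ Tri c k j))
include hj h2j hT

omit hq in
/-- The triangular conditions are inequalities if the integrality conditions hold. -/
lemma exists_lt_of_not_tri : j < a - g ∨ j < g - a ∨ a + g < j ∨ j < b - f ∨ j < f - b ∨ b + f < j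
    ∨ j < c - k ∨ j < k - c ∨ c + k < j := by
  by_contra hn
  push Not at hn
  obtain ⟨l₁, l₂, l₃, l₄, l₅, l₆, l₇, l₈, l₉⟩ := hn
  have i₁ := H.abe.two1.isInt
  have i₂ := H.efg.two3.isInt
  have i₃ : IsInt (b + f - j) := (((H.abe.sum.isInt.add H.efg.sum.isInt).sub hj).sub
    (H.abe.two3.isInt.add h2j)).of_eq (by ring)
  have i₄ := H.abe.two2.isInt
  have i₅ := H.cdf.two3.isInt
  have i₆ : IsInt (c + k - j) := (((H.ach.sum.isInt.add H.hkg.sum.isInt).sub hj).sub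
    (H.ach.two3.isInt.add h2j)).of_eq (by ring)
  have i₇ := H.ach.two2.isInt
  have i₈ := H.hkg.two2.isInt
  exact hT ⟨⟨hj.isNat (by linarith), ((i₁.sub hj).of_eq (by ring)).isNat (by linarith),
      ((i₂.sub hj).of_eq (by ring)).isNat (by linarith)⟩,
    ⟨i₃.isNat (by linarith), ((i₄.sub i₃).of_eq (by ring)).isNat (by linarith),
      ((i₅.sub i₃).of_eq (by ring)).isNat (by linarith)⟩,
    ⟨i₆.isNat (by linarith), ((i₇.sub i₆).of_eq (by ring)).isNat (by linarith),
      ((i₈.sub i₆).of_eq (by ring)).isNat (by linarith)⟩⟩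

/-- Six of the nine triangle inequalities are enforced by inverse factorials in the three
representations. The remaining ones are j ≥ g-a and j ≥ c-k, for which the A-sum vanishes, and j ≤
b+f, for which the B-sum vanishes. -/
lemma hatABD_eq_zero : hatA q k g h a c j * hatB q f c d k b j * hatD q a b e f g j = 0 := by
  by_contra hne
  have hA := left_ne_zero_of_mul (left_ne_zero_of_mul hne)
  have hB := right_ne_zero_of_mul (left_ne_zero_of_mul hne)
  have hD := right_ne_zero_of_mul hne
  obtain ⟨a₁, a₂⟩ := le_of_hatA_ne_zero hA
  obtain ⟨b₁, b₂⟩ := le_of_hatB_ne_zero hB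
  obtain ⟨d₁, d₂⟩ := le_of_hatD_ne_zero hD
  have i₀ := H.efg.two3.isInt
  have i₃ : IsInt (j - f - b) := ((hj.add (H.abe.two3.isInt.add h2j)).sub
    (H.abe.sum.isInt.add H.efg.sum.isInt)).of_eq (by ring)
  have i₆ : IsInt (j - k - c) := ((hj.add (H.ach.two3.isInt.add h2j)).sub
    (H.ach.sum.isInt.add H.hkg.sum.isInt)).of_eq (by ring)
  have i₇ := H.ach.two2.isInt
  have hU : IsInt (j - (k - c)) := (i₆.add i₇).of_eq (by ring)
  have hV : IsInt (j - (a - g)) := ((hj.neg).add i₀).of_eq (by ring)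
  rcases exists_lt_of_not_tri H hj h2j hT with l | l | l | l | l | l | l | l | l
  · linarith
  · refine hA ?_
    have := nsum_termA_eq_zero hq H.hkg.rot H.ach.rot.rot (U := j) (V := -1 - j)
      (hU.isNat (by linarith)) (IsInt.isNat ((hj.sub (H.ach.two1.isInt.add isInt_one)).of_eq
          (by ring)) (by
        have := (hj.sub H.ach.two1.isInt).neg.le_neg_one (by linarith)
        linarith)) (by linarith)
    unfold hatA
    simpa only [(closedPair_neg_one_sub _ _).2] using this
  · linarith
  · linarith
  · linarith
  · exact hB (hatB_eq_zero hq H.cdf.rot.rot H.bdk.rot i₃ (by linarith) (by linarith))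
  · refine hA ?_
    have i₈ : IsInt (j - (c - k)) := (i₆.add H.hkg.two2.isInt).of_eq (by ring)
    have := nsum_termA_eq_zero hq H.hkg.rot H.ach.rot.rot (U := -1 - j) (V := j)
      (IsInt.isNat ((i₈.neg.sub isInt_one).of_eq (by ring)) (by
        have := i₈.le_neg_one (by linarith)
        linarith)) (hV.isNat (by linarith)) (by linarith)
    unfold hatA
    simpa only [(closedPair_neg_one_sub _ _).1] using this
  · linarith
  · linarith

/-- Here inverse factorials give five of the inequalities. Violations of j ≥ g-a and j ≥ f-b kill
the C-sum, and violations of j ≤ c+k and j ≤ b+f kill the respective B-sums; j ≤ c+k comes first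
because the second B-sum needs it. -/
lemma hatBBC_eq_zero : hatC q a b e f g j * hatB q k g h a c j * hatB q f c d k b j = 0 := by
  by_contra hne
  have hC := left_ne_zero_of_mul (left_ne_zero_of_mul hne)
  have hA := right_ne_zero_of_mul (left_ne_zero_of_mul hne)
  have hB := right_ne_zero_of_mul hne
  have c₁ := le_of_hatC_ne_zero hC
  obtain ⟨a₁, a₂⟩ := le_of_hatB_ne_zero hA
  obtain ⟨b₁, b₂⟩ := le_of_hatB_ne_zero hB
  have i₀ := H.efg.two3.isInt
  have i₃ : IsInt (j - f - b) := ((hj.add (H.abe.two3.isInt.add h2j)).sub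
    (H.abe.sum.isInt.add H.efg.sum.isInt)).of_eq (by ring)
  have i₆ : IsInt (j - k - c) := ((hj.add (H.ach.two3.isInt.add h2j)).sub
    (H.ach.sum.isInt.add H.hkg.sum.isInt)).of_eq (by ring)
  have hU : IsInt (j - (a - g)) := ((hj.neg).add i₀).of_eq (by ring)
  have hV : IsInt (j - (b - f)) := (i₃.add H.efg.two2.isInt).of_eq (by ring)
  have hl : j ≤ c + k := by
    by_contra hn
    exact hA (hatB_eq_zero hq H.hkg.rot H.ach.rot.rot i₆ (by linarith) (by linarith))
  rcases exists_lt_of_not_tri H hj h2j hT with l | l | l | l | l | l | l | l | l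
  · linarith
  · refine hC ?_
    have i₈ : IsInt (j - (g - a)) := (hj.neg.add H.ach.two1.isInt).of_eq (by ring)
    have := nsum_termC_eq_zero hq H.abe H.efg (U := -1 - j) (V := j)
      (IsInt.isNat ((i₈.neg.sub isInt_one).of_eq (by ring)) (by
        have := i₈.le_neg_one (by linarith)
        linarith)) (hV.isNat (by linarith)) (by linarith)
    unfold hatC
    simpa only [(closedPair_neg_one_sub _ _).1] using this
  · linarith
  · linarith
  · refine hC ?_
    have i₈ : IsInt (j - (f - b)) := (i₃.add H.abe.two2.isInt).of_eq (by ring)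
    have := nsum_termC_eq_zero hq H.abe H.efg (U := j) (V := -1 - j) (hU.isNat (by linarith))
      (IsInt.isNat ((i₈.neg.sub isInt_one).of_eq (by ring)) (by
        have := i₈.le_neg_one (by linarith)
        linarith)) (by linarith)
    unfold hatC
    simpa only [(closedPair_neg_one_sub _ _).2] using this
  · exact hB (hatB_eq_zero hq H.cdf.rot.rot H.bdk.rot i₃ (by linarith) (by linarith))
  · linarith
  · linarith
  · linarith

end

variable {j₀ : ℚ} {N : ℕ} (h0 : IsNat (2 * j₀)) (h1 : j₀ < 1) (hj : IsInt (a + g - j₀))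
  (hN : a + g ≤ j₀ + N)
include h0 hj

lemma jsum_coreTerm_eq_ABD : jsum j₀ N (coreTerm q a b e c d f h k g) =
    factorABD q a b e c d f h k g * jsum j₀ N fun j => jWeight q j
      * (hatA q k g h a c j * hatB q f c d k b j * hatD q a b e f g j) := by
  unfold jsum
  rw [mul_sum]
  refine sum_congr rfl fun i _ => ?_
  beta_reduce
  by_cases hT : Tri a g (j₀ + i) ∧ Tri b f (j₀ + i) ∧ Tri c k (j₀ + i)
  · exact coreTerm_eq_ABD hq H hT.1 hT.2.1 hT.2.2
  · rw [coreTerm, if_neg hT, hatABD_eq_zero hq H ((hj.sub (isInt_natCast i)).of_eq (by ring))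
      ((h0.isInt.add ((isInt_natCast i).add (isInt_natCast i))).of_eq (by ring)) hT]
    ring

lemma jsum_coreTerm_eq_BBC : jsum j₀ N (coreTerm q a b e c d f h k g) =
    factorBBC q a b e c d f h k g * jsum j₀ N fun j => jWeight q j
      * (hatC q a b e f g j * hatB q k g h a c j * hatB q f c d k b j) := by
  unfold jsum
  rw [mul_sum]
  refine sum_congr rfl fun i _ => ?_
  beta_reduce
  by_cases hT : Tri a g (j₀ + i) ∧ Tri b f (j₀ + i) ∧ Tri c k (j₀ + i)
  · exact coreTerm_eq_BBC hq H hT.1 hT.2.1 hT.2.2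
  · rw [coreTerm, if_neg hT, hatBBC_eq_zero hq H ((hj.sub (isInt_natCast i)).of_eq (by ring))
      ((h0.isInt.add ((isInt_natCast i).add (isInt_natCast i))).of_eq (by ring)) hT]
    ring

include h1 hN

/-- The triple sum obtained from the representations `A`, `B` and `D` of the `6j` coefficients. -/
theorem jsum_coreTerm_eq_sum_ABD : jsum j₀ N (coreTerm q a b e c d f h k g) =
    factorABD q a b e c d f h k g * nsum (g + h - k) fun z₁ => nsum (d + k - b) fun z₂ =>
      nsum (f + g - e) fun z₃ => termA q k g h a c z₁ * termB q f c d k b z₂ * termD q a b e f g z₃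
        * closedTriple q (k + a - h + z₁) (d + k - f - z₂) (a + f - e - z₃) := by
  rw [jsum_coreTerm_eq_ABD hq H h0 hj]
  congr 1
  have i₁ := H.hkg.n3
  have i₂ := H.cdf.n1.isInt
  have i₃ := H.efg.two3.isInt
  refine jsum_mul_nsum hq h0 h1 (H.hkg.rot.n3) (H.bdk.rot.n1) H.efg.n3 (fun z hz hz' => ?_)
    (fun z hz => ?_) (fun z hz => ?_) (fun y z hy hz => ?_)
  · have := hz'.nonneg
    exact ⟨(hj.sub hz'.isInt).of_eq (by ring), by linarith⟩
  · exact ((((hj.add H.abe.two3.isInt).sub (H.abe.sum.isInt.add H.efg.sum.isInt)).add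
      H.bdk.sum.isInt).sub hz.isInt).of_eq (by ring)
  · exact (((hj.add H.efg.n1.isInt).sub H.efg.two1.isInt).sub hz.isInt).of_eq (by ring)
  -- Non-vanishing coefficients force z₂ ≤ d+k-b and z₃ ≤ a+b-e, hence u + v = a+d+k-e-z₂-z₃ ≥ 0.
  · have := le_of_termB_ne_zero hy
    have := le_of_termD_ne_zero hz
    linarith

/-- The triple sum obtained from the representations `B`, `B` and `C` of the `6j` coefficients. -/
theorem jsum_coreTerm_eq_sum_BBC : jsum j₀ N (coreTerm q a b e c d f h k g) =
    factorBBC q a b e c d f h k g * nsum (f + g - e) fun z₃ => nsum (h + a - c) fun z₁ =>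
      nsum (d + k - b) fun z₂ => termC q a b e f g z₃ * termB q k g h a c z₁ * termB q f c d k b z₂
        * closedTriple q (a + g - z₃) (h + a - k - z₁) (d + k - f - z₂) := by
  rw [jsum_coreTerm_eq_BBC hq H h0 hj]
  congr 1
  refine jsum_mul_nsum hq h0 h1 H.efg.n3 H.ach.rot.rot.n1 H.bdk.rot.n1 (fun z hz hz' => ?_)
    (fun z hz => ?_) (fun z hz => ?_) (fun y z hy hz => ?_)
  · have := hz.nonneg
    exact ⟨(hj.sub hz.isInt).of_eq (by ring), by linarith⟩
  · exact (((hj.add H.hkg.n2.isInt).sub H.efg.two3.isInt).sub hz.isInt).of_eq (by ring)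
  · exact ((((hj.add H.abe.two3.isInt).sub (H.abe.sum.isInt.add H.efg.sum.isInt)).add
      H.bdk.sum.isInt).sub hz.isInt).of_eq (by ring)
  · have := le_of_termB_ne_zero hy
    have := le_of_termB_ne_zero hz
    linarith

end

/-! ### Change of representation under the summation sign -/

section
variable {q : ℂ}

lemma termB_eq (a b e f g z : ℚ) :
    termB q a b e f g z = coreB q a b e f g z * qInvFact q (e + f - g - z) := by
  unfold termB coreB; ring

lemma termD_eq (a b e f g z : ℚ) :
    termD q a b e f g z = coreD q a b e f g z * qInvFact q (a + b - e - z) := by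
  unfold termD coreD; ring

variable (hq : IsGeneric q) {N₁ : ℚ} (hN₁ : IsNat N₁) {A : ℚ → ℂ} {x : ℚ → ℚ}
include hq hN₁

/-- The factor `[u+v]! / [m]!` with `u + v = m + L` may be replaced by a product of `L` factors
under a summation sign for which the terms with `u + v < 0` add up to zero. -/
lemma nsum_mul_closedTriple {m u v : ℚ} {L : ℕ} (hm : IsInt m) (huv : u + v = m + L)
    (h0 : u + v < 0 → nsum N₁ (fun y => A y * closedPair q u v (x y)) = 0) (C : ℂ) :
    nsum N₁ (fun y => A y * (C * qInvFact q m * closedTriple q (x y) u v)) =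
      nsum N₁ fun y => A y * (C * (qPow q (u * v - x y * (u + v + 1)) * qPoch q (m + 1) L
        * qInvFact q (x y - u) * qInvFact q (x y - v))) := by
  rcases le_or_gt 0 (u + v) with h | h
  · refine nsum_congr hN₁ fun y _ _ => ?_
    have := qFact_mul_qInvFact_sub hq (x := u + v) (y := m) (l := L)
      (((hm.add (isInt_natCast L)).of_eq huv).isNat h) (by linarith)
    unfold closedTriple
    linear_combination A y * C * qPow q (u * v - x y * (u + v + 1)) * qInvFact q (x y - u)
      * qInvFact q (x y - v) * this
  -- Now m < 0 and the left side vanishes termwise. On the right the shifted factorial need not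
  -- vanish, but it is independent of y, and the remaining sum over y is zero by hypothesis.
  · have hL : (0 : ℚ) ≤ L := by positivity
    rw [nsum_eq_zero hN₁ fun y _ _ => by rw [qInvFact_of_neg (by linarith : m < 0)]; ring]
    symm
    calc _ = nsum N₁ (fun y => (C * qPow q (u * v) * qPoch q (m + 1) L)
          * (A y * closedPair q u v (x y))) := by
          refine nsum_congr hN₁ fun y _ _ => ?_
          unfold closedPair
          rw [sub_eq_add_neg, qPow_add hq.ne_zero]
          ring
      _ = 0 := by rw [nsum_mul_left, h0 h, mul_zero]

/-- The identity between `coreB` and `termC` uses a shifted factorial where the j-sum produces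
[u+v]!/[e+f-g-z]!. The two agree termwise for u+v ≥ 0 only, so the exchange takes place under an
outer sum that kills the terms with u+v < 0. -/
lemma nsum_termB_mul_closedTriple {a b e f g v : ℚ} (h₁ : Tri a b e) (h₂ : Tri e f g)
    (hv : IsNat (v - (a - g)))
    (hx : ∀ y, IsNat y → A y ≠ 0 → IsInt (x y - (a - g)) ∧ x y ≤ b + f)
    (h0 : ∀ u, IsNat (u - (f - b)) → u + v < 0 →
      nsum N₁ (fun y => A y * closedPair q u v (x y)) = 0) :
    nsum N₁ (fun y => A y * nsum (e + f - g) fun z =>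
      termB q a b e f g z * closedTriple q (x y) (e + f - a - z) v) =
    nsum N₁ fun y => A y * (sgn (b + f - v) * nsum (f + g - e) fun z =>
      termC q a b e f g z * closedPairPair q (x y) (a + g - z) v) := by
  obtain ⟨L, hL⟩ := hv
  have hv' : v = a - g + L := by linarith
  have hbe : IsNat (b - a + e) := h₁.n3.of_eq (by ring)
  have e₁ : ∀ y, nsum (e + f - g) (fun z =>
      termB q a b e f g z * closedTriple q (x y) (e + f - a - z) v) =
      nsum (b - a + e) (fun z =>
      termB q a b e f g z * closedTriple q (x y) (e + f - a - z) v) := fun y =>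
    -- Without the factor 1/[e+f-g-z]! the sum is cut off by 1/[b-a+e-z]!, so its range is changed
    -- before that factor is split off.
    nsum_range h₂.n1 hbe fun z _ hz => le_of_termB_ne_zero (left_ne_zero_of_mul hz)
  have e₂ : ∀ y, IsNat y → IsNat (N₁ - y) → A y * (sgn (b + f - v) * nsum (f + g - e) (fun z =>
      termC q a b e f g z * closedPairPair q (x y) (a + g - z) v)) =
      A y * nsum (b - a + e) (fun z => coreB q a b e f g z
      * (qPow q ((e + f - a - z) * v - x y * (e + f - a - z + v + 1))
        * qPoch q (e + f - g - z + 1) L * qInvFact q (x y - (e + f - a - z))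
        * qInvFact q (x y - v))) := by
    intro y i₁ _
    by_cases hA : A y = 0
    · simp [hA]
    obtain ⟨j₁, j₂⟩ := hx y i₁ hA
    rw [hv', ← coreB_sum_eq_sgn_mul_termC_sum hq h₁ h₂ L (x y) j₁ j₂]
    congr 1
    refine nsum_congr hbe fun z _ _ => ?_
    rw [mul_comm (a - g + (L : ℚ)) (e + f - a - z), add_comm (a - g + (L : ℚ)) (e + f - a - z)]
    ring
  rw [nsum_congr hN₁ fun y i₁ i₂ => by rw [e₁ y],
    nsum_congr (f := fun y => A y * (sgn (b + f - v) * _)) hN₁ e₂]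
  simp only [← nsum_mul_left]
  rw [nsum_comm, nsum_comm N₁]
  refine nsum_congr hbe fun z i₁ i₂ => ?_
  simp only [termB_eq]
  refine nsum_mul_closedTriple hq hN₁ (h₂.n1.isInt.sub i₁.isInt) (by linarith) (h0 _ ?_) _
  exact i₂.of_eq (by ring)

/-- The coefficients of the correction are chosen before u, so that u can afterwards be summed over
with the correction kept as a linear expression in `jRatio`. -/
lemma exists_nsum_termD_mul_closedTriple {a b e f g : ℚ} (h₁ : Tri a b e) (h₂ : Tri e f g)
    (hx : ∀ y, IsNat y → A y ≠ 0 → IsInt (x y - (b - f)) ∧ x y ≤ a + g) :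
    ∃ (c : ℕ → ℂ) (N : ℕ), ∀ u : ℚ, IsNat (u - (b - f)) →
    (∀ v, IsNat (v - (a - g)) → u + v < 0 →
      nsum N₁ (fun y => A y * closedPair q u v (x y)) = 0) →
    nsum N₁ (fun y => A y * nsum (f + g - e) fun z =>
      termD q a b e f g z * closedTriple q (x y) u (a + f - e - z)) =
    nsum N₁ (fun y => A y * (sgn (b + f - x y + (e + f - g)) * nsum (e + f - g) fun z =>
      termE q a b e f g z * closedNum q (x y) (e + a + f - z) u)) +
    nsum N₁ (fun y => A y * ∑ i ∈ range N, c i * (jRatio q u (b + f + 1 + i)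
      * jPair q (x y) (b + f + 1 + i))) := by
  obtain ⟨c, N, hc⟩ := exists_coreD_sum_eq hq h₁ h₂
  refine ⟨c, N, ?_⟩
  rintro u ⟨L, hL⟩ h0
  have hu : u = b - f + L := by linarith
  rw [← nsum_add]
  have e₂ : ∀ y, IsNat y → IsNat (N₁ - y) →
      A y * (sgn (b + f - x y + (e + f - g)) * nsum (e + f - g) fun z =>
        termE q a b e f g z * closedNum q (x y) (e + a + f - z) u) +
      A y * ∑ i ∈ range N, c i * (jRatio q u (b + f + 1 + i) * jPair q (x y) (b + f + 1 + i)) =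
      A y * nsum (f + g - e) (fun z => coreD q a b e f g z
      * (qPow q (u * (a + f - e - z) - x y * (u + (a + f - e - z) + 1))
        * qPoch q (a + b - e - z + 1) L * qInvFact q (x y - u)
        * qInvFact q (x y - (a + f - e - z)))) := by
    intro y i₁ _
    by_cases hA : A y = 0
    · simp [hA]
    obtain ⟨j₁, j₂⟩ := hx y i₁ hA
    rw [← mul_add, hu, ← hc L (x y) j₁ j₂]
  rw [nsum_congr (f := fun y => A y * (sgn (b + f - x y + (e + f - g)) * _) + _) hN₁ e₂]
  simp only [← nsum_mul_left]
  rw [nsum_comm, nsum_comm N₁]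
  refine nsum_congr h₂.n3 fun z i₁ i₂ => ?_
  simp only [termD_eq]
  refine nsum_mul_closedTriple hq hN₁ (h₁.n1.isInt.sub i₁.isInt) (by linarith) (h0 _ ?_) _
  exact i₂.of_eq (by ring)

end

section
variable {q : ℂ} (hq : IsGeneric q) {a b e c d f h k g : ℚ} (H : NineTri a b e c d f h k g)
include hq H

/-- Representation `C` instead of `B` in the triple sum of `A`, `B`, `D`. -/
theorem sum_ABD_eq_sum_ACD :
    (nsum (g + h - k) fun z₁ => nsum (d + k - b) fun z₂ => nsum (f + g - e) fun z₃ =>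
      termA q k g h a c z₁ * termB q f c d k b z₂ * termD q a b e f g z₃
        * closedTriple q (k + a - h + z₁) (d + k - f - z₂) (a + f - e - z₃)) =
    nsum (g + h - k) fun z₁ => nsum (k + b - d) fun z₂ => nsum (f + g - e) fun z₃ =>
      termA q k g h a c z₁ * termC q f c d k b z₂ * termD q a b e f g z₃
        * (sgn (c + k - (a + f - e - z₃))
          * closedPairPair q (k + a - h + z₁) (f + b - z₂) (a + f - e - z₃)) := by
  have hA : IsNat (g + h - k) := H.hkg.rot.n3
  have hB : IsNat (d + k - b) := H.bdk.rot.n1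
  have hC : IsNat (k + b - d) := H.bdk.rot.n3
  have hD := H.efg.n3
  have e₁ : ∀ z₁, (nsum (d + k - b) fun z₂ => nsum (f + g - e) fun z₃ =>
      termA q k g h a c z₁ * termB q f c d k b z₂ * termD q a b e f g z₃
        * closedTriple q (k + a - h + z₁) (d + k - f - z₂) (a + f - e - z₃)) =
      nsum (f + g - e) fun z₃ => termD q a b e f g z₃ * (termA q k g h a c z₁
        * nsum (d + k - b) fun z₂ => termB q f c d k b z₂
          * closedTriple q (k + a - h + z₁) (d + k - f - z₂) (a + f - e - z₃)) := by
    intro z₁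
    rw [nsum_comm]
    refine nsum_congr hD fun z₃ _ _ => ?_
    rw [← nsum_mul_left, ← nsum_mul_left]
    refine nsum_congr hB fun z₂ _ _ => ?_
    ring
  have e₂ : ∀ z₁, (nsum (k + b - d) fun z₂ => nsum (f + g - e) fun z₃ =>
      termA q k g h a c z₁ * termC q f c d k b z₂ * termD q a b e f g z₃
        * (sgn (c + k - (a + f - e - z₃))
          * closedPairPair q (k + a - h + z₁) (f + b - z₂) (a + f - e - z₃))) =
      nsum (f + g - e) fun z₃ => termD q a b e f g z₃ * (termA q k g h a c z₁
        * (sgn (c + k - (a + f - e - z₃)) * nsum (k + b - d) fun z₂ => termC q f c d k b z₂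
          * closedPairPair q (k + a - h + z₁) (f + b - z₂) (a + f - e - z₃))) := by
    intro z₁
    rw [nsum_comm]
    refine nsum_congr hD fun z₃ _ _ => ?_
    rw [← nsum_mul_left, ← nsum_mul_left, ← nsum_mul_left]
    refine nsum_congr hC fun z₂ _ _ => ?_
    ring
  simp only [e₁, e₂]
  rw [nsum_comm, nsum_comm (g + h - k)]
  refine nsum_congr hD fun z₃ i₁ i₂ => ?_
  rw [nsum_mul_left, nsum_mul_left]
  by_cases hz : termD q a b e f g z₃ = 0
  · rw [hz]; ring
  have hz := (le_of_termD_ne_zero hz).1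
  congr 1
  -- For fixed z₃ the A-sum plays the role of the outer sum and provides the required vanishing.
  refine nsum_termB_mul_closedTriple hq hA H.cdf.rot.rot H.bdk.rot ?_ (fun y i₁ i₂ => ?_)
    fun u hu huv => nsum_termA_eq_zero hq H.hkg.rot H.ach.rot.rot hu (i₂.of_eq (by ring)) huv
  · exact IsInt.isNat ((H.abe.n1.isInt.sub i₁.isInt).of_eq (by ring)) (by linarith)
  · have := le_of_termA_ne_zero i₂
    exact ⟨(((H.abe.sum.isInt.sub H.efg.sum.isInt).add H.hkg.n3.isInt).add i₁.isInt).of_eq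
      (by ring), by linarith⟩

/-- Representation `C` instead of the first `B` in the triple sum of `B`, `B`, `C`. -/
theorem sum_BBC_eq_sum_CBC :
    (nsum (f + g - e) fun z₃ => nsum (h + a - c) fun z₁ => nsum (d + k - b) fun z₂ =>
      termC q a b e f g z₃ * termB q k g h a c z₁ * termB q f c d k b z₂
        * closedTriple q (a + g - z₃) (h + a - k - z₁) (d + k - f - z₂)) =
    nsum (a + c - h) fun z₁ => nsum (d + k - b) fun z₂ => nsum (f + g - e) fun z₃ =>
      termC q k g h a c z₁ * termB q f c d k b z₂ * termC q a b e f g z₃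
        * (sgn (g + a - (d + k - f - z₂))
          * closedPairPair q (a + g - z₃) (k + c - z₁) (d + k - f - z₂)) := by
  have hA : IsNat (h + a - c) := H.ach.rot.rot.n1
  have hA' : IsNat (a + c - h) := H.ach.n1
  have hB : IsNat (d + k - b) := H.bdk.rot.n1
  have hC := H.efg.n3
  have e₁ : ∀ z₃, (nsum (h + a - c) fun z₁ => nsum (d + k - b) fun z₂ =>
      termC q a b e f g z₃ * termB q k g h a c z₁ * termB q f c d k b z₂
        * closedTriple q (a + g - z₃) (h + a - k - z₁) (d + k - f - z₂)) =
      nsum (d + k - b) fun z₂ => termB q f c d k b z₂ * (termC q a b e f g z₃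
        * nsum (h + a - c) fun z₁ => termB q k g h a c z₁
          * closedTriple q (a + g - z₃) (h + a - k - z₁) (d + k - f - z₂)) := by
    intro z₁
    rw [nsum_comm]
    refine nsum_congr hB fun z₃ _ _ => ?_
    rw [← nsum_mul_left, ← nsum_mul_left]
    refine nsum_congr hA fun z₂ _ _ => ?_
    ring
  have e₂ : (nsum (a + c - h) fun z₁ => nsum (d + k - b) fun z₂ => nsum (f + g - e) fun z₃ =>
      termC q k g h a c z₁ * termB q f c d k b z₂ * termC q a b e f g z₃
        * (sgn (g + a - (d + k - f - z₂))
          * closedPairPair q (a + g - z₃) (k + c - z₁) (d + k - f - z₂))) =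
      nsum (d + k - b) fun z₂ => nsum (f + g - e) fun z₃ =>
        termB q f c d k b z₂ * (termC q a b e f g z₃
        * (sgn (g + a - (d + k - f - z₂)) * nsum (a + c - h) fun z₁ => termC q k g h a c z₁
          * closedPairPair q (a + g - z₃) (k + c - z₁) (d + k - f - z₂))) := by
    rw [nsum_comm]
    refine nsum_congr hB fun z₂ _ _ => ?_
    rw [nsum_comm]
    refine nsum_congr hC fun z₃ _ _ => ?_
    rw [← nsum_mul_left, ← nsum_mul_left, ← nsum_mul_left]
    refine nsum_congr hA' fun z₁ _ _ => ?_
    ring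
  simp only [e₁]
  rw [e₂, nsum_comm]
  refine nsum_congr hB fun z₂ i₁ i₂ => ?_
  rw [nsum_mul_left, nsum_mul_left]
  by_cases hz : termB q f c d k b z₂ = 0
  · rw [hz]; ring
  have hz := (le_of_termB_ne_zero hz).2
  congr 1
  -- Here, for fixed z₂, the C-sum is the outer sum.
  refine nsum_termB_mul_closedTriple hq hC H.hkg.rot H.ach.rot.rot ?_ (fun y i₁ i₂ => ?_)
    fun u hu huv => nsum_termC_eq_zero hq H.abe H.efg hu (i₂.of_eq (by ring)) huv
  · exact IsInt.isNat ((H.cdf.n1.isInt.sub i₁.isInt).of_eq (by ring)) (by linarith)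
  · have := le_of_termC_ne_zero i₂
    exact ⟨(((H.ach.sum.isInt.add H.hkg.sum.isInt).sub (H.hkg.two1.isInt.add
      H.hkg.two2.isInt)).sub i₁.isInt).of_eq (by ring), by linarith⟩

/-- Representation `E` instead of `D` in the triple sum of `A`, `B`, `D`. -/
theorem sum_ABD_eq_sum_ABE :
    (nsum (g + h - k) fun z₁ => nsum (d + k - b) fun z₂ => nsum (f + g - e) fun z₃ =>
      termA q k g h a c z₁ * termB q f c d k b z₂ * termD q a b e f g z₃
        * closedTriple q (k + a - h + z₁) (d + k - f - z₂) (a + f - e - z₃)) =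
    nsum (g + h - k) fun z₁ => nsum (d + k - b) fun z₂ => nsum (e + f - g) fun z₃ =>
      termA q k g h a c z₁ * termB q f c d k b z₂ * termE q a b e f g z₃
        * (sgn (b + f - (k + a - h + z₁) + (e + f - g))
          * closedNum q (k + a - h + z₁) (e + a + f - z₃) (d + k - f - z₂)) := by
  have hA : IsNat (g + h - k) := H.hkg.rot.n3
  have hB : IsNat (d + k - b) := H.bdk.rot.n1
  have hD := H.efg.n3
  have hE := H.efg.n1
  obtain ⟨γ, N, hγ⟩ := exists_nsum_termD_mul_closedTriple hq hA (A := termA q k g h a c)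
    (x := fun z => k + a - h + z) H.abe H.efg (fun y i₁ i₂ => by
      have := le_of_termA_ne_zero i₂
      exact ⟨(((H.abe.sum.isInt.add H.efg.sum.isInt).sub (H.abe.two2.isInt.add
        (H.efg.two1.isInt))).add (H.hkg.n3.isInt.sub H.efg.two3.isInt) |>.add i₁.isInt).of_eq
          (by ring), by linarith⟩)
  -- Summed over z₂, the correction collects values of `hatB` at j = b+f+1+i. A non-zero pair and a
  -- non-zero `termA` force j ≤ c+k, so these values lie in the range f+b < j ≤ c+k where `hatB`
  -- vanishes.
  have e₀ : (nsum (d + k - b) fun z₂ => termB q f c d k b z₂ * nsum (g + h - k) fun z₁ =>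
      termA q k g h a c z₁ * ∑ i ∈ range N, γ i * (jRatio q (d + k - f - z₂) (b + f + 1 + i)
        * jPair q (k + a - h + z₁) (b + f + 1 + i))) = 0 := by
    simp only [← nsum_mul_left]
    rw [nsum_comm]
    refine nsum_eq_zero hA fun z₁ i₁ _ => ?_
    by_cases hz : termA q k g h a c z₁ = 0
    · rw [hz]; simp [nsum]
    have hz := (le_of_termA_ne_zero hz).2
    calc _ = ∑ i ∈ range N, termA q k g h a c z₁ * γ i * jPair q (k + a - h + z₁) (b + f + 1 + i)
          * hatB q f c d k b (b + f + 1 + i) := by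
          unfold hatB
          simp only [nsum, mul_sum]
          rw [sum_comm]
          refine sum_congr rfl fun i _ => sum_congr rfl fun z₂ _ => ?_
          ring
      _ = 0 := by
          refine sum_eq_zero fun i _ => ?_
          have hi : (0 : ℚ) ≤ i := by positivity
          by_cases hp : jPair q (k + a - h + z₁) (b + f + 1 + i) = 0
          · rw [hp]; ring
          have hp := le_of_jPair_ne_zero hp
          rw [hatB_eq_zero hq H.cdf.rot.rot H.bdk.rot
            ((isInt_one.add (isInt_natCast i)).of_eq (by ring)) (by linarith) (by linarith)]
          ring
  have e₁ : (nsum (g + h - k) fun z₁ => nsum (d + k - b) fun z₂ => nsum (f + g - e) fun z₃ =>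
      termA q k g h a c z₁ * termB q f c d k b z₂ * termD q a b e f g z₃
        * closedTriple q (k + a - h + z₁) (d + k - f - z₂) (a + f - e - z₃)) =
      nsum (d + k - b) fun z₂ => termB q f c d k b z₂ * nsum (g + h - k) fun z₁ =>
        termA q k g h a c z₁ * nsum (f + g - e) fun z₃ => termD q a b e f g z₃
        * closedTriple q (k + a - h + z₁) (d + k - f - z₂) (a + f - e - z₃) := by
    rw [nsum_comm]
    refine nsum_congr hB fun z₂ _ _ => ?_
    rw [← nsum_mul_left]
    refine nsum_congr hA fun z₁ _ _ => ?_
    rw [← nsum_mul_left, ← nsum_mul_left]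
    refine nsum_congr hD fun z₃ _ _ => ?_
    ring
  have e₂ : (nsum (g + h - k) fun z₁ => nsum (d + k - b) fun z₂ => nsum (e + f - g) fun z₃ =>
      termA q k g h a c z₁ * termB q f c d k b z₂ * termE q a b e f g z₃
        * (sgn (b + f - (k + a - h + z₁) + (e + f - g))
          * closedNum q (k + a - h + z₁) (e + a + f - z₃) (d + k - f - z₂))) =
      nsum (d + k - b) fun z₂ => termB q f c d k b z₂ * nsum (g + h - k) fun z₁ =>
        termA q k g h a c z₁ * (sgn (b + f - (k + a - h + z₁) + (e + f - g))
          * nsum (e + f - g) fun z₃ => termE q a b e f g z₃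
          * closedNum q (k + a - h + z₁) (e + a + f - z₃) (d + k - f - z₂)) := by
    rw [nsum_comm]
    refine nsum_congr hB fun z₂ _ _ => ?_
    rw [← nsum_mul_left]
    refine nsum_congr hA fun z₁ _ _ => ?_
    rw [← nsum_mul_left, ← nsum_mul_left, ← nsum_mul_left]
    refine nsum_congr hE fun z₃ _ _ => ?_
    ring
  rw [e₁, e₂, ← add_zero (nsum (d + k - b) fun z₂ => _ * nsum _ fun z₁ => _ * (_ * _)), ← e₀,
    ← nsum_add]
  refine nsum_congr hB fun z₂ i₁ i₂ => ?_
  rw [← mul_add]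
  by_cases hz : termB q f c d k b z₂ = 0
  · rw [hz]; ring
  have hz := (le_of_termB_ne_zero hz).2
  congr 1
  refine hγ _ (i₂.of_eq (by ring)) fun v hv huv =>
    nsum_termA_eq_zero hq H.hkg.rot H.ach.rot.rot ?_ hv huv
  exact IsInt.isNat ((H.cdf.n1.isInt.sub i₁.isInt).of_eq (by ring)) (by linarith)

end

/-! ### The triple sums in terms of factorials -/

/-- The offset is half the residue of 2x modulo 2, that is, 0 or 1/2; N is only required to be
large. -/
lemma exists_offset {x : ℚ} (hx : IsNat (2 * x)) (M : ℚ) :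
    ∃ (j₀ : ℚ) (N : ℕ), IsNat (2 * j₀) ∧ j₀ < 1 ∧ IsInt (x - j₀) ∧ M ≤ j₀ + N := by
  obtain ⟨n, hn⟩ := hx
  obtain ⟨N, hN⟩ := exists_nat_ge M
  have h1 : ((n % 2 : ℕ) : ℚ) ≤ 1 := by exact_mod_cast (by omega : n % 2 ≤ 1)
  have h0 : (0 : ℚ) ≤ ((n % 2 : ℕ) : ℚ) := by positivity
  have h2 : (n : ℚ) = ((n % 2 : ℕ) : ℚ) + 2 * ((n / 2 : ℕ) : ℚ) := by
    exact_mod_cast (Nat.mod_add_div n 2).symm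
  exact ⟨((n % 2 : ℕ) : ℚ) / 2, N, ⟨n % 2, by ring⟩, by linarith, ⟨((n / 2 : ℕ) : ℤ), by
    rw [Int.cast_natCast]; linarith⟩, by linarith⟩

lemma eq_of_eq_sgn_mul_self (z : ℚ) {X Y : ℂ} (h : X = sgn z * sgn z * Y) : X = Y := by
  rw [h, sgn_mul_self, one_mul]

/-- The ranges left by the derivation and those of the final formulas may differ; both contain the
support of the summand, and the limits are adjusted from the innermost sum outwards. -/
lemma nsum_eq_mul_tripleSum {N₁ N₂ N₃ M₁ M₂ M₃ : ℚ} {F G : ℚ → ℚ → ℚ → ℂ} {κ : ℂ}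
    (hN₁ : IsNat N₁) (hN₂ : IsNat N₂) (hN₃ : IsNat N₃)
    (hM₁ : IsNat M₁) (hM₂ : IsNat M₂) (hM₃ : IsNat M₃)
    (hF : ∀ z₁ z₂ z₃, IsNat z₁ → IsNat z₂ → IsNat z₃ → F z₁ z₂ z₃ ≠ 0 →
      (z₁ ≤ N₁ ∧ z₁ ≤ M₁) ∧ (z₂ ≤ N₂ ∧ z₂ ≤ M₂) ∧ (z₃ ≤ N₃ ∧ z₃ ≤ M₃))
    (hG : ∀ z₁ z₂ z₃, IsNat z₁ → IsNat z₂ → IsNat z₃ → F z₁ z₂ z₃ = κ * G z₁ z₂ z₃) :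
    (nsum N₁ fun z₁ => nsum N₂ fun z₂ => nsum N₃ fun z₃ => F z₁ z₂ z₃) =
      κ * tripleSum M₁ M₂ M₃ G := by
  calc _ = nsum N₁ fun z₁ => nsum N₂ fun z₂ => nsum M₃ fun z₃ => F z₁ z₂ z₃ :=
        nsum_congr hN₁ fun z₁ i₁ _ => nsum_congr hN₂ fun z₂ i₂ _ =>
          nsum_range hN₃ hM₃ fun z₃ i₃ hz => (hF z₁ z₂ z₃ i₁ i₂ i₃ hz).2.2
    _ = nsum N₁ fun z₁ => nsum M₂ fun z₂ => nsum M₃ fun z₃ => F z₁ z₂ z₃ :=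
        nsum_congr hN₁ fun z₁ i₁ _ => nsum_range hN₂ hM₂ fun z₂ i₂ hz => by
          obtain ⟨z₃, i₃, hz⟩ := exists_of_nsum_ne_zero hz
          exact (hF z₁ z₂ z₃ i₁ i₂ i₃ hz).2.1
    _ = nsum M₁ fun z₁ => nsum M₂ fun z₂ => nsum M₃ fun z₃ => F z₁ z₂ z₃ :=
        nsum_range hN₁ hM₁ fun z₁ i₁ hz => by
          obtain ⟨z₂, i₂, hz⟩ := exists_of_nsum_ne_zero hz
          obtain ⟨z₃, i₃, hz⟩ := exists_of_nsum_ne_zero hz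
          exact (hF z₁ z₂ z₃ i₁ i₂ i₃ hz).1
    _ = κ * tripleSum M₁ M₂ M₃ G := by
        unfold tripleSum nsum
        simp only [mul_sum]
        exact sum_congr rfl fun z₁ _ => sum_congr rfl fun z₂ _ => sum_congr rfl fun z₃ _ =>
          hG _ _ _ (isNat_natCast z₁) (isNat_natCast z₂) (isNat_natCast z₃)

section
variable {q : ℂ}

lemma le_of_termE_ne_zero {a b e f g z : ℚ} (h : termE q a b e f g z ≠ 0) : z ≤ e + f - g := by
  unfold termE at h
  simp only [mul_ne_zero_iff] at h
  have h1 := nonneg_of_qInvFact_ne_zero h.2.1.1.2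
  linarith

lemma nabla_swap (a b c : ℚ) : nabla q a b c = nabla q a c b := by
  unfold nabla
  rw [show a + c - b = a - b + c by ring, show a - c + b = a + b - c by ring,
    show a + c + b + 1 = a + b + c + 1 by ring, show c + b - a = b + c - a by ring]
  ring

variable (hq : IsGeneric q)
include hq

/-- The quotient of ∇ by Δ is [a+b+c+1]!/[b+c-a]!. Since roots are taken factor by factor, no
ambiguity of branches arises. -/
lemma triDelta_mul_eq_nabla {a b c : ℚ} (h : Tri a b c) :
    triDelta q a b c * (qFact q (a + b + c + 1) * qInvFact q (b + c - a)) = nabla q a b c := by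
  rw [qInvFact_of_nonneg h.n3.nonneg, ← qFactSqrt_mul_self q (a + b + c + 1),
    ← qFactSqrt_mul_self q (b + c - a)]
  unfold triDelta nabla
  have := qFactSqrt_ne_zero hq (a + b + c + 1)
  have := qFactSqrt_ne_zero hq (b + c - a)
  field_simp

lemma triDelta_mul_eq_inv_nabla {a b c : ℚ} (h : Tri a b c) :
    triDelta q a b c * (qInvFact q (a + b - c) * qInvFact q (a + c - b)) = (nabla q a b c)⁻¹ := by
  rw [qInvFact_of_nonneg h.n1.nonneg, qInvFact_of_nonneg h.n2.nonneg,
    ← qFactSqrt_mul_self q (a + b - c), ← qFactSqrt_mul_self q (a + c - b),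
    show a + c - b = a - b + c by ring]
  unfold triDelta nabla
  have := qFactSqrt_ne_zero hq (a + b + c + 1)
  have := qFactSqrt_ne_zero hq (b + c - a)
  have := qFactSqrt_ne_zero hq (a + b - c)
  have := qFactSqrt_ne_zero hq (a - b + c)
  field_simp

variable {a b e c d f h k g : ℚ} (H : NineTri a b e c d f h k g)
include H

lemma triDelta_mul_factorABD : triDelta q a b e * triDelta q c d f * triDelta q h k g
      * triDelta q a c h * triDelta q b d k * triDelta q e f g * factorABD q a b e c d f h k g =
    sgn (c + h - a) * (nabla q a b e * nabla q f e g * nabla q k b d /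
        (nabla q a c h * nabla q f c d * nabla q k g h)) := by
  rw [← triDelta_mul_eq_nabla hq H.abe, ← triDelta_mul_eq_nabla hq H.efg.swap12,
    ← triDelta_mul_eq_nabla hq H.bdk.rot.rot, div_eq_mul_inv, mul_inv, mul_inv,
    ← triDelta_mul_eq_inv_nabla hq H.ach, ← triDelta_mul_eq_inv_nabla hq H.cdf.rot.rot,
    ← triDelta_mul_eq_inv_nabla hq H.hkg.rot]
  unfold factorABD
  rw [triDelta_swap12 q f e g, triDelta_swap12 q k b d, triDelta_swap23 q b k d,
    triDelta_swap12 q f c d, triDelta_swap23 q c f d, triDelta_swap23 q k g h,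
    triDelta_swap12 q k h g, show f + e + g + 1 = e + f + g + 1 by ring,
    show k + b + d + 1 = d + k + b + 1 by ring, show b + d - k = d + b - k by ring,
    show a + h - c = h + a - c by ring]
  ring

lemma triDelta_mul_factorBBC : triDelta q a b e * triDelta q c d f * triDelta q h k g
      * triDelta q a c h * triDelta q b d k * triDelta q e f g * factorBBC q a b e c d f h k g =
    sgn (c + k - a - g) * (nabla q a c h * nabla q f e g * nabla q k b d /
        (nabla q a b e * nabla q f c d * nabla q k g h)) := by
  rw [← triDelta_mul_eq_nabla hq H.ach, ← triDelta_mul_eq_nabla hq H.efg.swap12,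
    ← triDelta_mul_eq_nabla hq H.bdk.rot.rot, div_eq_mul_inv, mul_inv, mul_inv,
    ← triDelta_mul_eq_inv_nabla hq H.abe, ← triDelta_mul_eq_inv_nabla hq H.cdf.rot.rot,
    ← triDelta_mul_eq_inv_nabla hq H.hkg.rot]
  unfold factorBBC
  rw [triDelta_swap12 q f e g, triDelta_swap12 q k b d, triDelta_swap23 q b k d,
    triDelta_swap12 q f c d, triDelta_swap23 q c f d, triDelta_swap23 q k g h,
    triDelta_swap12 q k h g, show f + e + g + 1 = e + f + g + 1 by ring,
    show k + b + d + 1 = d + k + b + 1 by ring, show b + d - k = d + b - k by ring,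
    show h + a + c + 1 = a + c + h + 1 by ring, show h + c - a = c + h - a by ring]
  ring

lemma sum_ABD_eq_tripleSum :
    (nsum (g + h - k) fun z₁ => nsum (d + k - b) fun z₂ => nsum (f + g - e) fun z₃ =>
      termA q k g h a c z₁ * termB q f c d k b z₂ * termD q a b e f g z₃
        * closedTriple q (k + a - h + z₁) (d + k - f - z₂) (a + f - e - z₃)) =
    qPow q ((f + h - e - k) * (a + d - e + k + 1) - (a - e + f) * (a - e + f + 1)) *
      tripleSum (g + h - k) (c + d - f) (a + b - e) (fun z₁ z₂ z₃ =>
        sgn (z₁ + z₂ + z₃) *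
        qPow q (-z₁ * (a + d - e + k - z₂ - z₃ + 1) + z₂ * (e - f - h + k + z₃)
          + z₃ * (a - d + f - h)) *
        qRatio q
          [g - h + k + z₁, a + c - h + z₁, 2 * h - z₁, 2 * d - z₂, c - d + f + z₂,
            b + e - a + z₃, e - f + g + z₃, a + d - e + k - z₂ - z₃]
          [z₁, g + h - k - z₁, c - a + h - z₁, z₂, d - b + k - z₂, c + d - f - z₂,
            b + d + k - z₂ + 1, z₃, a + b - e - z₃, f + g - e - z₃, 2 * e + z₃ + 1,
            a - d + f - h + z₁ + z₂, e - f - h + k + z₁ + z₃]) := by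
  refine nsum_eq_mul_tripleSum H.hkg.rot.n3 H.bdk.rot.n1 H.efg.n3 H.hkg.rot.n3 H.cdf.n1 H.abe.n1
    (fun z₁ z₂ z₃ i₁ i₂ i₃ hz => ?_) (fun z₁ z₂ z₃ i₁ i₂ i₃ => ?_)
  · simp only [mul_ne_zero_iff] at hz
    have t₁ := le_of_termA_ne_zero hz.1.1.1
    have t₂ := le_of_termB_ne_zero hz.1.1.2
    have t₃ := le_of_termD_ne_zero hz.1.2
    refine ⟨⟨?_, ?_⟩, ⟨?_, ?_⟩, ⟨?_, ?_⟩⟩ <;> linarith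
  · unfold termA termB termD closedTriple
    rw [sgn_add _ i₃.isInt, sgn_add _ i₂.isInt, show (d + k - f - z₂) * (a + f - e - z₃)
      - (k + a - h + z₁) * (d + k - f - z₂ + (a + f - e - z₃) + 1) =
      ((f + h - e - k) * (a + d - e + k + 1) - (a - e + f) * (a - e + f + 1)) +
      (-z₁ * (a + d - e + k - z₂ - z₃ + 1) + z₂ * (e - f - h + k + z₃)
          + z₃ * (a - d + f - h)) by ring, qPow_add hq.ne_zero]
    simp only [qRatio, List.map_cons, List.map_nil, List.prod_cons, List.prod_nil]
    generalize qPow q (_ - _) = P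
    generalize qPow q (_ + _) = P'
    ring_nf

lemma sum_ACD_eq_tripleSum :
    (nsum (g + h - k) fun z₁ => nsum (k + b - d) fun z₂ => nsum (f + g - e) fun z₃ =>
      termA q k g h a c z₁ * termC q f c d k b z₂ * termD q a b e f g z₃
        * (sgn (c + k - (a + f - e - z₃))
          * closedPairPair q (k + a - h + z₁) (f + b - z₂) (a + f - e - z₃))) =
    (sgn (c + k - a - f + e) *
      qPow q ((b + e - a) * (e - f - h + k) - (a - e + f + 1) * (a - e + f))) *
      tripleSum (g + h - k) (b - d + k) (a + b - e) (fun z₁ z₂ z₃ =>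
        sgn (z₁ + z₂) *
        qPow q (z₁ * (b + e - a - z₂ + z₃) + z₃ * (a + b + f - h + k - z₂ + 1)
          - z₂ * (e + k - f - h)) *
        qRatio q
          [a + c - h + z₁, g - h + k + z₁, 2 * h - z₁, 2 * b - z₂, b - c + f + k - z₂,
            b + c + f + k - z₂ + 1, b + e - a + z₃, e - f + g + z₃]
          [z₁, c + h - a - z₁, g + h - k - z₁, z₂, b - d + k - z₂, b + d + k - z₂ + 1,
            z₃, a + b - e - z₃, f + g - e - z₃, 2 * e + z₃ + 1, e + k - f - h + z₁ + z₃,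
            b + e - a - z₂ + z₃, a + b + f - h + k + z₁ - z₂ + 1]) := by
  have hC : IsNat (b - d + k) := H.bdk.n2.of_eq (by ring)
  refine nsum_eq_mul_tripleSum H.hkg.rot.n3 H.bdk.rot.n3 H.efg.n3 H.hkg.rot.n3 hC H.abe.n1
    (fun z₁ z₂ z₃ i₁ i₂ i₃ hz => ?_) (fun z₁ z₂ z₃ i₁ i₂ i₃ => ?_)
  · simp only [mul_ne_zero_iff] at hz
    have t₁ := le_of_termA_ne_zero hz.1.1.1
    have t₂ := le_of_termC_ne_zero hz.1.1.2
    have t₃ := le_of_termD_ne_zero hz.1.2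
    refine ⟨⟨?_, ?_⟩, ⟨?_, ?_⟩, ⟨?_, ?_⟩⟩ <;> linarith
  · unfold termA termC termD closedPairPair
    rw [show c + k - (a + f - e - z₃) = c + k - a - f + e + z₃ by ring, sgn_add _ i₃.isInt,
      sgn_add _ i₂.isInt, show (k + a - h + z₁) * (f + b - z₂)
      - (a + f - e - z₃) * (k + a - h + z₁ + (f + b - z₂) + 1) =
      ((b + e - a) * (e - f - h + k) - (a - e + f + 1) * (a - e + f)) +
      (z₁ * (b + e - a - z₂ + z₃) + z₃ * (a + b + f - h + k - z₂ + 1)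
          - z₂ * (e + k - f - h)) by ring, qPow_add hq.ne_zero]
    simp only [qRatio, List.map_cons, List.map_nil, List.prod_cons, List.prod_nil]
    generalize qPow q (_ - (a - e + f + 1) * _) = P
    generalize qPow q (_ - z₂ * _) = P'
    refine eq_of_eq_sgn_mul_self z₃ ?_
    ring_nf

lemma sum_CBC_eq_tripleSum :
    (nsum (a + c - h) fun z₁ => nsum (d + k - b) fun z₂ => nsum (f + g - e) fun z₃ =>
      termC q k g h a c z₁ * termB q f c d k b z₂ * termC q a b e f g z₃
        * (sgn (g + a - (d + k - f - z₂))
          * closedPairPair q (a + g - z₃) (k + c - z₁) (d + k - f - z₂))) =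
    (sgn (g + a - d - k + f) *
      qPow q ((c - d + f) * (a + g) - (d - f + k) * (c + k + 1))) *
      tripleSum (a + c - h) (c + d - f) (f + g - e) (fun z₁ z₂ z₃ =>
        sgn (z₁ + z₃) *
        qPow q (-z₁ * (a - d + f + g - k + z₂ - z₃) + z₂ * (a + c + g + k - z₃ + 1)
          - z₃ * (c - d + f)) *
        qRatio q
          [a + c - g + k - z₁, a + c + g + k - z₁ + 1, 2 * c - z₁, 2 * d - z₂,
            c - d + f + z₂, a - b + f + g - z₃, a + b + f + g - z₃ + 1, 2 * g - z₃]
          [z₁, a + c - h - z₁, a + c + h - z₁ + 1, z₂, d - b + k - z₂, c + d - f - z₂,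
            b + d + k - z₂ + 1, z₃, f + g - e - z₃, e + f + g - z₃ + 1,
            c - d + f - z₁ + z₂, a - d + f + g - k + z₂ - z₃,
            a + c + g + k - z₁ - z₃ + 1]) := by
  refine nsum_eq_mul_tripleSum H.ach.n1 H.bdk.rot.n1 H.efg.n3 H.ach.n1 H.cdf.n1 H.efg.n3
    (fun z₁ z₂ z₃ i₁ i₂ i₃ hz => ?_) (fun z₁ z₂ z₃ i₁ i₂ i₃ => ?_)
  · simp only [mul_ne_zero_iff] at hz
    have t₁ := le_of_termC_ne_zero hz.1.1.1
    have t₂ := le_of_termB_ne_zero hz.1.1.2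
    have t₃ := le_of_termC_ne_zero hz.1.2
    refine ⟨⟨?_, ?_⟩, ⟨?_, ?_⟩, ⟨?_, ?_⟩⟩ <;> linarith
  · unfold termB termC closedPairPair
    rw [show g + a - (d + k - f - z₂) = g + a - d - k + f + z₂ by ring, sgn_add _ i₂.isInt,
      sgn_add _ i₃.isInt, show (a + g - z₃) * (k + c - z₁)
      - (d + k - f - z₂) * (a + g - z₃ + (k + c - z₁) + 1) =
      ((c - d + f) * (a + g) - (d - f + k) * (c + k + 1)) +
      (-z₁ * (a - d + f + g - k + z₂ - z₃) + z₂ * (a + c + g + k - z₃ + 1)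
          - z₃ * (c - d + f)) by ring, qPow_add hq.ne_zero]
    simp only [qRatio, List.map_cons, List.map_nil, List.prod_cons, List.prod_nil]
    generalize qPow q (_ - (d - f + k) * _) = P
    generalize qPow q (_ - z₃ * _) = P'
    refine eq_of_eq_sgn_mul_self z₂ ?_
    ring_nf

/-- For the permuted symbol C yields z₂ and the two B yield z₃ and z₁; the sums are reordered
accordingly. -/
lemma sum_BBC_cycle_eq_tripleSum :
    (nsum (k + b - d) fun z₂ => nsum (e + f - g) fun z₃ => nsum (h + a - c) fun z₁ =>
      termC q f c d k b z₂ * termB q a b e f g z₃ * termB q k g h a c z₁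
        * closedTriple q (f + b - z₂) (e + f - a - z₃) (h + a - k - z₁)) =
      qPow q (-(a + h - k + 1) * (a + b - e) - (e + f - a) * (b + f + 1)) *
      tripleSum (g + h - k) (b - d + k) (e + f - g) (fun z₁ z₂ z₃ =>
        sgn (z₁ + z₂ + z₃) *
        qPow q (z₁ * (a + b - e - z₂ + z₃) + z₂ * (e + f + h - k - z₃ + 1)
          + z₃ * (b - a + f - h + k)) *
        qRatio q
          [2 * h - z₁, g - h + k + z₁, 2 * b - z₂, b - c + f + k - z₂,
            b + c + f + k - z₂ + 1, 2 * e - z₃, a + b - e + z₃, e + f - k + h - z₁ - z₃]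
          [z₁, a - c + h - z₁, g + h - k - z₁, a + c + h - z₁ + 1, z₂, b - d + k - z₂,
            b + d + k - z₂ + 1, z₃, e + f - g - z₃, b - a + e - z₃, e + f + g - z₃ + 1,
            b + f - h + k - a + z₁ - z₂, a + b - e - z₂ + z₃]) := by
  have hC : IsNat (b - d + k) := H.bdk.n2.of_eq (by ring)
  rw [nsum_congr H.bdk.rot.n3 fun z₂ _ _ => nsum_comm _ _ _, nsum_comm]
  refine nsum_eq_mul_tripleSum H.ach.rot.rot.n1 H.bdk.rot.n3 H.efg.n1 H.hkg.rot.n3 hC H.efg.n1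
    (fun z₁ z₂ z₃ i₁ i₂ i₃ hz => ?_) (fun z₁ z₂ z₃ i₁ i₂ i₃ => ?_)
  · simp only [mul_ne_zero_iff] at hz
    have t₁ := le_of_termC_ne_zero hz.1.1.1
    have t₂ := le_of_termB_ne_zero hz.1.1.2
    have t₃ := le_of_termB_ne_zero hz.1.2
    refine ⟨⟨?_, ?_⟩, ⟨?_, ?_⟩, ⟨?_, ?_⟩⟩ <;> linarith
  · unfold termB termC closedTriple
    rw [sgn_add _ i₃.isInt, sgn_add _ i₂.isInt, show (e + f - a - z₃) * (h + a - k - z₁)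
      - (f + b - z₂) * (e + f - a - z₃ + (h + a - k - z₁) + 1) =
      (-(a + h - k + 1) * (a + b - e) - (e + f - a) * (b + f + 1)) +
      (z₁ * (a + b - e - z₂ + z₃) + z₂ * (e + f + h - k - z₃ + 1)
          + z₃ * (b - a + f - h + k)) by ring, qPow_add hq.ne_zero]
    simp only [qRatio, List.map_cons, List.map_nil, List.prod_cons, List.prod_nil]
    generalize qPow q (_ - _) = P
    generalize qPow q (_ + _) = P'
    ring_nf

lemma sum_ABE_eq_tripleSum :
    (nsum (g + h - k) fun z₁ => nsum (d + k - b) fun z₂ => nsum (e + f - g) fun z₃ =>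
      termA q k g h a c z₁ * termB q f c d k b z₂ * termE q a b e f g z₃
        * (sgn (b + f - (k + a - h + z₁) + (e + f - g))
          * closedNum q (k + a - h + z₁) (e + a + f - z₃) (d + k - f - z₂))) =
    (sgn (b + f - k - a + h + (e + f - g)) *
      qPow q (-(a - b - h + f + k) * (a + b + e + 2) - (b - f) * (b - f + 1)
        + (d - b + k) * (e + f + h - k + 1))) *
      tripleSum (g + h - k) (c + d - f) (e + f - g) (fun z₁ z₂ z₃ =>
        sgn (z₂ + z₃) *
        qPow q (z₃ * (a - d + f - h + z₁ + z₂) - z₂ * (e + f + h - k - z₁ + 1)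
          - z₁ * (a + d + e + k + 2)) *
        qRatio q
          [k + g - h + z₁, a + c - h + z₁, 2 * h - z₁, 2 * d - z₂, c - d + f + z₂,
            2 * e - z₃, a + d + e + k - z₂ - z₃ + 1, e + f + h - k - z₁ - z₃]
          [z₁, g + h - k - z₁, c - a + h - z₁, z₂, d - b + k - z₂, c + d - f - z₂,
            b + d + k - z₂ + 1, z₃, a - b + e - z₃, e + f - g - z₃, e + f + g - z₃ + 1,
            a + b + e - z₃ + 1, a - d + f - h + z₁ + z₂]) := by
  refine nsum_eq_mul_tripleSum H.hkg.rot.n3 H.bdk.rot.n1 H.efg.n1 H.hkg.rot.n3 H.cdf.n1 H.efg.n1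
    (fun z₁ z₂ z₃ i₁ i₂ i₃ hz => ?_) (fun z₁ z₂ z₃ i₁ i₂ i₃ => ?_)
  · simp only [mul_ne_zero_iff] at hz
    have t₁ := le_of_termA_ne_zero hz.1.1.1
    have t₂ := le_of_termB_ne_zero hz.1.1.2
    have t₃ := le_of_termE_ne_zero hz.1.2
    refine ⟨⟨?_, ?_⟩, ⟨?_, ?_⟩, ⟨?_, ?_⟩⟩ <;> linarith
  · unfold termA termB termE closedNum
    rw [show b + f - (k + a - h + z₁) + (e + f - g) = b + f - k - a + h + (e + f - g) - z₁ by ring,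
      sgn_sub _ i₁.isInt, sgn_add _ i₃.isInt, show (d + k - f - z₂) * (e + a + f - z₃ + 1)
      - (k + a - h + z₁) * (d + k - f - z₂ + (e + a + f - z₃) + 2) =
      (-(a - b - h + f + k) * (a + b + e + 2) - (b - f) * (b - f + 1)
        + (d - b + k) * (e + f + h - k + 1)) +
      (z₃ * (a - d + f - h + z₁ + z₂) - z₂ * (e + f + h - k - z₁ + 1)
          - z₁ * (a + d + e + k + 2)) by ring, qPow_add hq.ne_zero]
    simp only [qRatio, List.map_cons, List.map_nil, List.prod_cons, List.prod_nil]
    generalize qPow q (_ + (d - b + k) * _) = P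
    generalize qPow q (_ - z₁ * _) = P'
    refine eq_of_eq_sgn_mul_self z₁ ?_
    ring_nf

end

section
variable {q : ℂ} (hq : IsGeneric q) {a b e c d f h k g : ℚ} (H : NineTri a b e c d f h k g)
include hq H

lemma triDelta_mul_factorBBC_cycle : triDelta q a b e * triDelta q c d f * triDelta q h k g
      * triDelta q a c h * triDelta q b d k * triDelta q e f g * factorBBC q f c d g h k e a b =
    sgn (b - a + f - g) * (nabla q a c h * nabla q f e g * nabla q k b d /
        (nabla q a b e * nabla q f c d * nabla q k g h)) := by
  have hs : sgn (b - a + f - g) = sgn (g + a - f - b) :=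
    sgn_congr (((H.abe.sum.isInt.add H.efg.n3.isInt).sub (H.abe.two1.isInt.add
      H.efg.two3.isInt)).of_eq (by ring))
  have rot : ∀ x y z, triDelta q x y z = triDelta q y z x := fun x y z => by
    rw [triDelta_swap12 q x y z, triDelta_swap23 q y x z]
  have key := triDelta_mul_factorBBC hq H.cycle
  rw [nabla_swap f g e, nabla_swap k d b, rot f c d, rot g h k, rot e a b, ← rot e f g,
    ← rot a c h, ← rot b d k] at key
  rw [hs]
  linear_combination key

end

end QNineJ

end

/-! ### The five formulas -/

open QNineJ in
theorem mainTheorem1 (q : ℂ) (hq : IsGeneric q) (a b e c d f h k g : ℚ)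
    (habe : Triad a b e) (hcdf : Triad c d f) (hhkg : Triad h k g)
    (hach : Triad a c h) (hbdk : Triad b d k) (hefg : Triad e f g) :
    (nineJ q a b e c d f h k g =
      sgn (c + h - a) *
      (nabla q a b e * nabla q f e g * nabla q k b d /
        (nabla q a c h * nabla q f c d * nabla q k g h)) *
      qPow q ((f + h - e - k) * (a + d - e + k + 1) - (a - e + f) * (a - e + f + 1)
        + Zexp d e h) *
      tripleSum (g + h - k) (c + d - f) (a + b - e) (fun z₁ z₂ z₃ =>
        sgn (z₁ + z₂ + z₃) *
        qPow q (-z₁ * (a + d - e + k - z₂ - z₃ + 1) + z₂ * (e - f - h + k + z₃)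
          + z₃ * (a - d + f - h)) *
        qRatio q
          [g - h + k + z₁, a + c - h + z₁, 2 * h - z₁, 2 * d - z₂, c - d + f + z₂,
            b + e - a + z₃, e - f + g + z₃, a + d - e + k - z₂ - z₃]
          [z₁, g + h - k - z₁, c - a + h - z₁, z₂, d - b + k - z₂, c + d - f - z₂,
            b + d + k - z₂ + 1, z₃, a + b - e - z₃, f + g - e - z₃, 2 * e + z₃ + 1,
            a - d + f - h + z₁ + z₂, e - f - h + k + z₁ + z₃])) ∧
    (nineJ q a b e c d f h k g =
      sgn (e - f - h + k) *
      (nabla q a b e * nabla q f e g * nabla q k b d /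
        (nabla q a c h * nabla q f c d * nabla q k g h)) *
      qPow q ((b + e - a) * (e - f - h + k) - (a - e + f + 1) * (a - e + f)
        + Zexp d e h) *
      tripleSum (g + h - k) (b - d + k) (a + b - e) (fun z₁ z₂ z₃ =>
        sgn (z₁ + z₂) *
        qPow q (z₁ * (b + e - a - z₂ + z₃) + z₃ * (a + b + f - h + k - z₂ + 1)
          - z₂ * (e + k - f - h)) *
        qRatio q
          [a + c - h + z₁, g - h + k + z₁, 2 * h - z₁, 2 * b - z₂, b - c + f + k - z₂,
            b + c + f + k - z₂ + 1, b + e - a + z₃, e - f + g + z₃]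
          [z₁, c + h - a - z₁, g + h - k - z₁, z₂, b - d + k - z₂, b + d + k - z₂ + 1,
            z₃, a + b - e - z₃, f + g - e - z₃, 2 * e + z₃ + 1, e + k - f - h + z₁ + z₃,
            b + e - a - z₂ + z₃, a + b + f - h + k + z₁ - z₂ + 1])) ∧
    (nineJ q a b e c d f h k g =
      sgn (c - d + f) *
      (nabla q a c h * nabla q f e g * nabla q k b d /
        (nabla q a b e * nabla q f c d * nabla q k g h)) *
      qPow q ((c - d + f) * (a + g) - (d - f + k) * (c + k + 1) + Zexp d e h) *
      tripleSum (a + c - h) (c + d - f) (f + g - e) (fun z₁ z₂ z₃ =>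
        sgn (z₁ + z₃) *
        qPow q (-z₁ * (a - d + f + g - k + z₂ - z₃) + z₂ * (a + c + g + k - z₃ + 1)
          - z₃ * (c - d + f)) *
        qRatio q
          [a + c - g + k - z₁, a + c + g + k - z₁ + 1, 2 * c - z₁, 2 * d - z₂,
            c - d + f + z₂, a - b + f + g - z₃, a + b + f + g - z₃ + 1, 2 * g - z₃]
          [z₁, a + c - h - z₁, a + c + h - z₁ + 1, z₂, d - b + k - z₂, c + d - f - z₂,
            b + d + k - z₂ + 1, z₃, f + g - e - z₃, e + f + g - z₃ + 1,
            c - d + f - z₁ + z₂, a - d + f + g - k + z₂ - z₃,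
            a + c + g + k - z₁ - z₃ + 1])) ∧
    (nineJ q a b e c d f h k g =
      sgn (b - a + f - g) *
      (nabla q a c h * nabla q f e g * nabla q k b d /
        (nabla q a b e * nabla q f c d * nabla q k g h)) *
      qPow q (-(a + h - k + 1) * (a + b - e) - (e + f - a) * (b + f + 1) + Zexp d e h) *
      tripleSum (g + h - k) (b - d + k) (e + f - g) (fun z₁ z₂ z₃ =>
        sgn (z₁ + z₂ + z₃) *
        qPow q (z₁ * (a + b - e - z₂ + z₃) + z₂ * (e + f + h - k - z₃ + 1)
          + z₃ * (b - a + f - h + k)) *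
        qRatio q
          [2 * h - z₁, g - h + k + z₁, 2 * b - z₂, b - c + f + k - z₂,
            b + c + f + k - z₂ + 1, 2 * e - z₃, a + b - e + z₃, e + f - k + h - z₁ - z₃]
          [z₁, a - c + h - z₁, g + h - k - z₁, a + c + h - z₁ + 1, z₂, b - d + k - z₂,
            b + d + k - z₂ + 1, z₃, e + f - g - z₃, b - a + e - z₃, e + f + g - z₃ + 1,
            b + f - h + k - a + z₁ - z₂, a + b - e - z₂ + z₃])) ∧
    (nineJ q a b e c d f h k g =
      sgn (c - b + e - g + k) *
      (nabla q a b e * nabla q f e g * nabla q k b d /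
        (nabla q a c h * nabla q f c d * nabla q k h g)) *
      qPow q (Zexp d e h - (a - b - h + f + k) * (a + b + e + 2) - (b - f) * (b - f + 1)
        + (d - b + k) * (e + f + h - k + 1)) *
      tripleSum (g + h - k) (c + d - f) (e + f - g) (fun z₁ z₂ z₃ =>
        sgn (z₂ + z₃) *
        qPow q (z₃ * (a - d + f - h + z₁ + z₂) - z₂ * (e + f + h - k - z₁ + 1)
          - z₁ * (a + d + e + k + 2)) *
        qRatio q
          [k + g - h + z₁, a + c - h + z₁, 2 * h - z₁, 2 * d - z₂, c - d + f + z₂,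
            2 * e - z₃, a + d + e + k - z₂ - z₃ + 1, e + f + h - k - z₁ - z₃]
          [z₁, g + h - k - z₁, c - a + h - z₁, z₂, d - b + k - z₂, c + d - f - z₂,
            b + d + k - z₂ + 1, z₃, a - b + e - z₃, e + f - g - z₃, e + f + g - z₃ + 1,
            a + b + e - z₃ + 1, a - d + f - h + z₁ + z₂])) := by
  have H : NineTri a b e c d f h k g :=
    ⟨habe.tri, hcdf.tri, hhkg.tri, hach.tri, hbdk.tri, hefg.tri⟩
  have q0 := hq.ne_zero
  have hag : IsNat (2 * (a + g)) := (H.abe.two1.add H.efg.two3).of_eq (by ring)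
  -- The same j-range has to serve the original and the cyclically permuted symbol, in which f+b
  -- takes the place of a+g.
  obtain ⟨j₀, N, h0, h1, hj, hM⟩ := exists_offset hag (max (a + g) (f + b))
  have hN := (le_max_left _ _).trans hM
  have hN' := (le_max_right _ _).trans hM
  have hj' : IsInt (f + b - j₀) := (((H.abe.sum.isInt.add H.efg.sum.isInt).sub hj).sub
    (h0.isInt.add H.abe.two3.isInt)).of_eq (by ring)
  have hABD := jsum_coreTerm_eq_sum_ABD hq H h0 h1 hj hN
  have hBBC := jsum_coreTerm_eq_sum_BBC hq H h0 h1 hj hN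
  have hcyc := jsum_coreTerm_eq_sum_BBC hq H.cycle h0 h1 hj' hN'
  rw [show coreTerm q f c d g h k e a b = coreTerm q a b e c d f h k g from
    funext fun j => coreTerm_cycle q a b e c d f h k g j] at hcyc
  have δABD := triDelta_mul_factorABD hq H
  have δBBC := triDelta_mul_factorBBC hq H
  have δcyc := triDelta_mul_factorBBC_cycle hq H
  rw [nineJ_eq_jsum hq H h0 h1 hj hN]
  refine ⟨?_, ?_, ?_, ?_, ?_⟩
  · rw [hABD, sum_ABD_eq_tripleSum hq H, qPow_add q0]
    generalize tripleSum _ _ _ _ = T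
    generalize qPow q (_ - _) = P
    linear_combination qPow q (Zexp d e h) * P * T * δABD
  · rw [hABD, sum_ABD_eq_sum_ACD hq H, sum_ACD_eq_tripleSum hq H, qPow_add q0,
      show sgn (e - f - h + k) = sgn (c + h - a) * sgn (c + k - a - f + e) from ?_]
    · generalize tripleSum _ _ _ _ = T
      generalize qPow q (_ - _) = P
      linear_combination qPow q (Zexp d e h) * sgn (c + k - a - f + e) * P * T * δABD
    · rw [mul_comm, ← sgn_add _ H.ach.n3.isInt]
      exact sgn_congr (H.ach.n3.isInt.neg.of_eq (by ring))
  · rw [hBBC, sum_BBC_eq_sum_CBC hq H, sum_CBC_eq_tripleSum hq H, qPow_add q0,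
      show sgn (c - d + f) = sgn (c + k - a - g) * sgn (g + a - d - k + f) from ?_]
    · generalize tripleSum _ _ _ _ = T
      generalize qPow q (_ - _) = P
      linear_combination qPow q (Zexp d e h) * sgn (g + a - d - k + f) * P * T * δBBC
    · rw [← sgn_add _ (((H.abe.sum.isInt.add H.efg.n3.isInt).sub (H.bdk.sum.isInt)).of_eq
        (by ring))]
      congr 1
      ring
  · rw [hcyc, sum_BBC_cycle_eq_tripleSum hq H, qPow_add q0]
    generalize tripleSum _ _ _ _ = T
    generalize qPow q (_ - _) = P
    linear_combination qPow q (Zexp d e h) * P * T * δcyc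
  · rw [hABD, sum_ABD_eq_sum_ABE hq H, sum_ABE_eq_tripleSum hq H, nabla_swap k h g,
      show sgn (c - b + e - g + k) = sgn (c + h - a) * sgn (b + f - k - a + h
          + (e + f - g)) from ?_,
      show Zexp d e h - (a - b - h + f + k) * (a + b + e + 2) - (b - f) * (b - f + 1)
        + (d - b + k) * (e + f + h - k + 1) = Zexp d e h + (-(a - b - h + f + k) * (a + b + e + 2)
        - (b - f) * (b - f + 1) + (d - b + k) * (e + f + h - k + 1)) by ring,
            qPow_add q0 (Zexp d e h)]
    · generalize tripleSum _ _ _ _ = T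
      generalize qPow q (_ + _) = P
      linear_combination qPow q (Zexp d e h) * sgn (b + f - k - a + h + (e + f - g)) * P * T * δABD
    · have hi : IsInt (b + f - k - a + h) := (((H.abe.sum.isInt.add H.efg.n3.isInt).sub
        H.hkg.n3.isInt).sub H.abe.two1.isInt).of_eq (by ring)
      rw [← sgn_add _ (hi.add H.efg.n1.isInt)]
      exact sgn_congr (hi.neg.of_eq (by ring))
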